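/- Let $Q=[-1,1]^2$ and let $\mathfrak h=(\mathfrak h_1,\mathfrak h_2,\mathfrak h_3)$ be an $L$ bi-Lipschitz, sense-preserving map from $Q$ onto the upper unit hemisphere $\{x\in\mathbb R^3:|x|=1,\ x_3\ge 0\}$, that is, $\tfrac1L|x-y|\le|\mathfrak h(x)-\mathfrak h(y)|\le L|x-y|$ for $x,y\in Q$, and $\det(\partial_1\mathfrak h,\partial_2\mathfrak h,\mathfrak h)>0$ almost everywhere in $Q$. Assume that $\mathfrak h$ is symmetric: $\mathfrak h_1(t,t)=\mathfrak h_2(t,t)$ and $\mathfrak h_1(t,-t)=-\mathfrak h_2(t,-t)$ for $|t|\le 1$. For $\lambda>1$ and $\nu>0$ put $h(x)=\lambda\,\mathfrak h(x/\lambda)$ for $x\in\lambda Q$, and let $\mathcal Z_\nu:\mathbb R^3\to\mathbb R^3$ be the Zorich map with scale factor $\lambda$, i.e. $$\mathcal Z_\nu(x_1,x_2,x_3)=\nu e^{x_3}h(x_1,x_2),\qquad (x_1,x_2,x_3)\in\lambda Q\times\mathbb R,$$ extended to $\mathbb R^3$ by repeated reflection across the sides of the beam $\lambda Q\times\mathbb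 R$ in the domain and across the plane $x_3=0$ in the range. For an open set $A\subset\mathbb R^3$ and a compact set $C\subset A$ let $\operatorname{cap}(A,C)=\inf_u\int_A|\nabla u|^3\,dm$, the infimum being over all non-negative $u\in C_0^\infty(A)$ with $u\ge1$ on $C$. A compact set $C$ has capacity zero if $\operatorname{cap}(A,C)=0$ for some bounded open set $A\supset C$, and an arbitrary set has capacity zero if all its compact subsets do. The Julia set $\mathcal J(f)$ of $f:\mathbb R^3\to\mathbb R^3$ is the set of all $x\in\mathbb R^3$ such that $\mathbb R^3\setminus\bigcup_{k=1}^\infty f^k(U)$ has capacity zero for every neighbourhood $U$ of $x$. **Theorem.** Let $\lambda>L^5$ and $\nu>\sqrt{2L/\lambda}$. Then $\mathcal J(\mathcal Z_\nu)=\mathbb R^3$. Moreover, for every non-empty open set $V\subset\mathbb R^3$, the union $\bigcup_{n\ge0}\mathcal Z_\nu^n(V)$ covers $\mathbb R^3\setminus\{0\}$. -/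

import Mathlib

open scoped ContDiff ENNReal Topology

noncomputable section

namespace Zorich

/-! ### Conformal capacity and the Julia set -/

/-- The conformal capacity of the condenser `(A, C)` in `ℝ^d`: the infimum of `∫_A |∇u|^d` over all
non-negative `u ∈ C_0^∞(A)` with `u ≥ 1` on `C`. Here `‖fderiv ℝ u x‖ = |∇u(x)|`, since the norm of
a linear functional on Euclidean space is the norm of the vector that represents it. -/
def condenserCap {d : ℕ} (A C : Set (EuclideanSpace ℝ (Fin d))) : ℝ≥0∞ :=
  ⨅ (u : EuclideanSpace ℝ (Fin d) → ℝ)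
    (_ : ContDiff ℝ ∞ u ∧ HasCompactSupport u ∧ tsupport u ⊆ A ∧ (∀ x, 0 ≤ u x) ∧
      ∀ x ∈ C, 1 ≤ u x),
    ∫⁻ x in A, ‖fderiv ℝ u x‖ₑ ^ d

/-- `cap S = 0`: every compact subset `F` of `S` has `cap (A, F) = 0` for some bounded open set `A`
containing `F`. -/
def CapZero {d : ℕ} (S : Set (EuclideanSpace ℝ (Fin d))) : Prop :=
  ∀ F ⊆ S, IsCompact F →
    ∃ A, IsOpen A ∧ Bornology.IsBounded A ∧ F ⊆ A ∧ condenserCap A F = 0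

/-- The Julia set of a self-map `f` of `ℝ^d`: the points `x` such that, for every neighbourhood `U`
of `x`, the set omitted by all the forward images `f^k(U)`, `k ≥ 1`, has capacity zero. -/
def juliaSet {d : ℕ} (f : EuclideanSpace ℝ (Fin d) → EuclideanSpace ℝ (Fin d)) :
    Set (EuclideanSpace ℝ (Fin d)) :=
  {x | ∀ U ∈ 𝓝 x, CapZero (⋃ k : ℕ, ⋃ _ : 1 ≤ k, f^[k] '' U)ᶜ}

/-! ### Zorich maps -/

/-- The square `Q = [-1, 1]²`. -/
def square : Set (EuclideanSpace ℝ (Fin 2)) := {x | |x 0| ≤ 1 ∧ |x 1| ≤ 1}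

/-- The closed upper unit hemisphere in `ℝ³`. -/
def upperHemisphere : Set (EuclideanSpace ℝ (Fin 3)) :=
  {y | y 0 ^ 2 + y 1 ^ 2 + y 2 ^ 2 = 1 ∧ 0 ≤ y 2}

/-- The determinant with columns `∂₁h(x)`, `∂₂h(x)`, `h(x)`, which is the Jacobian determinant at
`(x₁, x₂, 0)` of the map `(x₁, x₂, x₃) ↦ e^{x₃} h(x₁, x₂)`. -/
def orientationDet (h : EuclideanSpace ℝ (Fin 2) → EuclideanSpace ℝ (Fin 3))
    (x : EuclideanSpace ℝ (Fin 2)) : ℝ :=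
  Matrix.det (Matrix.of fun i j : Fin 3 =>
    (![fderiv ℝ h x (EuclideanSpace.single 0 1), fderiv ℝ h x (EuclideanSpace.single 1 1), h x] j) i)

/-- `h` maps the square `Q` onto the upper hemisphere, is `L` bi-Lipschitz and sense-preserving
there, and is symmetric: it maps the two diagonals of `Q` into the planes `y₁ = y₂` and `y₁ = -y₂`
respectively. Only the values of `h` on `Q` matter. A Lipschitz map is differentiable almost
everywhere, so being sense-preserving is expressed by the sign of the Jacobian determinant almost
everywhere (the determinant is zero at points of non-differentiability, by convention). -/
structure IsSymmetricGenerator (L : ℝ)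
    (h : EuclideanSpace ℝ (Fin 2) → EuclideanSpace ℝ (Fin 3)) : Prop where
  image_square : h '' square = upperHemisphere
  dist_le : ∀ x ∈ square, ∀ y ∈ square, dist (h x) (h y) ≤ L * dist x y
  le_dist : ∀ x ∈ square, ∀ y ∈ square, dist x y ≤ L * dist (h x) (h y)
  sensePreserving : ∀ᵐ x ∂(MeasureTheory.volume.restrict square), 0 < orientationDet h x
  diagonal : ∀ t : ℝ, |t| ≤ 1 → h !₂[t, t] 0 = h !₂[t, t] 1
  antidiagonal : ∀ t : ℝ, |t| ≤ 1 → h !₂[t, -t] 0 = -h !₂[t, -t] 1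

/-- The rescaled map `x ↦ lam • h(x / lam)` on the square `[-lam, lam]²`. -/
def rescale (lam : ℝ) (h : EuclideanSpace ℝ (Fin 2) → EuclideanSpace ℝ (Fin 3))
    (x : EuclideanSpace ℝ (Fin 2)) : EuclideanSpace ℝ (Fin 3) :=
  lam • h (lam⁻¹ • x)

/-- The index `k` of an interval `[(2k-1)lam, (2k+1)lam]` that contains `t`. -/
def cell (lam t : ℝ) : ℤ := round (t / (2 * lam))

/-- The point of `[-lam, lam]` obtained from `t` by successive reflections in the points
`(2k+1)lam`, `k ∈ ℤ`; it takes `|cell lam t|` reflections. -/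
def fold (lam t : ℝ) : ℝ := (-1) ^ cell lam t * (t - 2 * lam * cell lam t)

/-- The Zorich map `𝒵_ν` with scale factor `lam`. On the beam `[-lam, lam]² × ℝ` it is
`ν e^{x₃} (rescale lam h)(x₁, x₂)`. It is extended to `ℝ³` by reflecting repeatedly across the sides
of the beam in the domain and the plane `x₃ = 0` in the range: `(x₁, x₂)` is folded into the square
and the sign of the third coordinate of the image changes once for each reflection. -/
def zorich (h : EuclideanSpace ℝ (Fin 2) → EuclideanSpace ℝ (Fin 3)) (lam nu : ℝ)
    (x : EuclideanSpace ℝ (Fin 3)) : EuclideanSpace ℝ (Fin 3) :=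
  let y := (nu * Real.exp (x 2)) • rescale lam h !₂[fold lam (x 0), fold lam (x 1)]
  !₂[y 0, y 1, (-1) ^ (cell lam (x 0) + cell lam (x 1)) * y 2]

end Zorich

end

namespace Zorich

open Set Metric Filter MeasureTheory

/-! Write `Z` for the Zorich map. In polar form `Z x = ν λ e^{x₂} · dir x`: the height determines
the norm of the image, and the horizontal position determines its direction. On each beam `Z` is a
homeomorphism onto a punctured closed half-space, with explicit lower distance bounds, and `Z` is
open. The proof pushes a given open set `V` through three stages.

Some iterate of `V` meets the planes over the diagonals of the beams (`exists_iterate_mem_plane`).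
These planes cut space into diamond-shaped beams on which `Z` is injective. If all iterates of a
ball stayed inside diamonds, two facts would collide. The measure with density `axisDist ^ (-3)` is
expanded by a factor beyond some `q > 1`: volume grows by `(ν e^s / L)³ · L λ` while the distance
from the axis grows by at most `L ν e^s`, and the quotient `λ / L⁵` exceeds `1`. By Borel-Cantelli
some orbit then returns to bounded sets only ever closer to the axis. But near the axis heights grow
like iterated exponentials, and the image balls grow with them, so they become too large for a
diamond (`orbit_obstruction`).

Because the generator is symmetric, the next iterate meets a plane `x₁ = ± x₀`, which `Z` maps into
itself. There the orbit of a point either hits the centre of a beam, after which it climbs the axis,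
or all images of a small plane disc stay in strips on which area is expanded by `ν² λ / (2 L) > 1`.
Borel-Cantelli again yields a point whose height tends to infinity (`exists_tendsto_height`).

Along such an orbit the images of `V` contain arbitrarily large balls. A large ball maps over a
thick spherical shell, and that shell contains a preimage of any prescribed non-zero point
(`exists_mem_image_of_tendsto`). Hence only `0` can be omitted, and a point has conformal capacity
zero (`capZero_of_subset_singleton`). -/

/-! ### Invariance of boundaries in the plane, via continuous logarithms. -/

/-- A continuous map into `ℂ \ {0}` that is homotopic in `ℂ \ {0}` to a constant has a continuous
logarithm. -/
lemma exists_continuous_log {X : Type*} [TopologicalSpace X] (H : unitInterval × X → ℂ)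
    (hH : Continuous H) (h0 : ∀ q, H q ≠ 0) (c : ℂ) (hc : ∀ x, H (0, x) = c) :
    ∃ l : X → ℂ, Continuous l ∧ ∀ x, Complex.exp (l x) = H (1, x) := by
  rcases isEmpty_or_nonempty X with hX | ⟨⟨x₀⟩⟩
  · exact ⟨fun _ => 0, continuous_const, fun x => (hX.false x).elim⟩
  have hc0 : c ≠ 0 := hc x₀ ▸ h0 _
  let H' : C(unitInterval × X, {z : ℂ // z ≠ 0}) := ⟨fun q => ⟨H q, h0 q⟩, by fun_prop⟩
  let f : C(X, ℂ) := .const X (Complex.log c)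
  have h00 : ∀ a, H' (0, a) = ⟨Complex.exp (f a), Complex.exp_ne_zero _⟩ := fun a => by
    apply Subtype.ext
    simp [H', f, hc, Complex.exp_log hc0]
  let G := Complex.isCoveringMap_exp.liftHomotopy H' f h00
  refine ⟨fun x => G (1, x), by fun_prop, fun x => ?_⟩
  have := congr_fun (Complex.isCoveringMap_exp.liftHomotopy_lifts H' f h00) (1, x)
  exact congr_arg Subtype.val this

/-- There is no continuous logarithm on a circle around the origin. -/
lemma not_continuous_log_circle {r : ℝ} (l : ℝ → ℂ) (hl : Continuous l)
    (h : ∀ θ : ℝ, Complex.exp (l θ) = r * Complex.exp (θ * Complex.I))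
    (hper : l (2 * Real.pi) = l 0) : False := by
  -- Two lifts through the exponential that agree at `0` agree everywhere, so `l θ = l 0 + iθ`,
  -- which is not `2π`-periodic.
  have key := Complex.isCoveringMap_exp.eq_of_comp_eq (g₁ := l)
    (g₂ := fun θ : ℝ => l 0 + θ * Complex.I) hl (by fun_prop) (by
      funext θ
      apply Subtype.ext
      simp [Complex.exp_add, h]) 0 (by simp)
  have h2 := congr_fun key (2 * Real.pi)
  rw [hper] at h2
  simp [Complex.I_ne_zero, Real.pi_ne_zero] at h2

/-- A homeomorphism of a set `A` onto a plane set cannot map a point `a`, for which `A \ {a}` is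
star-shaped, to an interior point of the image. -/
lemma notMem_interior_image {E : Type*} [NormedAddCommGroup E] [NormedSpace ℝ E] {A : Set E}
    {a c : E} (ha : a ∈ A)
    (star : ∀ z ∈ A, z ≠ a → ∀ t : ℝ, 0 ≤ t → t ≤ 1 → c + t • (z - c) ∈ A ∧ c + t • (z - c) ≠ a)
    {φ : E → ℂ} {ψ : ℂ → E} (hφ : ContinuousOn φ A) (hψ : ContinuousOn ψ (φ '' A))
    (left : ∀ z ∈ A, ψ (φ z) = z) : φ a ∉ interior (φ '' A) := by
  intro hint
  obtain ⟨r, hr, hball⟩ : ∃ r > 0, closedBall (φ a) r ⊆ φ '' A :=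
    nhds_basis_closedBall.mem_iff.1 (mem_interior_iff_mem_nhds.1 hint)
  have inj : ∀ z ∈ A, φ z = φ a → z = a := fun z hz h => by rw [← left z hz, h, left a ha]
  let S := {z : E // z ∈ A ∧ z ≠ a}
  have hmem : ∀ q : unitInterval × S, c + (q.1 : ℝ) • ((q.2 : E) - c) ∈ A := fun q =>
    (star q.2.1 q.2.2.1 q.2.2.2 q.1 q.1.2.1 q.1.2.2).1
  -- Contracting `A \ {a}` to `c` along segments avoids `a`, so `φ - φ a` is null-homotopic in `ℂ \
  -- {0}` and has a logarithm. If `φ a` were interior, pulling this back by `ψ` to a small circle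
  -- around `φ a` would give a logarithm on the circle.
  obtain ⟨l, hl, hexp⟩ := exists_continuous_log (X := S)
    (fun q => φ (c + (q.1 : ℝ) • ((q.2 : E) - c)) - φ a)
    ((hφ.comp_continuous (continuous_const.add ((continuous_subtype_val.comp continuous_fst).smul
      ((continuous_subtype_val.comp continuous_snd).sub continuous_const))) hmem).sub
      continuous_const)
    (fun q h => (star q.2.1 q.2.2.1 q.2.2.2 q.1 q.1.2.1 q.1.2.2).2
      (inj _ (hmem q) (sub_eq_zero.1 h)))
    (φ c - φ a) (fun x => by simp)
  let y : ℝ → ℂ := fun θ => φ a + r * Complex.exp (θ * Complex.I)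
  have hy : ∀ θ, y θ ∈ φ '' A := fun θ => hball (by
    simp [y, Complex.norm_exp_ofReal_mul_I, abs_of_pos hr])
  have hψy : ∀ θ, ψ (y θ) ∈ A ∧ φ (ψ (y θ)) = y θ := fun θ => by
    obtain ⟨z, hz, h⟩ := hy θ
    rw [← h, left z hz]
    exact ⟨hz, rfl⟩
  have hne : ∀ θ, ψ (y θ) ≠ a := fun θ h => by
    have := (hψy θ).2
    rw [h] at this
    simp [y, hr.ne'] at this
  let s : ℝ → S := fun θ => ⟨ψ (y θ), (hψy θ).1, hne θ⟩
  have hs : Continuous s := by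
    refine Continuous.subtype_mk (hψ.comp_continuous ?_ hy) _
    fun_prop
  refine not_continuous_log_circle (r := r) (fun θ => l (s θ)) (hl.comp hs) (fun θ => ?_) ?_
  · rw [hexp]
    change φ (c + (1 : ℝ) • (ψ (y θ) - c)) - φ a = _
    rw [one_smul, add_sub_cancel, (hψy θ).2, add_sub_cancel_left]
  · congr 1
    have hyy : y (2 * Real.pi) = y 0 := by simp [y]
    exact Subtype.ext (congrArg ψ hyy)

/-! ### Coordinates in dimensions two and three. -/

lemma dist_sq_two (x y : EuclideanSpace ℝ (Fin 2)) :
    dist x y ^ 2 = (x 0 - y 0) ^ 2 + (x 1 - y 1) ^ 2 := by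
  rw [EuclideanSpace.dist_eq, Real.sq_sqrt (by positivity)]
  simp [Fin.sum_univ_two, Real.dist_eq, sq_abs]

lemma dist_sq_three (x y : EuclideanSpace ℝ (Fin 3)) :
    dist x y ^ 2 = (x 0 - y 0) ^ 2 + (x 1 - y 1) ^ 2 + (x 2 - y 2) ^ 2 := by
  rw [EuclideanSpace.dist_eq, Real.sq_sqrt (by positivity)]
  simp [Fin.sum_univ_three, Real.dist_eq, sq_abs]

lemma norm_sq_two (x : EuclideanSpace ℝ (Fin 2)) : ‖x‖ ^ 2 = x 0 ^ 2 + x 1 ^ 2 := by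
  simpa using dist_sq_two x 0

lemma norm_sq_three (x : EuclideanSpace ℝ (Fin 3)) : ‖x‖ ^ 2 = x 0 ^ 2 + x 1 ^ 2 + x 2 ^ 2 := by
  simpa using dist_sq_three x 0

lemma abs_coord_le_norm {d : ℕ} (x : EuclideanSpace ℝ (Fin d)) (i : Fin d) : |x i| ≤ ‖x‖ := by
  simpa using PiLp.norm_apply_le x i

lemma ext_two {x y : EuclideanSpace ℝ (Fin 2)} (h0 : x 0 = y 0) (h1 : x 1 = y 1) : x = y := by
  ext i; fin_cases i <;> assumption

lemma ext_three {x y : EuclideanSpace ℝ (Fin 3)} (h0 : x 0 = y 0) (h1 : x 1 = y 1)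
    (h2 : x 2 = y 2) : x = y := by
  ext i; fin_cases i <;> assumption

lemma continuous_mk_two {X : Type*} [TopologicalSpace X] {f g : X → ℝ} (hf : Continuous f)
    (hg : Continuous g) : Continuous fun x => (!₂[f x, g x] : EuclideanSpace ℝ (Fin 2)) := by
  refine (PiLp.continuous_toLp 2 _).comp (continuous_pi fun i => ?_)
  fin_cases i <;> simpa

lemma continuous_mk_three {X : Type*} [TopologicalSpace X] {f g k : X → ℝ} (hf : Continuous f)
    (hg : Continuous g) (hk : Continuous k) :
    Continuous fun x => (!₂[f x, g x, k x] : EuclideanSpace ℝ (Fin 3)) := by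
  refine (PiLp.continuous_toLp 2 _).comp (continuous_pi fun i => ?_)
  fin_cases i <;> simpa

/-! ### Elementary and topological properties of the generator. -/

namespace IsSymmetricGenerator

variable {L : ℝ} {h : EuclideanSpace ℝ (Fin 2) → EuclideanSpace ℝ (Fin 3)}

lemma mem_upperHemisphere (hh : IsSymmetricGenerator L h) {x : EuclideanSpace ℝ (Fin 2)}
    (hx : x ∈ square) : h x ∈ upperHemisphere := hh.image_square ▸ mem_image_of_mem h hx

lemma norm_map (hh : IsSymmetricGenerator L h) {x : EuclideanSpace ℝ (Fin 2)} (hx : x ∈ square) :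
    ‖h x‖ = 1 := by
  have h1 := norm_sq_three (h x)
  rw [(hh.mem_upperHemisphere hx).1] at h1
  nlinarith [norm_nonneg (h x)]

lemma nonneg_map (hh : IsSymmetricGenerator L h) {x : EuclideanSpace ℝ (Fin 2)}
    (hx : x ∈ square) : 0 ≤ h x 2 := (hh.mem_upperHemisphere hx).2

lemma one_le (hh : IsSymmetricGenerator L h) : 1 ≤ L := by
  have m0 : (0 : EuclideanSpace ℝ (Fin 2)) ∈ square := by simp [square]
  have m1 : (!₂[1, 0] : EuclideanSpace ℝ (Fin 2)) ∈ square := by simp [square]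
  have d : dist (!₂[1, 0] : EuclideanSpace ℝ (Fin 2)) 0 = 1 := by
    have h := norm_sq_two (!₂[1, 0] : EuclideanSpace ℝ (Fin 2))
    simp only [Matrix.cons_val_zero, Matrix.cons_val_one] at h
    rw [dist_zero_right]
    nlinarith [norm_nonneg (!₂[1, 0] : EuclideanSpace ℝ (Fin 2))]
  have h1 := hh.dist_le _ m1 _ m0
  have h2 := hh.le_dist _ m1 _ m0
  rw [d] at h1 h2
  have h3 : 0 ≤ dist (h !₂[1, 0]) (h 0) := dist_nonneg
  nlinarith

lemma injOn (hh : IsSymmetricGenerator L h) : InjOn h square := fun x hx y hy hxy => by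
  have := hh.le_dist x hx y hy
  rw [hxy, dist_self, mul_zero] at this
  exact dist_le_zero.1 this

lemma continuousOn (hh : IsSymmetricGenerator L h) : ContinuousOn h square :=
  (LipschitzOnWith.of_dist_le_mul (K := L.toNNReal) fun x hx y hy => by
    rw [Real.coe_toNNReal _ (zero_le_one.trans hh.one_le)]
    exact hh.dist_le x hx y hy).continuousOn

lemma exists_eq (hh : IsSymmetricGenerator L h) {y : EuclideanSpace ℝ (Fin 3)}
    (hy : y ∈ upperHemisphere) : ∃ x ∈ square, h x = y := by
  rw [← hh.image_square] at hy
  exact hy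

lemma exists_inverse (hh : IsSymmetricGenerator L h) :
    ∃ k : EuclideanSpace ℝ (Fin 3) → EuclideanSpace ℝ (Fin 2),
      (∀ y ∈ upperHemisphere, k y ∈ square ∧ h (k y) = y) ∧ (∀ x ∈ square, k (h x) = x) ∧
      ContinuousOn k upperHemisphere := by
  choose! k hk using fun y (hy : y ∈ upperHemisphere) => hh.exists_eq hy
  refine ⟨k, hk, fun x hx => hh.injOn (hk _ (hh.mem_upperHemisphere hx)).1 hx
    (hk _ (hh.mem_upperHemisphere hx)).2, ?_⟩
  refine (LipschitzOnWith.of_dist_le_mul (K := L.toNNReal) fun x hx y hy => ?_).continuousOn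
  rw [Real.coe_toNNReal _ (zero_le_one.trans hh.one_le)]
  have := hh.le_dist _ (hk x hx).1 _ (hk y hy).1
  rwa [(hk x hx).2, (hk y hy).2] at this

/-- The centre lies on both diagonals, so its image lies in both planes `y₁ = ± y₀`, that is, on the
vertical axis. -/
lemma map_zero (hh : IsSymmetricGenerator L h) : h 0 = !₂[0, 0, 1] := by
  have m0 : (0 : EuclideanSpace ℝ (Fin 2)) ∈ square := by simp [square]
  have e : (!₂[0, 0] : EuclideanSpace ℝ (Fin 2)) = 0 := ext_two (by simp) (by simp)
  have h1 := hh.diagonal 0 (by simp)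
  have h2 := hh.antidiagonal 0 (by simp)
  rw [neg_zero] at h2
  rw [e] at h1 h2
  have h0 : h 0 0 = 0 := by linarith
  have h0' : h 0 1 = 0 := by linarith
  have h3 := (hh.mem_upperHemisphere m0).1
  have h4 := hh.nonneg_map m0
  rw [h0, h0'] at h3
  refine ext_three (by simpa) (by simpa) ?_
  have : h 0 2 = 1 := by nlinarith
  simpa

/-- Interior points of the square are mapped into the open hemisphere. -/
lemma pos_of_interior (hh : IsSymmetricGenerator L h) {x : EuclideanSpace ℝ (Fin 2)}
    (h0 : |x 0| < 1) (h1 : |x 1| < 1) : 0 < h x 2 := by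
  have hx : x ∈ square := ⟨h0.le, h1.le⟩
  refine (hh.nonneg_map hx).lt_of_ne fun h2 => ?_
  obtain ⟨k, hk, hk', hkc⟩ := hh.exists_inverse
  let up : ℂ → EuclideanSpace ℝ (Fin 3) := fun z => !₂[z.re, z.im, √(1 - z.re ^ 2 - z.im ^ 2)]
  have hup : ∀ z ∈ closedBall (0 : ℂ) 1, up z ∈ upperHemisphere := fun z hz => by
    have : z.re ^ 2 + z.im ^ 2 ≤ 1 := by
      have h := Complex.sq_norm z
      rw [Complex.normSq_apply] at h
      rw [mem_closedBall_zero_iff] at hz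
      nlinarith [norm_nonneg z]
    refine ⟨?_, by simp [up, Real.sqrt_nonneg]⟩
    have h := Real.sq_sqrt (show 0 ≤ 1 - z.re ^ 2 - z.im ^ 2 by linarith)
    simp only [up, Matrix.cons_val_zero, Matrix.cons_val_one, Matrix.cons_val]
    linarith
  have hupc : Continuous up := continuous_mk_three (by fun_prop) (by fun_prop) (by fun_prop)
  let toC : EuclideanSpace ℝ (Fin 2) → ℂ := fun w => ⟨w 0, w 1⟩
  have htoC : Continuous toC := by
    have : toC = fun w : EuclideanSpace ℝ (Fin 2) => ((w 0 : ℝ) : ℂ) + (w 1 : ℝ) * Complex.I := by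
      funext w; apply Complex.ext <;> simp [toC]
    rw [this]; fun_prop
  let ofC : ℂ → EuclideanSpace ℝ (Fin 2) := fun z => !₂[z.re, z.im]
  have hofC : Continuous ofC := continuous_mk_two (by fun_prop) (by fun_prop)
  let a : ℂ := ⟨h x 0, h x 1⟩
  have hup_proj : ∀ w ∈ square, up ⟨h w 0, h w 1⟩ = h w := fun w hw => by
    have := (hh.mem_upperHemisphere hw).1
    refine ext_three (by simp [up]) (by simp [up]) ?_
    simp only [up, Matrix.cons_val]
    rw [show 1 - h w 0 ^ 2 - h w 1 ^ 2 = h w 2 ^ 2 by linarith, Real.sqrt_sq (hh.nonneg_map hw)]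
  have hball : ∀ w ∈ square, (⟨h w 0, h w 1⟩ : ℂ) ∈ closedBall (0 : ℂ) 1 := fun w hw => by
    have := (hh.mem_upperHemisphere hw).1
    have h' := Complex.sq_norm ⟨h w 0, h w 1⟩
    rw [Complex.normSq_apply] at h'
    rw [mem_closedBall_zero_iff]
    nlinarith [sq_nonneg (h w 2), norm_nonneg (⟨h w 0, h w 1⟩ : ℂ)]
  have ha1 : ‖a‖ = 1 := by
    have := (hh.mem_upperHemisphere hx).1
    have h' := Complex.sq_norm a
    rw [Complex.normSq_apply] at h'
    rw [← h2] at this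
    have h3 : ‖a‖ ^ 2 = 1 := by rw [h']; simp only [a]; linarith
    nlinarith [norm_nonneg a]
  have hka : k (up a) = x := by rw [hup_proj x hx, hk' x hx]
  -- The hemisphere is identified with the closed disc by vertical projection. If `h x` were on the
  -- equator, `h⁻¹` would send the boundary point `a` of the disc to an interior point of the
  -- square. Segments from `0` reach the unit circle only at their ends, so the disc without `a` is
  -- still star-shaped.
  have := notMem_interior_image (A := closedBall (0 : ℂ) 1) (a := a) (c := 0)
    (φ := fun z => toC (k (up z))) (ψ := fun z => ⟨h (ofC z) 0, h (ofC z) 1⟩) (hball x hx)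
    (fun z hz hza t ht0 ht1 => ?_) ?_ ?_ (fun z hz => ?_)
  · apply this
    have himg : toC '' square ⊆ (fun z => toC (k (up z))) '' closedBall (0 : ℂ) 1 := by
      rintro _ ⟨w, hw, rfl⟩
      exact ⟨_, hball w hw, by simp only [hup_proj w hw, hk' w hw]⟩
    refine interior_mono himg ?_
    rw [mem_interior]
    refine ⟨{z | |z.re| < 1 ∧ |z.im| < 1}, fun z hz => ⟨ofC z, ⟨?_, ?_⟩, ?_⟩, ?_, ?_⟩
    · simpa [ofC] using hz.1.le
    · simpa [ofC] using hz.2.le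
    · simp [toC, ofC]
    · exact (isOpen_lt (f := fun z : ℂ => |z.re|) (by fun_prop) continuous_const).inter
        (isOpen_lt (f := fun z : ℂ => |z.im|) (by fun_prop) continuous_const)
    · simp only [hka]
      exact ⟨h0, h1⟩
  · rw [mem_closedBall_zero_iff] at hz ⊢
    simp only [sub_zero, zero_add, norm_smul, Real.norm_eq_abs, abs_of_nonneg ht0]
    refine ⟨by nlinarith [norm_nonneg z], fun h => hza ?_⟩
    have hn : t * ‖z‖ = 1 := by rw [← ha1, ← h, norm_smul, Real.norm_eq_abs, abs_of_nonneg ht0]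
    have : t = 1 := by nlinarith [norm_nonneg z]
    rwa [this, one_smul] at h
  · exact htoC.comp_continuousOn (hkc.comp hupc.continuousOn hup)
  · have hm : MapsTo ofC ((fun z => toC (k (up z))) '' closedBall (0 : ℂ) 1) square := by
      rintro _ ⟨z, hz, rfl⟩
      have := (hk _ (hup z hz)).1
      exact ⟨by simpa [ofC, toC] using this.1, by simpa [ofC, toC] using this.2⟩
    have hc := hh.continuousOn.comp hofC.continuousOn hm
    have : Continuous fun y : EuclideanSpace ℝ (Fin 3) => (⟨y 0, y 1⟩ : ℂ) := by
      have : (fun y : EuclideanSpace ℝ (Fin 3) => (⟨y 0, y 1⟩ : ℂ)) =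
          fun y => ((y 0 : ℝ) : ℂ) + (y 1 : ℝ) * Complex.I := by
        funext w; apply Complex.ext <;> simp
      rw [this]; fun_prop
    exact this.comp_continuousOn hc
  · have e : ofC (toC (k (up z))) = k (up z) := ext_two (by simp [ofC, toC]) (by simp [ofC, toC])
    simp only [e, (hk _ (hup z hz)).2]
    simp [up]

/-- Boundary points of the square are mapped to the equator. -/
lemma eq_zero_of_boundary (hh : IsSymmetricGenerator L h) {x : EuclideanSpace ℝ (Fin 2)}
    (hx : x ∈ square) (hb : |x 0| = 1 ∨ |x 1| = 1) : h x 2 = 0 := by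
  by_contra h2
  obtain ⟨k, hk, hk', hkc⟩ := hh.exists_inverse
  let up : ℂ → EuclideanSpace ℝ (Fin 3) := fun z => !₂[z.re, z.im, √(1 - z.re ^ 2 - z.im ^ 2)]
  have hupc : Continuous up := continuous_mk_three (by fun_prop) (by fun_prop) (by fun_prop)
  let pr : EuclideanSpace ℝ (Fin 3) → ℂ := fun y => ⟨y 0, y 1⟩
  have hpr : Continuous pr := by
    have : pr = fun y => ((y 0 : ℝ) : ℂ) + (y 1 : ℝ) * Complex.I := by
      funext w; apply Complex.ext <;> simp [pr]
    rw [this]; fun_prop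
  have hup_pr : ∀ y ∈ upperHemisphere, up (pr y) = y := fun y hy => by
    refine ext_three (by simp [up, pr]) (by simp [up, pr]) ?_
    simp only [up, pr, Matrix.cons_val]
    rw [show 1 - y 0 ^ 2 - y 1 ^ 2 = y 2 ^ 2 by linarith [hy.1], Real.sqrt_sq hy.2]
  -- The same argument with the roles of the square and the disc exchanged.
  have := notMem_interior_image (A := square) (a := x) (c := 0)
    (φ := fun w => pr (h w)) (ψ := fun z => k (up z)) hx
    (fun z hz hza t ht0 ht1 => ?_) (hpr.comp_continuousOn hh.continuousOn) ?_ (fun z hz => ?_)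
  · apply this
    rw [mem_interior]
    refine ⟨{z | z.re ^ 2 + z.im ^ 2 < 1}, fun z hz => ?_, ?_, ?_⟩
    · have hz' : z.re ^ 2 + z.im ^ 2 < 1 := hz
      have hs := Real.sq_sqrt (show 0 ≤ 1 - z.re ^ 2 - z.im ^ 2 by linarith)
      have hm : up z ∈ upperHemisphere := by
        refine ⟨?_, by simp [up, Real.sqrt_nonneg]⟩
        simp only [up, Matrix.cons_val_zero, Matrix.cons_val_one, Matrix.cons_val]
        linarith
      refine ⟨k (up z), (hk _ hm).1, ?_⟩
      simp [(hk _ hm).2, up, pr]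
    · exact isOpen_lt (by fun_prop) (by fun_prop)
    · have := (hh.mem_upperHemisphere hx).1
      change h x 0 ^ 2 + h x 1 ^ 2 < 1
      have : 0 < h x 2 ^ 2 := by positivity
      linarith
  · simp only [sub_zero, zero_add]
    have e : ∀ i, |(t • z) i| = t * |z i| := fun i => by
      simp [abs_mul, abs_of_nonneg ht0]
    refine ⟨⟨?_, ?_⟩, fun h => hza ?_⟩
    · rw [e]; nlinarith [hz.1, abs_nonneg (z 0)]
    · rw [e]; nlinarith [hz.2, abs_nonneg (z 1)]
    · have : t = 1 := by
        rcases hb with hb | hb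
        · rw [← h, e] at hb; nlinarith [hz.1, abs_nonneg (z 0)]
        · rw [← h, e] at hb; nlinarith [hz.2, abs_nonneg (z 1)]
      rwa [this, one_smul] at h
  · refine hkc.comp hupc.continuousOn ?_
    rintro _ ⟨w, hw, rfl⟩
    rw [hup_pr _ (hh.mem_upperHemisphere hw)]
    exact hh.mem_upperHemisphere hw
  · simp only [hup_pr _ (hh.mem_upperHemisphere hz), hk' z hz]

end IsSymmetricGenerator

/-! ### Signs of reflections. -/

lemma neg_one_zpow_eq (k : ℤ) : (-1 : ℝ) ^ k = 1 ∨ (-1 : ℝ) ^ k = -1 := by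
  rcases Int.even_or_odd k with h | h
  · exact Or.inl h.neg_one_zpow
  · exact Or.inr h.neg_one_zpow

lemma neg_one_zpow_sq (k : ℤ) : ((-1 : ℝ) ^ k) ^ 2 = 1 := by
  rcases neg_one_zpow_eq k with h | h <;> rw [h] <;> norm_num

lemma abs_neg_one_zpow (k : ℤ) : |(-1 : ℝ) ^ k| = 1 := by
  rcases neg_one_zpow_eq k with h | h <;> rw [h] <;> norm_num

lemma neg_one_zpow_succ (k : ℤ) : (-1 : ℝ) ^ (k + 1) = -(-1 : ℝ) ^ k := by
  rw [zpow_add_one₀ (by norm_num)]; ring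

/-! ### Folding -/

section fold

variable {lam : ℝ}

lemma abs_sub_cell_le (hlam : 0 < lam) (t : ℝ) : |t - 2 * lam * cell lam t| ≤ lam := by
  have h := abs_sub_round (t / (2 * lam))
  have e : t - 2 * lam * cell lam t = 2 * lam * (t / (2 * lam) - round (t / (2 * lam))) := by
    rw [cell]; field_simp
  rw [e, abs_mul, abs_of_pos (by positivity : 0 < 2 * lam)]
  nlinarith

/-- `cell` picks one index on a wall between two cells by the rounding convention; the folded value
does not depend on that choice. -/
lemma cell_eq_or_boundary (hlam : 0 < lam) {t : ℝ} {k : ℤ} (hk : |t - 2 * lam * k| ≤ lam) :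
    fold lam t = (-1) ^ k * (t - 2 * lam * k) ∧ (cell lam t = k ∨ |fold lam t| = lam) := by
  have h := abs_sub_cell_le hlam t
  have hn : cell lam t = k ∨ cell lam t = k + 1 ∨ cell lam t = k - 1 := by
    rw [abs_le] at h hk
    have h1 : (cell lam t : ℝ) < k + 2 := by nlinarith
    have h2 : (k : ℝ) < cell lam t + 2 := by nlinarith
    have h1' : cell lam t < k + 2 := by exact_mod_cast h1
    have h2' : k < cell lam t + 2 := by exact_mod_cast h2
    omega
  rw [fold]
  rcases hn with hn | hn | hn
  · rw [hn]; exact ⟨rfl, Or.inl rfl⟩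
  · rw [hn] at h ⊢
    push_cast at h ⊢
    rw [abs_le] at h hk
    have ht : t = 2 * lam * k + lam := by linarith
    rw [neg_one_zpow_succ, ht]
    refine ⟨by ring, Or.inr ?_⟩
    rw [abs_mul, abs_neg, abs_neg_one_zpow, one_mul,
      show 2 * lam * k + lam - 2 * lam * (k + 1) = -lam by ring, abs_neg, abs_of_pos hlam]
  · rw [hn] at h ⊢
    push_cast at h ⊢
    rw [abs_le] at h hk
    have ht : t = 2 * lam * k - lam := by linarith
    have e : (-1 : ℝ) ^ (k - 1) = -(-1) ^ k := by
      rw [← neg_eq_iff_eq_neg, ← neg_one_zpow_succ, sub_add_cancel]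
    rw [e, ht]
    refine ⟨by ring, Or.inr ?_⟩
    rw [abs_mul, abs_neg, abs_neg_one_zpow, one_mul,
      show 2 * lam * k - lam - 2 * lam * (k - 1) = lam by ring, abs_of_pos hlam]

lemma fold_eq (hlam : 0 < lam) {t : ℝ} {k : ℤ} (hk : |t - 2 * lam * k| ≤ lam) :
    fold lam t = (-1) ^ k * (t - 2 * lam * k) := (cell_eq_or_boundary hlam hk).1

lemma abs_fold (t : ℝ) : |fold lam t| = |t - 2 * lam * cell lam t| := by
  rw [fold, abs_mul, abs_neg_one_zpow, one_mul]

lemma abs_fold_le (hlam : 0 < lam) (t : ℝ) : |fold lam t| ≤ lam := by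
  rw [abs_fold]; exact abs_sub_cell_le hlam t

lemma abs_fold_le_abs (hlam : 0 < lam) (t : ℝ) : |fold lam t| ≤ |t| := by
  by_cases h : |t| ≤ lam
  · rw [fold_eq hlam (k := 0) (by simpa using h)]; simp
  · exact (abs_fold_le hlam t).trans (not_le.1 h).le

end fold

/-! ### The direction of the Zorich map -/

/-- Multiplication of the third coordinate by `e`. -/
noncomputable def flip (e : ℝ) (v : EuclideanSpace ℝ (Fin 3)) : EuclideanSpace ℝ (Fin 3) :=
  !₂[v 0, v 1, e * v 2]

@[simp] lemma flip_zero (e : ℝ) (v) : flip e v 0 = v 0 := by simp [flip]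
@[simp] lemma flip_one (e : ℝ) (v) : flip e v 1 = v 1 := by simp [flip]
@[simp] lemma flip_two (e : ℝ) (v) : flip e v 2 = e * v 2 := by simp [flip]

lemma dist_flip {e : ℝ} (he : e ^ 2 = 1) (u v : EuclideanSpace ℝ (Fin 3)) :
    dist (flip e u) (flip e v) = dist u v := by
  have h1 := dist_sq_three (flip e u) (flip e v)
  have h2 := dist_sq_three u v
  simp only [flip_zero, flip_one, flip_two] at h1
  rw [← mul_sub, mul_pow, he, one_mul, ← h2] at h1
  exact (pow_left_inj₀ dist_nonneg dist_nonneg two_ne_zero).1 h1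

lemma norm_flip {e : ℝ} (he : e ^ 2 = 1) (u : EuclideanSpace ℝ (Fin 3)) : ‖flip e u‖ = ‖u‖ := by
  have h := dist_flip he u 0
  rwa [show flip e 0 = 0 from ext_three (by simp) (by simp) (by simp), dist_zero_right,
    dist_zero_right] at h

lemma flip_flip {e : ℝ} (he : e ^ 2 = 1) (u : EuclideanSpace ℝ (Fin 3)) : flip e (flip e u) = u :=
  ext_three (by simp) (by simp) (by simp [← mul_assoc, ← sq, he])

lemma continuous_flip (e : ℝ) : Continuous (flip e) :=
  continuous_mk_three (by fun_prop) (by fun_prop) (by fun_prop)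

/-- The point of the square `Q` to which `x` is folded, expressed with the cell `(k, l)`. -/
noncomputable def cellPoint (lam : ℝ) (k l : ℤ) (x : EuclideanSpace ℝ (Fin 3)) :
    EuclideanSpace ℝ (Fin 2) :=
  lam⁻¹ • !₂[(-1) ^ k * (x 0 - 2 * lam * k), (-1) ^ l * (x 1 - 2 * lam * l)]

/-- The closed square beam with index `(k, l)`. -/
def beam (lam : ℝ) (k l : ℤ) : Set (EuclideanSpace ℝ (Fin 3)) :=
  {x | |x 0 - 2 * lam * k| ≤ lam ∧ |x 1 - 2 * lam * l| ≤ lam}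

/-- The direction of `zorich h lam nu x`. -/
noncomputable def dir (h : EuclideanSpace ℝ (Fin 2) → EuclideanSpace ℝ (Fin 3)) (lam : ℝ)
    (x : EuclideanSpace ℝ (Fin 3)) : EuclideanSpace ℝ (Fin 3) :=
  flip ((-1) ^ (cell lam (x 0) + cell lam (x 1)))
    (h (cellPoint lam (cell lam (x 0)) (cell lam (x 1)) x))

section cellPoint

variable {lam : ℝ}

lemma abs_cellPoint_zero (hlam : 0 < lam) (k l : ℤ) (x) :
    |cellPoint lam k l x 0| = lam⁻¹ * |x 0 - 2 * lam * k| := by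
  simp [cellPoint, abs_mul, abs_of_pos hlam]

lemma abs_cellPoint_one (hlam : 0 < lam) (k l : ℤ) (x) :
    |cellPoint lam k l x 1| = lam⁻¹ * |x 1 - 2 * lam * l| := by
  simp [cellPoint, abs_mul, abs_of_pos hlam]

lemma cellPoint_mem (hlam : 0 < lam) {k l : ℤ} {x} (hx : x ∈ beam lam k l) :
    cellPoint lam k l x ∈ square := by
  refine ⟨?_, ?_⟩
  · rw [abs_cellPoint_zero hlam, inv_mul_le_iff₀ hlam, mul_one]; exact hx.1
  · rw [abs_cellPoint_one hlam, inv_mul_le_iff₀ hlam, mul_one]; exact hx.2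

lemma continuous_cellPoint (k l : ℤ) : Continuous (cellPoint lam k l) := by
  unfold cellPoint
  have : Continuous fun x : EuclideanSpace ℝ (Fin 3) =>
      (!₂[(-1) ^ k * (x 0 - 2 * lam * k), (-1) ^ l * (x 1 - 2 * lam * l)] :
        EuclideanSpace ℝ (Fin 2)) := continuous_mk_two (by fun_prop) (by fun_prop)
  exact Continuous.const_smul this (lam⁻¹ : ℝ)

lemma isClosed_beam (k l : ℤ) : IsClosed (beam lam k l) :=
  (isClosed_le (f := fun x : EuclideanSpace ℝ (Fin 3) => |x 0 - 2 * lam * k|) (by fun_prop)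
    continuous_const).inter
    (isClosed_le (f := fun x : EuclideanSpace ℝ (Fin 3) => |x 1 - 2 * lam * l|) (by fun_prop)
    continuous_const)

lemma mem_beam_cell (hlam : 0 < lam) (x : EuclideanSpace ℝ (Fin 3)) :
    x ∈ beam lam (cell lam (x 0)) (cell lam (x 1)) :=
  ⟨abs_sub_cell_le hlam _, abs_sub_cell_le hlam _⟩

lemma dist_cellPoint_sq (hlam : 0 < lam) (k l : ℤ) (x z) :
    lam ^ 2 * dist (cellPoint lam k l x) (cellPoint lam k l z) ^ 2 =
      (x 0 - z 0) ^ 2 + (x 1 - z 1) ^ 2 := by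
  rw [dist_sq_two]
  simp only [cellPoint, PiLp.smul_apply, smul_eq_mul, Matrix.cons_val_zero, Matrix.cons_val_one]
  have h1 := neg_one_zpow_sq k
  have h2 := neg_one_zpow_sq l
  have h3 : lam * lam⁻¹ = 1 := mul_inv_cancel₀ hlam.ne'
  calc _ = (lam * lam⁻¹) ^ 2 * (((-1 : ℝ) ^ k) ^ 2 * (x 0 - z 0) ^ 2
        + ((-1 : ℝ) ^ l) ^ 2 * (x 1 - z 1) ^ 2) := by ring
    _ = _ := by rw [h1, h2, h3]; ring

end cellPoint

section dir

variable {L lam nu : ℝ} {h : EuclideanSpace ℝ (Fin 2) → EuclideanSpace ℝ (Fin 3)}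

lemma zorich_eq_smul (x) :
    zorich h lam nu x = (nu * lam * Real.exp (x 2)) • dir h lam x := by
  have e : rescale lam h !₂[fold lam (x 0), fold lam (x 1)] =
      lam • h (cellPoint lam (cell lam (x 0)) (cell lam (x 1)) x) := rfl
  refine ext_three ?_ ?_ ?_
  · simp [zorich, e, dir]; ring
  · simp [zorich, e, dir]; ring
  · simp [zorich, e, dir]; ring

/-- Closed beams overlap along walls, where the signs given by the two sides differ. Walls are
mapped to the equator, where the sign multiplies zero. This makes the reflected extension consistent
and, with local finiteness of the beams, continuous. -/
lemma dir_eq (hh : IsSymmetricGenerator L h) (hlam : 0 < lam) {k l : ℤ} {x}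
    (hx : x ∈ beam lam k l) :
    dir h lam x = flip ((-1) ^ (k + l)) (h (cellPoint lam k l x)) := by
  obtain ⟨f0, c0⟩ := cell_eq_or_boundary hlam hx.1
  obtain ⟨f1, c1⟩ := cell_eq_or_boundary hlam hx.2
  have e : cellPoint lam (cell lam (x 0)) (cell lam (x 1)) x = cellPoint lam k l x := by
    rw [cellPoint, cellPoint, ← f0, ← f1]; rfl
  rw [dir, e]
  by_cases hc : cell lam (x 0) = k ∧ cell lam (x 1) = l
  · rw [hc.1, hc.2]
  · have hb : |cellPoint lam k l x 0| = 1 ∨ |cellPoint lam k l x 1| = 1 := by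
      rw [abs_cellPoint_zero hlam, abs_cellPoint_one hlam]
      rw [f0, abs_mul, abs_neg_one_zpow, one_mul] at c0
      rw [f1, abs_mul, abs_neg_one_zpow, one_mul] at c1
      have hi : lam⁻¹ * lam = 1 := inv_mul_cancel₀ hlam.ne'
      rcases c0 with c0 | c0
      · rcases c1 with c1 | c1
        · exact absurd ⟨c0, c1⟩ hc
        · right; rw [c1, hi]
      · left; rw [c0, hi]
    have h0 := hh.eq_zero_of_boundary (cellPoint_mem hlam hx) hb
    exact ext_three (by simp) (by simp) (by simp [h0])

lemma norm_dir (hh : IsSymmetricGenerator L h) (hlam : 0 < lam) (x) : ‖dir h lam x‖ = 1 := by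
  rw [dir, norm_flip (neg_one_zpow_sq _), hh.norm_map (cellPoint_mem hlam (mem_beam_cell hlam x))]

lemma continuous_dir (hh : IsSymmetricGenerator L h) (hlam : 0 < lam) :
    Continuous (dir h lam) := by
  have hfin : LocallyFinite fun q : ℤ × ℤ => beam lam q.1 q.2 := by
    intro x
    have key : ∀ t : ℝ, ∃ N : ℤ, ∀ s : ℝ, |s - t| < 1 → ∀ k : ℤ, |s - 2 * lam * k| ≤ lam →
        k ∈ Icc (-N) N := by
      intro t
      refine ⟨⌈(|t| + 1 + lam) / (2 * lam)⌉, fun s hs k hk => ?_⟩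
      have h1 := Int.le_ceil ((|t| + 1 + lam) / (2 * lam))
      rw [div_le_iff₀ (by positivity)] at h1
      rw [abs_lt] at hs
      rw [abs_le] at hk
      have h2 := le_abs_self t
      have h3 := neg_abs_le t
      constructor
      · have : (-⌈(|t| + 1 + lam) / (2 * lam)⌉ : ℝ) ≤ k := by nlinarith
        exact_mod_cast this
      · have : (k : ℝ) ≤ ⌈(|t| + 1 + lam) / (2 * lam)⌉ := by nlinarith
        exact_mod_cast this
    obtain ⟨N, hN⟩ := key (x 0)
    obtain ⟨M, hM⟩ := key (x 1)
    refine ⟨ball x 1, ball_mem_nhds x one_pos, ((finite_Icc (-N) N).prod (finite_Icc (-M) M)).subset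
      ?_⟩
    rintro ⟨k, l⟩ ⟨y, hy, hyx⟩
    rw [mem_ball, dist_eq_norm] at hyx
    exact ⟨hN (y 0) ((abs_coord_le_norm (y - x) 0).trans_lt hyx) k hy.1,
      hM (y 1) ((abs_coord_le_norm (y - x) 1).trans_lt hyx) l hy.2⟩
  refine hfin.continuous ?_ (fun q => ?_) (fun q => ?_)
  · exact eq_univ_of_forall fun x => mem_iUnion.2 ⟨(_, _), mem_beam_cell hlam x⟩
  · exact isClosed_beam _ _
  · refine ContinuousOn.congr ?_ fun x hx => dir_eq hh hlam hx
    exact (continuous_flip _).comp_continuousOn (hh.continuousOn.comp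
      (continuous_cellPoint _ _).continuousOn fun x hx => cellPoint_mem hlam hx)

lemma dist_dir_of_mem_beam (hh : IsSymmetricGenerator L h) (hlam : 0 < lam) {k l : ℤ} {x z}
    (hx : x ∈ beam lam k l) (hz : z ∈ beam lam k l) :
    (x 0 - z 0) ^ 2 + (x 1 - z 1) ^ 2 ≤ (L * lam) ^ 2 * dist (dir h lam x) (dir h lam z) ^ 2 := by
  rw [dir_eq hh hlam hx, dir_eq hh hlam hz, dist_flip (neg_one_zpow_sq _),
    ← dist_cellPoint_sq hlam k l x z]
  have := hh.le_dist _ (cellPoint_mem hlam hx) _ (cellPoint_mem hlam hz)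
  have h2 := pow_le_pow_left₀ dist_nonneg this 2
  rw [mul_pow] at h2
  calc _ ≤ lam ^ 2 * (L ^ 2 * _) := by gcongr
    _ = _ := by ring

lemma norm_zorich (hh : IsSymmetricGenerator L h) (hlam : 0 < lam) (hnu : 0 < nu) (x) :
    ‖zorich h lam nu x‖ = nu * lam * Real.exp (x 2) := by
  rw [zorich_eq_smul, norm_smul, norm_dir hh hlam, mul_one, Real.norm_eq_abs,
    abs_of_pos (by positivity)]

lemma continuous_zorich (hh : IsSymmetricGenerator L h) (hlam : 0 < lam) :
    Continuous (zorich h lam nu) := by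
  have : zorich h lam nu = fun x => (nu * lam * Real.exp (x 2)) • dir h lam x :=
    funext zorich_eq_smul
  rw [this]
  have := continuous_dir hh hlam
  fun_prop

/-- The law of cosines, separating the radial from the spherical part of a distance. -/
lemma dist_smul_sq {E : Type*} [NormedAddCommGroup E] [InnerProductSpace ℝ E] {u v : E}
    (hu : ‖u‖ = 1) (hv : ‖v‖ = 1) (a b : ℝ) :
    dist (a • u) (b • v) ^ 2 = (a - b) ^ 2 + a * b * dist u v ^ 2 := by
  rw [dist_eq_norm, dist_eq_norm, norm_sub_sq_real, norm_sub_sq_real, norm_smul, norm_smul, hu, hv,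
    real_inner_smul_left, real_inner_smul_right]
  simp only [Real.norm_eq_abs, mul_one, sq_abs]
  ring

/-- Above height `s` the radial part expands by at least the derivative of the exponential at `s`,
and the product of the two radii is at least the square of the smallest possible radius. -/
lemma le_dist_zorich_sq (hh : IsSymmetricGenerator L h) (hlam : 0 < lam) (hnu : 0 < nu) {x z}
    {s : ℝ} (hx : s ≤ x 2) (hz : s ≤ z 2) :
    (nu * lam * Real.exp s) ^ 2 * ((x 2 - z 2) ^ 2 + dist (dir h lam x) (dir h lam z) ^ 2) ≤
      dist (zorich h lam nu x) (zorich h lam nu z) ^ 2 := by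
  rw [zorich_eq_smul, zorich_eq_smul, dist_smul_sq (norm_dir hh hlam x) (norm_dir hh hlam z), mul_add]
  have hx' := Real.exp_le_exp.2 hx
  have hz' := Real.exp_le_exp.2 hz
  have hs := Real.exp_pos s
  have key : ∀ a b : ℝ, s ≤ a → a ≤ b → Real.exp s * (b - a) ≤ Real.exp b - Real.exp a := by
    intro a b ha hab
    have h1 : Real.exp b = Real.exp a * Real.exp (b - a) := by rw [← Real.exp_add]; ring_nf
    have h2 := Real.add_one_le_exp (b - a)
    have h3 := Real.exp_le_exp.2 ha
    nlinarith [Real.exp_pos a]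
  have hab : Real.exp s * |x 2 - z 2| ≤ |Real.exp (x 2) - Real.exp (z 2)| := by
    rcases le_total (x 2) (z 2) with h | h
    · rw [abs_sub_comm, abs_sub_comm (Real.exp _), abs_of_nonneg (sub_nonneg.2 h)]
      exact (key _ _ hx h).trans (le_abs_self _)
    · rw [abs_of_nonneg (sub_nonneg.2 h)]
      exact (key _ _ hz h).trans (le_abs_self _)
  have hab2 := pow_le_pow_left₀ (by positivity) hab 2
  rw [mul_pow, sq_abs, sq_abs] at hab2
  have hprod : Real.exp s ^ 2 ≤ Real.exp (x 2) * Real.exp (z 2) := by nlinarith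
  have hk : 0 ≤ (nu * lam) ^ 2 := by positivity
  refine add_le_add ?_ (mul_le_mul_of_nonneg_right ?_ (by positivity))
  · calc _ = (nu * lam) ^ 2 * (Real.exp s ^ 2 * (x 2 - z 2) ^ 2) := by ring
      _ ≤ (nu * lam) ^ 2 * (Real.exp (x 2) - Real.exp (z 2)) ^ 2 := by gcongr
      _ = _ := by ring
  · calc _ = (nu * lam) ^ 2 * Real.exp s ^ 2 := by ring
      _ ≤ (nu * lam) ^ 2 * (Real.exp (x 2) * Real.exp (z 2)) := by gcongr
      _ = _ := by ring

end dir

variable {L lam nu : ℝ} {h : EuclideanSpace ℝ (Fin 2) → EuclideanSpace ℝ (Fin 3)}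

/-! ### Local inverses and openness of the Zorich map -/

lemma zorich_two_sign (hh : IsSymmetricGenerator L h) (hlam : 0 < lam) (hnu : 0 < nu) {k l : ℤ} {x}
    (hx : x ∈ beam lam k l) : 0 ≤ (-1 : ℝ) ^ (k + l) * zorich h lam nu x 2 := by
  rw [zorich_eq_smul, dir_eq hh hlam hx]
  simp only [PiLp.smul_apply, flip_two, smul_eq_mul]
  have h1 := neg_one_zpow_sq (k + l)
  have h2 := hh.nonneg_map (cellPoint_mem hlam hx)
  calc (0 : ℝ) ≤ ((-1 : ℝ) ^ (k + l)) ^ 2 * (nu * lam * Real.exp (x 2)) *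
        h (cellPoint lam k l x) 2 := by positivity
    _ = _ := by ring

lemma zorich_injOn_beam (hh : IsSymmetricGenerator L h) (hlam : 0 < lam) (hnu : 0 < nu)
    (k l : ℤ) : InjOn (zorich h lam nu) (beam lam k l) := fun x hx z hz hxz => by
  have h1 := le_dist_zorich_sq hh hlam hnu (min_le_left (x 2) (z 2)) (min_le_right (x 2) (z 2))
  have h2 := dist_dir_of_mem_beam hh hlam hx hz
  rw [hxz, dist_self] at h1
  have h3 : (x 2 - z 2) ^ 2 + dist (dir h lam x) (dir h lam z) ^ 2 ≤ 0 := by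
    have : 0 < (nu * lam * Real.exp (min (x 2) (z 2))) ^ 2 := by positivity
    nlinarith
  have h4 : dist (dir h lam x) (dir h lam z) ^ 2 = 0 := by nlinarith [sq_nonneg (x 2 - z 2)]
  rw [h4, mul_zero] at h2
  have e0 : (x 0 - z 0) ^ 2 = 0 := by nlinarith [sq_nonneg (x 0 - z 0), sq_nonneg (x 1 - z 1)]
  have e1 : (x 1 - z 1) ^ 2 = 0 := by nlinarith [sq_nonneg (x 0 - z 0), sq_nonneg (x 1 - z 1)]
  have e2 : (x 2 - z 2) ^ 2 = 0 := by nlinarith [sq_nonneg (x 2 - z 2)]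
  exact ext_three (sub_eq_zero.1 (pow_eq_zero_iff two_ne_zero |>.1 e0))
    (sub_eq_zero.1 (pow_eq_zero_iff two_ne_zero |>.1 e1))
    (sub_eq_zero.1 (pow_eq_zero_iff two_ne_zero |>.1 e2))

/-- On each closed beam the Zorich map has a continuous inverse, defined on a punctured closed
half-space. -/
lemma exists_inverse_zorich (hh : IsSymmetricGenerator L h) (hlam : 0 < lam) (hnu : 0 < nu)
    (k l : ℤ) : ∃ g : EuclideanSpace ℝ (Fin 3) → EuclideanSpace ℝ (Fin 3),
      ContinuousOn g {y | y ≠ 0 ∧ 0 ≤ (-1 : ℝ) ^ (k + l) * y 2} ∧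
      (∀ y, y ≠ 0 → 0 ≤ (-1 : ℝ) ^ (k + l) * y 2 → g y ∈ beam lam k l ∧ zorich h lam nu (g y) = y) ∧
      ∀ x ∈ beam lam k l, g (zorich h lam nu x) = x := by
  obtain ⟨K, hK, -, hKc⟩ := hh.exists_inverse
  let e : ℝ := (-1) ^ (k + l)
  have he : e ^ 2 = 1 := neg_one_zpow_sq _
  let u : EuclideanSpace ℝ (Fin 3) → EuclideanSpace ℝ (Fin 3) := fun y => flip e (‖y‖⁻¹ • y)
  have hu : ∀ y, y ≠ 0 → 0 ≤ e * y 2 → u y ∈ upperHemisphere := fun y hy h2 => by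
    have hn : ‖u y‖ = 1 := by
      rw [norm_flip he, norm_smul, norm_inv, norm_norm, inv_mul_cancel₀ (norm_ne_zero_iff.2 hy)]
    refine ⟨by rw [← norm_sq_three, hn, one_pow], ?_⟩
    simp only [u, flip_two, PiLp.smul_apply, smul_eq_mul]
    rw [mul_left_comm]
    positivity
  let g : EuclideanSpace ℝ (Fin 3) → EuclideanSpace ℝ (Fin 3) := fun y =>
    !₂[2 * lam * k + (-1) ^ k * (lam * K (u y) 0), 2 * lam * l + (-1) ^ l * (lam * K (u y) 1),
      Real.log (‖y‖ / (nu * lam))]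
  have hg : ∀ y, y ≠ 0 → 0 ≤ e * y 2 → g y ∈ beam lam k l ∧ zorich h lam nu (g y) = y := by
    intro y hy h2
    obtain ⟨hm, hKu⟩ := hK _ (hu y hy h2)
    have hb : g y ∈ beam lam k l := by
      refine ⟨?_, ?_⟩
      · simp only [g, Matrix.cons_val_zero, add_sub_cancel_left, abs_mul, abs_neg_one_zpow,
          abs_of_pos hlam]
        nlinarith [hm.1]
      · simp only [g, Matrix.cons_val_one, Matrix.cons_val_zero, add_sub_cancel_left, abs_mul,
          abs_neg_one_zpow, abs_of_pos hlam]
        nlinarith [hm.2]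
    refine ⟨hb, ?_⟩
    have hc : cellPoint lam k l (g y) = K (u y) := by
      have h1 := neg_one_zpow_sq k
      have h2 := neg_one_zpow_sq l
      refine ext_two ?_ ?_
      · simp only [cellPoint, g, PiLp.smul_apply, Matrix.cons_val_zero, add_sub_cancel_left,
          smul_eq_mul]
        rw [← mul_assoc ((-1 : ℝ) ^ k), ← sq, h1, one_mul, inv_mul_cancel_left₀ hlam.ne']
      · simp only [cellPoint, g, PiLp.smul_apply, Matrix.cons_val_zero, Matrix.cons_val_one,
          add_sub_cancel_left, smul_eq_mul]
        rw [← mul_assoc ((-1 : ℝ) ^ l), ← sq, h2, one_mul, inv_mul_cancel_left₀ hlam.ne']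
    have hn : 0 < ‖y‖ := norm_pos_iff.2 hy
    have hexp : nu * lam * Real.exp (g y 2) = ‖y‖ := by
      simp only [g, Matrix.cons_val]
      rw [Real.exp_log (by positivity)]
      field_simp
    rw [zorich_eq_smul, dir_eq hh hlam hb, hc, hKu, flip_flip he, hexp, smul_inv_smul₀ hn.ne']
  refine ⟨g, ?_, hg, fun x hx => ?_⟩
  · have huc : ContinuousOn u {y | y ≠ 0 ∧ 0 ≤ e * y 2} :=
      (continuous_flip e).comp_continuousOn
        ((continuousOn_id.norm.inv₀ fun y hy => norm_ne_zero_iff.2 hy.1).smul continuousOn_id)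
    have hKu : ContinuousOn (fun y => K (u y)) {y | y ≠ 0 ∧ 0 ≤ e * y 2} :=
      hKc.comp huc fun y hy => hu y hy.1 hy.2
    refine (PiLp.continuous_toLp 2 _).comp_continuousOn (continuousOn_pi.2 fun i => ?_)
    have hK0 : ∀ i : Fin 2, ContinuousOn (fun y => K (u y) i) {y | y ≠ 0 ∧ 0 ≤ e * y 2} := fun i =>
      (EuclideanSpace.proj (𝕜 := ℝ) i).continuous.comp_continuousOn hKu
    fin_cases i
    · exact continuousOn_const.add (continuousOn_const.mul (continuousOn_const.mul (hK0 0)))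
    · exact continuousOn_const.add (continuousOn_const.mul (continuousOn_const.mul (hK0 1)))
    · refine ContinuousOn.log (continuousOn_id.norm.div_const _) fun y hy => ?_
      exact div_ne_zero (norm_ne_zero_iff.2 hy.1) (by positivity)
  · have hne : zorich h lam nu x ≠ 0 := by
      rw [← norm_pos_iff, norm_zorich hh hlam hnu]; positivity
    obtain ⟨h1, h2⟩ := hg _ hne (zorich_two_sign hh hlam hnu hx)
    exact zorich_injOn_beam hh hlam hnu k l h1 hx h2

/-- A direction on the equator forces the point onto a wall, by `pos_of_interior`. Crossing that
wall changes the parity, so beams of both signs contain the point. -/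
lemma exists_two_beams (hh : IsSymmetricGenerator L h) (hlam : 0 < lam) {x}
    (hx : dir h lam x 2 = 0) (e : ℝ) (he : e = 1 ∨ e = -1) :
    ∃ k l : ℤ, (-1 : ℝ) ^ (k + l) = e ∧ x ∈ beam lam k l := by
  have hm := mem_beam_cell hlam x
  set k := cell lam (x 0) with hk
  set l := cell lam (x 1) with hl
  by_cases hs : (-1 : ℝ) ^ (k + l) = e
  · exact ⟨k, l, hs, hm⟩
  have hs' : -(-1 : ℝ) ^ (k + l) = e := by
    rcases neg_one_zpow_eq (k + l) with h1 | h1 <;> rcases he with h2 | h2 <;> simp_all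
  rw [dir_eq hh hlam hm, flip_two] at hx
  have h0 : h (cellPoint lam k l x) 2 = 0 := by
    have := abs_neg_one_zpow (k + l)
    refine (mul_eq_zero.1 hx).resolve_left fun h => ?_
    rw [h] at this; norm_num at this
  have move : ∀ (t : ℝ) (n : ℤ), |t - 2 * lam * n| = lam →
      ∃ n' : ℤ, (n' = n + 1 ∨ n' = n - 1) ∧ |t - 2 * lam * n'| ≤ lam := by
    intro t n ht
    rcases abs_choice (t - 2 * lam * n) with h1 | h1
    · refine ⟨n + 1, Or.inl rfl, ?_⟩
      push_cast
      rw [abs_le]; constructor <;> linarith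
    · refine ⟨n - 1, Or.inr rfl, ?_⟩
      push_cast
      rw [abs_le]; constructor <;> linarith
  have sgn : ∀ m m' : ℤ, (m' = m + 1 ∨ m' = m - 1) → (-1 : ℝ) ^ m' = -(-1 : ℝ) ^ m := by
    rintro m m' (rfl | rfl)
    · exact neg_one_zpow_succ m
    · rw [← neg_eq_iff_eq_neg, ← neg_one_zpow_succ, sub_add_cancel]
  have hi : lam * lam⁻¹ = 1 := mul_inv_cancel₀ hlam.ne'
  by_cases h1 : |cellPoint lam k l x 0| < 1
  · have h2 : ¬ |cellPoint lam k l x 1| < 1 := fun h2 => (hh.pos_of_interior h1 h2).ne' h0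
    rw [abs_cellPoint_one hlam, inv_mul_lt_iff₀ hlam, mul_one, not_lt] at h2
    obtain ⟨n, hn, hn'⟩ := move _ _ (le_antisymm hm.2 h2)
    refine ⟨k, n, ?_, hm.1, hn'⟩
    rw [sgn (k + l) (k + n) (by omega), hs']
  · rw [abs_cellPoint_zero hlam, inv_mul_lt_iff₀ hlam, mul_one, not_lt] at h1
    obtain ⟨n, hn, hn'⟩ := move _ _ (le_antisymm hm.1 h1)
    refine ⟨n, l, ?_, hn', hm.2⟩
    rw [sgn (k + l) (n + l) (by omega), hs']

/-- The continuous inverse on a beam makes images neighbourhoods within a closed half-space. If the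
image point lies on the plane bounding it, the inverses on two beams of opposite sign cover both
half-spaces. -/
lemma isOpenMap_zorich (hh : IsSymmetricGenerator L h) (hlam : 0 < lam) (hnu : 0 < nu) :
    IsOpenMap (zorich h lam nu) := by
  rw [isOpenMap_iff_nhds_le]
  intro x O hO
  rw [Filter.mem_map] at hO
  have hne : zorich h lam nu x ≠ 0 := by
    rw [← norm_pos_iff, norm_zorich hh hlam hnu]; positivity
  have key : ∀ k l : ℤ, x ∈ beam lam k l →
      O ∈ 𝓝[{y | y ≠ 0 ∧ 0 ≤ (-1 : ℝ) ^ (k + l) * y 2}] (zorich h lam nu x) := by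
    intro k l hx
    obtain ⟨g, hgc, hg, hgx⟩ := exists_inverse_zorich hh hlam hnu k l
    have hmem := zorich_two_sign hh hlam hnu hx
    have := hgc _ ⟨hne, hmem⟩
    rw [ContinuousWithinAt, hgx x hx] at this
    filter_upwards [this hO, self_mem_nhdsWithin] with y hy1 hy2
    have : zorich h lam nu (g y) ∈ O := hy1
    rwa [(hg y hy2.1 hy2.2).2] at this
  have h2 : zorich h lam nu x 2 = nu * lam * Real.exp (x 2) * dir h lam x 2 := by
    rw [zorich_eq_smul]; simp
  by_cases hd : dir h lam x 2 = 0
  · obtain ⟨k, l, hkl, hx⟩ := exists_two_beams hh hlam hd 1 (Or.inl rfl)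
    obtain ⟨k', l', hkl', hx'⟩ := exists_two_beams hh hlam hd (-1) (Or.inr rfl)
    have h3 := Filter.mem_sup.2 ⟨key k l hx, key k' l' hx'⟩
    rw [← nhdsWithin_union, hkl, hkl'] at h3
    rw [nhdsWithin_eq_nhds.2] at h3
    · exact h3
    · filter_upwards [isOpen_ne.mem_nhds hne] with y hy
      rcases le_total 0 (y 2) with h | h
      · exact Or.inl ⟨hy, by linarith⟩
      · exact Or.inr ⟨hy, by linarith⟩
  · have hx := mem_beam_cell hlam x
    have h3 := key _ _ hx
    have hmem := zorich_two_sign hh hlam hnu hx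
    set e : ℝ := (-1) ^ (cell lam (x 0) + cell lam (x 1))
    rw [nhdsWithin_eq_nhds.2] at h3
    · exact h3
    · have hpos : 0 < e * zorich h lam nu x 2 := by
        refine hmem.lt_of_ne' (mul_ne_zero ?_ ?_)
        · rcases neg_one_zpow_eq (cell lam (x 0) + cell lam (x 1)) with h | h <;>
            simp only [e, h] <;> norm_num
        · rw [h2]; positivity
      have hc : Continuous fun y : EuclideanSpace ℝ (Fin 3) => e * y 2 := by fun_prop
      filter_upwards [isOpen_ne.mem_nhds hne, (isOpen_lt continuous_const hc).mem_nhds hpos]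
        with y h1 h2 using ⟨h1, le_of_lt h2⟩

/-- Every non-zero point has a preimage near every given vertical line. -/
lemma exists_preimage_near (hh : IsSymmetricGenerator L h) (hlam : 0 < lam) (hnu : 0 < nu)
    {y : EuclideanSpace ℝ (Fin 3)} (hy : y ≠ 0) (a b : ℝ) :
    ∃ x, zorich h lam nu x = y ∧ |x 0 - a| ≤ 4 * lam ∧ |x 1 - b| ≤ 4 * lam ∧
      nu * lam * Real.exp (x 2) = ‖y‖ := by
  have ha := abs_sub_cell_le hlam a
  have hb := abs_sub_cell_le hlam b
  set k := cell lam a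
  set l := cell lam b
  -- Adjacent beams map onto opposite half-spaces, so one of the two has the sign required by `y`.
  obtain ⟨k', hk', hs⟩ : ∃ k' : ℤ, (k' = k ∨ k' = k + 1) ∧ 0 ≤ (-1 : ℝ) ^ (k' + l) * y 2 := by
    by_cases hs : 0 ≤ (-1 : ℝ) ^ (k + l) * y 2
    · exact ⟨k, Or.inl rfl, hs⟩
    · refine ⟨k + 1, Or.inr rfl, ?_⟩
      rw [show k + 1 + l = k + l + 1 by ring, neg_one_zpow_succ]
      linarith
  obtain ⟨g, -, hg, -⟩ := exists_inverse_zorich hh hlam hnu k' l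
  obtain ⟨hm, hz⟩ := hg y hy hs
  refine ⟨g y, hz, ?_, ?_, by rw [← norm_zorich hh hlam hnu, hz]⟩
  · have h1 := hm.1
    rw [abs_le] at h1 ha ⊢
    rcases hk' with hk' | hk'
    · rw [hk'] at h1; constructor <;> linarith
    · rw [hk'] at h1; push_cast at h1; constructor <;> linarith
  · have h1 := hm.2
    rw [abs_le] at h1 hb ⊢
    constructor <;> linarith

/-! ### Expansion on diamond-shaped beams -/

/-- The height of `h w` controls the distance of `w` to the boundary of the square. -/
lemma IsSymmetricGenerator.depth_le (hh : IsSymmetricGenerator L h) {w} (hw : w ∈ square) {r : ℝ}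
    (h0 : r ≤ 1 - |w 0|) (h1 : r ≤ 1 - |w 1|) : r ≤ 2 * L * h w 2 := by
  have hL := hh.one_le
  obtain ⟨hs, hp⟩ := hh.mem_upperHemisphere hw
  rcases le_or_gt r 0 with hr | hr
  · nlinarith
  set n := √(h w 0 ^ 2 + h w 1 ^ 2) with hn
  have hn2 : n ^ 2 = h w 0 ^ 2 + h w 1 ^ 2 := Real.sq_sqrt (by positivity)
  have hn0 : 0 ≤ n := Real.sqrt_nonneg _
  rcases hn0.eq_or_lt with hz | hpos
  · rw [← hz] at hn2
    have : h w 2 = 1 := by nlinarith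
    rw [this]
    linarith [abs_nonneg (w 0)]
  -- `e` is the point of the equator on the meridian of `h w`. Its preimage `v` lies on the boundary
  -- of the square, hence at distance at least `r` from `w`, while `dist (h w) e ≤ 2 * h w 2`
  -- because `1 - n ≤ 1 - n² = (h w 2)² ≤ h w 2`.
  let e : EuclideanSpace ℝ (Fin 3) := !₂[h w 0 / n, h w 1 / n, 0]
  have he : e ∈ upperHemisphere := by
    refine ⟨?_, by simp [e]⟩
    simp only [e, Matrix.cons_val_zero, Matrix.cons_val_one, Matrix.cons_val, div_pow]
    rw [hn2]
    have : h w 0 ^ 2 + h w 1 ^ 2 ≠ 0 := by rw [← hn2]; positivity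
    field_simp
    ring
  obtain ⟨v, hv, hve⟩ := hh.exists_eq he
  have hd := hh.le_dist w hw v hv
  rw [hve] at hd
  have hde : dist (h w) e ^ 2 = (1 - n) ^ 2 + h w 2 ^ 2 := by
    rw [dist_sq_three]
    simp only [e, Matrix.cons_val_zero, Matrix.cons_val_one, Matrix.cons_val, sub_zero]
    have e0 : (h w 0 - h w 0 / n) ^ 2 + (h w 1 - h w 1 / n) ^ 2 = (1 - n) ^ 2 := by
      have : (h w 0 - h w 0 / n) ^ 2 + (h w 1 - h w 1 / n) ^ 2 =
          (h w 0 ^ 2 + h w 1 ^ 2) * ((n - 1) / n) ^ 2 := by field_simp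
      rw [this, ← hn2]; field_simp; ring
    rw [e0]
  have hn1 : n ≤ 1 := by nlinarith [sq_nonneg (h w 2)]
  have h21 : h w 2 ≤ 1 := by nlinarith [sq_nonneg (h w 2)]
  have h1n : 1 - n ≤ h w 2 := by nlinarith
  have hde2 : dist (h w) e ≤ 2 * h w 2 := by
    refine abs_le_of_sq_le_sq' ?_ (by positivity) |>.2
    rw [hde]; nlinarith
  have hrd : r ≤ dist w v := by
    have hdv := dist_eq_norm w v
    by_contra hcon
    rw [not_le] at hcon
    have a0 := abs_coord_le_norm (w - v) 0
    have a1 := abs_coord_le_norm (w - v) 1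
    rw [← hdv] at a0 a1
    have b0 : |v 0| ≤ |w 0| + |(w - v) 0| := by
      have := abs_sub (w 0) ((w - v) 0); simpa using this
    have b1 : |v 1| ≤ |w 1| + |(w - v) 1| := by
      have := abs_sub (w 1) ((w - v) 1); simpa using this
    have := hh.pos_of_interior (x := v) (by linarith) (by linarith)
    rw [hve] at this
    simp [e] at this
  nlinarith

/-- Two points of the upper hemisphere move apart when one of them is reflected in the equatorial
plane, and their vertical separation becomes the sum of their heights. -/
lemma IsSymmetricGenerator.adjacent (hh : IsSymmetricGenerator L h) {w v} (hw : w ∈ square)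
    (hv : v ∈ square) {e : ℝ} (he : e ^ 2 = 1) :
    dist w v ≤ L * dist (flip e (h w)) (flip (-e) (h v)) ∧
      h w 2 + h v 2 ≤ dist (flip e (h w)) (flip (-e) (h v)) := by
  have hL := hh.one_le
  have hw2 := hh.nonneg_map hw
  have hv2 := hh.nonneg_map hv
  have hd := dist_sq_three (flip e (h w)) (flip (-e) (h v))
  have hd2 := dist_sq_three (h w) (h v)
  simp only [flip_zero, flip_one, flip_two] at hd
  rw [show (e * h w 2 - -e * h v 2) ^ 2 = e ^ 2 * (h w 2 + h v 2) ^ 2 by ring, he, one_mul] at hd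
  constructor
  · refine (hh.le_dist w hw v hv).trans (mul_le_mul_of_nonneg_left ?_ (by linarith))
    refine abs_le_of_sq_le_sq' ?_ dist_nonneg |>.2
    rw [hd, hd2]; nlinarith
  · refine abs_le_of_sq_le_sq' ?_ dist_nonneg |>.2
    rw [hd]; nlinarith [sq_nonneg (h w 0 - h v 0), sq_nonneg (h w 1 - h v 1)]

/-- The diamond-shaped beams that are bounded by the preimages of the planes `y₁ = ± y₀`. -/
def diamond (lam : ℝ) (m n : ℤ) : Set (EuclideanSpace ℝ (Fin 3)) :=
  {x | x 0 + x 1 ∈ Ioo (2 * lam * m) (2 * lam * (m + 1)) ∧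
    x 0 - x 1 ∈ Ioo (2 * lam * n) (2 * lam * (n + 1))}

/-- The gap `z 0 - x 0` is the sum of the depths of the two points behind the common wall.
`depth_le` bounds depths by heights and `adjacent` bounds the heights by the distance `d` of the
directions, so the gap is at most `2 L λ d`. The other coordinate is folded alike in both beams and
differs by at most `L λ d`; this gives `5 = 2² + 1`. -/
lemma dist_dir_across_zero (hh : IsSymmetricGenerator L h) (hlam : 0 < lam) {k l : ℤ} {x z}
    (hx : |x 1 - 2 * lam * l| ≤ x 0 - 2 * lam * k) (hx' : x 0 - 2 * lam * k ≤ lam)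
    (hz : |z 1 - 2 * lam * l| ≤ 2 * lam * (k + 1) - z 0) (hz' : 2 * lam * (k + 1) - z 0 ≤ lam) :
    (x 0 - z 0) ^ 2 + (x 1 - z 1) ^ 2 ≤
      5 * (L * lam) ^ 2 * dist (dir h lam x) (dir h lam z) ^ 2 := by
  have hi : lam⁻¹ * lam = 1 := inv_mul_cancel₀ hlam.ne'
  have hL := hh.one_le
  have ax : |x 0 - 2 * lam * k| = x 0 - 2 * lam * k := abs_of_nonneg ((abs_nonneg _).trans hx)
  have az : |z 0 - 2 * lam * ((k + 1 : ℤ) : ℝ)| = 2 * lam * (k + 1) - z 0 := by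
    push_cast
    rw [abs_sub_comm, abs_of_nonneg ((abs_nonneg _).trans hz)]
  have mx : x ∈ beam lam k l := ⟨ax.trans_le hx', hx.trans hx'⟩
  have mz : z ∈ beam lam (k + 1) l := ⟨az.trans_le hz', hz.trans hz'⟩
  have dx := cellPoint_mem hlam mx
  have dz := cellPoint_mem hlam mz
  have px := hh.depth_le dx (r := lam⁻¹ * (lam - (x 0 - 2 * lam * k)))
    (by rw [abs_cellPoint_zero hlam, ax, mul_sub, hi])
    (by rw [abs_cellPoint_one hlam, mul_sub, hi]; gcongr)
  have pz := hh.depth_le dz (r := lam⁻¹ * (lam - (2 * lam * (k + 1) - z 0)))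
    (by rw [abs_cellPoint_zero hlam, az, mul_sub, hi])
    (by rw [abs_cellPoint_one hlam, mul_sub, hi]; gcongr)
  have e : (-1 : ℝ) ^ (k + 1 + l) = -(-1) ^ (k + l) := by
    rw [show k + 1 + l = k + l + 1 by ring, neg_one_zpow_succ]
  obtain ⟨q1, q2⟩ := hh.adjacent dx dz (neg_one_zpow_sq (k + l))
  rw [dir_eq hh hlam mx, dir_eq hh hlam mz, e]
  set d := dist (flip ((-1) ^ (k + l)) (h (cellPoint lam k l x)))
    (flip (-(-1) ^ (k + l)) (h (cellPoint lam (k + 1) l z)))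
  have hd : 0 ≤ d := dist_nonneg
  have r0 : z 0 - x 0 ≤ 2 * (L * lam) * d := by
    have : lam⁻¹ * (z 0 - x 0) ≤ 2 * L * d := by
      have h3 : lam⁻¹ * (lam - (x 0 - 2 * lam * k)) + lam⁻¹ * (lam - (2 * lam * (k + 1) - z 0)) =
        lam⁻¹ * (z 0 - x 0) := by ring
      nlinarith
    rw [inv_mul_le_iff₀ hlam] at this
    linarith
  have r0' : 0 ≤ z 0 - x 0 := by linarith
  have r1 : |x 1 - z 1| ≤ L * lam * d := by
    have h3 := abs_coord_le_norm (cellPoint lam k l x - cellPoint lam (k + 1) l z) 1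
    rw [← dist_eq_norm] at h3
    have h4 := h3.trans q1
    have h5 : (cellPoint lam k l x - cellPoint lam (k + 1) l z) 1 =
        lam⁻¹ * ((-1) ^ l * (x 1 - z 1)) := by simp [cellPoint]; ring
    rw [h5, abs_mul, abs_mul, abs_neg_one_zpow, one_mul, abs_of_pos (inv_pos.2 hlam),
      inv_mul_le_iff₀ hlam] at h4
    linarith
  have s0 := pow_le_pow_left₀ r0' r0 2
  have s1 := pow_le_pow_left₀ (abs_nonneg _) r1 2
  rw [sq_abs] at s1
  nlinarith

lemma dist_dir_across_one (hh : IsSymmetricGenerator L h) (hlam : 0 < lam) {k l : ℤ} {x z}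
    (hx : |x 0 - 2 * lam * k| ≤ x 1 - 2 * lam * l) (hx' : x 1 - 2 * lam * l ≤ lam)
    (hz : |z 0 - 2 * lam * k| ≤ 2 * lam * (l + 1) - z 1) (hz' : 2 * lam * (l + 1) - z 1 ≤ lam) :
    (x 0 - z 0) ^ 2 + (x 1 - z 1) ^ 2 ≤
      5 * (L * lam) ^ 2 * dist (dir h lam x) (dir h lam z) ^ 2 := by
  have hi : lam⁻¹ * lam = 1 := inv_mul_cancel₀ hlam.ne'
  have hL := hh.one_le
  have ax : |x 1 - 2 * lam * l| = x 1 - 2 * lam * l := abs_of_nonneg ((abs_nonneg _).trans hx)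
  have az : |z 1 - 2 * lam * ((l + 1 : ℤ) : ℝ)| = 2 * lam * (l + 1) - z 1 := by
    push_cast
    rw [abs_sub_comm, abs_of_nonneg ((abs_nonneg _).trans hz)]
  have mx : x ∈ beam lam k l := ⟨hx.trans hx', ax.trans_le hx'⟩
  have mz : z ∈ beam lam k (l + 1) := ⟨hz.trans hz', az.trans_le hz'⟩
  have dx := cellPoint_mem hlam mx
  have dz := cellPoint_mem hlam mz
  have px := hh.depth_le dx (r := lam⁻¹ * (lam - (x 1 - 2 * lam * l)))
    (by rw [abs_cellPoint_zero hlam, mul_sub, hi]; gcongr)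
    (by rw [abs_cellPoint_one hlam, ax, mul_sub, hi])
  have pz := hh.depth_le dz (r := lam⁻¹ * (lam - (2 * lam * (l + 1) - z 1)))
    (by rw [abs_cellPoint_zero hlam, mul_sub, hi]; gcongr)
    (by rw [abs_cellPoint_one hlam, az, mul_sub, hi])
  have e : (-1 : ℝ) ^ (k + (l + 1)) = -(-1) ^ (k + l) := by
    rw [← add_assoc, neg_one_zpow_succ]
  obtain ⟨q1, q2⟩ := hh.adjacent dx dz (neg_one_zpow_sq (k + l))
  rw [dir_eq hh hlam mx, dir_eq hh hlam mz, e]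
  set d := dist (flip ((-1) ^ (k + l)) (h (cellPoint lam k l x)))
    (flip (-(-1) ^ (k + l)) (h (cellPoint lam k (l + 1) z)))
  have hd : 0 ≤ d := dist_nonneg
  have r0 : z 1 - x 1 ≤ 2 * (L * lam) * d := by
    have : lam⁻¹ * (z 1 - x 1) ≤ 2 * L * d := by
      have h3 : lam⁻¹ * (lam - (x 1 - 2 * lam * l)) + lam⁻¹ * (lam - (2 * lam * (l + 1) - z 1)) =
        lam⁻¹ * (z 1 - x 1) := by ring
      nlinarith
    rw [inv_mul_le_iff₀ hlam] at this
    linarith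
  have r0' : 0 ≤ z 1 - x 1 := by linarith
  have r1 : |x 0 - z 0| ≤ L * lam * d := by
    have h3 := abs_coord_le_norm (cellPoint lam k l x - cellPoint lam k (l + 1) z) 0
    rw [← dist_eq_norm] at h3
    have h4 := h3.trans q1
    have h5 : (cellPoint lam k l x - cellPoint lam k (l + 1) z) 0 =
        lam⁻¹ * ((-1) ^ k * (x 0 - z 0)) := by simp [cellPoint]; ring
    rw [h5, abs_mul, abs_mul, abs_neg_one_zpow, one_mul, abs_of_pos (inv_pos.2 hlam),
      inv_mul_le_iff₀ hlam] at h4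
    linarith
  have s0 := pow_le_pow_left₀ r0' r0 2
  have s1 := pow_le_pow_left₀ (abs_nonneg _) r1 2
  rw [sq_abs] at s1
  nlinarith

lemma dist_dir_of_mem_diamond (hh : IsSymmetricGenerator L h) (hlam : 0 < lam) {m n : ℤ} {x z}
    (hx : x ∈ diamond lam m n) (hz : z ∈ diamond lam m n) :
    (x 0 - z 0) ^ 2 + (x 1 - z 1) ^ 2 ≤
      5 * (L * lam) ^ 2 * dist (dir h lam x) (dir h lam z) ^ 2 := by
  have weaken : ∀ {k l : ℤ}, x ∈ beam lam k l → z ∈ beam lam k l →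
      (x 0 - z 0) ^ 2 + (x 1 - z 1) ^ 2 ≤
        5 * (L * lam) ^ 2 * dist (dir h lam x) (dir h lam z) ^ 2 := fun mx mz => by
    have := dist_dir_of_mem_beam hh hlam mx mz
    have : 0 ≤ (L * lam) ^ 2 * dist (dir h lam x) (dir h lam z) ^ 2 := by positivity
    linarith
  obtain ⟨⟨x1, x2⟩, x3, x4⟩ := hx
  obtain ⟨⟨z1, z2⟩, z3, z4⟩ := hz
  -- A diamond consists of two triangular beams glued along a common wall. The parity of `m + n`
  -- decides which coordinate is constant on that wall.
  rcases Int.even_or_odd' (m + n) with ⟨k, hk | hk⟩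
  · obtain ⟨l, rfl⟩ : ∃ l, m = k + l := ⟨m - k, by ring⟩
    obtain rfl : n = k - l := by omega
    push_cast at x1 x2 x3 x4 z1 z2 z3 z4
    have cx : ∀ y : EuclideanSpace ℝ (Fin 3), 2 * lam * (k + l) < y 0 + y 1 →
        2 * lam * (k - l) < y 0 - y 1 → |y 1 - 2 * lam * l| ≤ y 0 - 2 * lam * k := fun y h1 h2 => by
      rw [abs_le]; constructor <;> nlinarith
    have cy : ∀ y : EuclideanSpace ℝ (Fin 3), y 0 + y 1 < 2 * lam * (k + l + 1) →
        y 0 - y 1 < 2 * lam * (k - l + 1) → |y 1 - 2 * lam * l| ≤ 2 * lam * (k + 1) - y 0 :=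
      fun y h1 h2 => by rw [abs_le]; constructor <;> nlinarith
    have bx : ∀ y : EuclideanSpace ℝ (Fin 3), |y 1 - 2 * lam * l| ≤ y 0 - 2 * lam * k →
        y 0 - 2 * lam * k ≤ lam → y ∈ beam lam k l := fun y h1 h2 =>
      ⟨(abs_of_nonneg ((abs_nonneg _).trans h1)).trans_le h2, h1.trans h2⟩
    have bz : ∀ y : EuclideanSpace ℝ (Fin 3), |y 1 - 2 * lam * l| ≤ 2 * lam * (k + 1) - y 0 →
        2 * lam * (k + 1) - y 0 ≤ lam → y ∈ beam lam (k + 1) l := fun y h1 h2 =>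
      ⟨by push_cast; rw [abs_sub_comm, abs_of_nonneg ((abs_nonneg _).trans h1)]; exact h2,
        h1.trans h2⟩
    rcases le_total (x 0 - 2 * lam * k) lam with hxk | hxk <;>
      rcases le_total (z 0 - 2 * lam * k) lam with hzk | hzk
    · exact weaken (bx x (cx x x1 x3) hxk) (bx z (cx z z1 z3) hzk)
    · exact dist_dir_across_zero hh hlam (cx x x1 x3) hxk (cy z z2 z4) (by linarith)
    · have := dist_dir_across_zero hh hlam (cx z z1 z3) hzk (cy x x2 x4) (by linarith)
      rw [dist_comm]
      linarith
    · exact weaken (bz x (cy x x2 x4) (by linarith)) (bz z (cy z z2 z4) (by linarith))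
  · obtain ⟨k, rfl⟩ : ∃ k', k = k' - 1 := ⟨k + 1, by ring⟩
    obtain ⟨l, rfl⟩ : ∃ l, m = k + l := ⟨m - k, by ring⟩
    obtain rfl : n = k - l - 1 := by omega
    push_cast at x1 x2 x3 x4 z1 z2 z3 z4
    have cx : ∀ y : EuclideanSpace ℝ (Fin 3), 2 * lam * (k + l) < y 0 + y 1 →
        y 0 - y 1 < 2 * lam * (k - l - 1 + 1) → |y 0 - 2 * lam * k| ≤ y 1 - 2 * lam * l :=
      fun y h1 h2 => by rw [abs_le]; constructor <;> nlinarith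
    have cy : ∀ y : EuclideanSpace ℝ (Fin 3), y 0 + y 1 < 2 * lam * (k + l + 1) →
        2 * lam * (k - l - 1) < y 0 - y 1 → |y 0 - 2 * lam * k| ≤ 2 * lam * (l + 1) - y 1 :=
      fun y h1 h2 => by rw [abs_le]; constructor <;> nlinarith
    have bx : ∀ y : EuclideanSpace ℝ (Fin 3), |y 0 - 2 * lam * k| ≤ y 1 - 2 * lam * l →
        y 1 - 2 * lam * l ≤ lam → y ∈ beam lam k l := fun y h1 h2 =>
      ⟨h1.trans h2, (abs_of_nonneg ((abs_nonneg _).trans h1)).trans_le h2⟩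
    have bz : ∀ y : EuclideanSpace ℝ (Fin 3), |y 0 - 2 * lam * k| ≤ 2 * lam * (l + 1) - y 1 →
        2 * lam * (l + 1) - y 1 ≤ lam → y ∈ beam lam k (l + 1) := fun y h1 h2 =>
      ⟨h1.trans h2, by push_cast; rw [abs_sub_comm, abs_of_nonneg ((abs_nonneg _).trans h1)]; exact h2⟩
    rcases le_total (x 1 - 2 * lam * l) lam with hxk | hxk <;>
      rcases le_total (z 1 - 2 * lam * l) lam with hzk | hzk
    · exact weaken (bx x (cx x x1 x4) hxk) (bx z (cx z z1 z4) hzk)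
    · exact dist_dir_across_one hh hlam (cx x x1 x4) hxk (cy z z2 z3) (by linarith)
    · have := dist_dir_across_one hh hlam (cx z z1 z4) hzk (cy x x2 x3) (by linarith)
      rw [dist_comm]
      linarith
    · exact weaken (bz x (cy x x2 x3) (by linarith)) (bz z (cy z z2 z3) (by linarith))

/-- Lower bound for the Zorich map on a set on which its direction is expanding. -/
lemma le_dist_zorich (hh : IsSymmetricGenerator L h) (hlam : 0 < lam) (hnu : 0 < nu) {x z}
    {s C : ℝ} (hC : 1 ≤ C) (hx : s ≤ x 2) (hz : s ≤ z 2)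
    (hxz : (x 0 - z 0) ^ 2 + (x 1 - z 1) ^ 2 ≤ C ^ 2 * dist (dir h lam x) (dir h lam z) ^ 2) :
    nu * lam * Real.exp s / C * dist x z ≤ dist (zorich h lam nu x) (zorich h lam nu z) := by
  have h1 := le_dist_zorich_sq hh hlam hnu hx hz
  have h2 := dist_sq_three x z
  refine abs_le_of_sq_le_sq' ?_ dist_nonneg |>.2
  refine le_trans ?_ h1
  rw [mul_pow, div_pow, h2, div_mul_eq_mul_div, div_le_iff₀ (by positivity),
    mul_assoc ((nu * lam * Real.exp s) ^ 2)]
  refine mul_le_mul_of_nonneg_left ?_ (sq_nonneg _)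
  have : (x 2 - z 2) ^ 2 ≤ (x 2 - z 2) ^ 2 * C ^ 2 :=
    le_mul_of_one_le_right (by positivity) (by nlinarith)
  linarith

lemma zorich_injOn_diamond (hh : IsSymmetricGenerator L h) (hlam : 0 < lam) (hnu : 0 < nu)
    (m n : ℤ) : InjOn (zorich h lam nu) (diamond lam m n) := fun x hx z hz hxz => by
  have h1 := dist_dir_of_mem_diamond hh hlam hx hz
  -- Since `1 + t` is at least `1` and `(1 + t)² ≥ t`, this constant serves in place of the square
  -- root of `5 (L λ)²`.
  have h2 := le_dist_zorich hh hlam hnu (C := 1 + 5 * (L * lam) ^ 2) (by nlinarith [sq_nonneg (L * lam)])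
    (min_le_left (x 2) (z 2)) (min_le_right (x 2) (z 2)) (h1.trans (by gcongr; nlinarith [sq_nonneg (L * lam)]))
  rw [hxz, dist_self] at h2
  have h3 : 0 < nu * lam * Real.exp (min (x 2) (z 2)) / (1 + 5 * (L * lam) ^ 2) := by positivity
  exact dist_le_zero.1 (not_lt.1 fun h4 => absurd h2 (not_le.2 (mul_pos h3 h4)))

/-! ### Images of balls -/

/-- An open map that moves the points at distance `r` from `x` by at least `ρ` maps the ball
of radius `r` over the ball of radius `ρ`, provided that it avoids the latter on the boundary of
the set `C` on which it is considered. -/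
lemma ball_subset_image {E : Type*} [NormedAddCommGroup E] [NormedSpace ℝ E] [ProperSpace E]
    {f : E → E} (hf : Continuous f) (hfo : IsOpenMap f) {C : Set E} (hC : IsClosed C) {x : E}
    (hx : x ∈ interior C) {r ρ : ℝ} (hr : 0 < r)
    (hρ : ∀ z ∈ C, dist z x = r → ρ ≤ dist (f z) (f x))
    (hb : ∀ z ∈ frontier C, dist z x ≤ r → f z ∉ ball (f x) ρ) :
    ball (f x) ρ ⊆ f '' ball x r := by
  rcases le_or_gt ρ 0 with h0 | h0
  · rw [ball_eq_empty.2 h0]; exact empty_subset _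
  have hK : IsClosed (f '' (closedBall x r ∩ C)) :=
    (((isCompact_closedBall x r).inter_right hC).image hf).isClosed
  have hO : IsOpen (f '' (ball x r ∩ interior C)) := hfo _ (isOpen_ball.inter isOpen_interior)
  -- Inside the target ball, the image of the compact set lies in the image of its open part:
  -- neither the sphere nor the frontier of `C` can map there. So that image is open and relatively
  -- closed in a connected ball.
  have hsub : ball (f x) ρ ∩ f '' (closedBall x r ∩ C) ⊆ f '' (ball x r ∩ interior C) := by
    rintro _ ⟨hy, z, ⟨hz, hzC⟩, rfl⟩
    refine ⟨z, ⟨?_, ?_⟩, rfl⟩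
    · rw [mem_ball]
      refine lt_of_le_of_ne hz fun h => ?_
      exact absurd (mem_ball.1 hy) (not_lt.2 (hρ z hzC h))
    · by_contra hzi
      exact hb z ⟨subset_closure hzC, hzi⟩ hz hy
  have hconn : IsPreconnected (ball (f x) ρ) := (convex_ball _ _).isPreconnected
  have := hconn.subset_of_closure_inter_subset hO
    ⟨f x, mem_ball_self h0, x, ⟨mem_ball_self hr, hx⟩, rfl⟩ (by
      rintro y ⟨hy, hyb⟩
      refine hsub ⟨hyb, ?_⟩
      exact closure_minimal (image_mono (inter_subset_inter ball_subset_closedBall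
        interior_subset)) hK hy)
  exact this.trans (image_mono inter_subset_left)

/-- Growth of balls that lie in a diamond-shaped beam. -/
lemma ball_subset_image_diamond (hh : IsSymmetricGenerator L h) (hlam : 0 < lam) (hnu : 0 < nu)
    {m n : ℤ} {x} {r : ℝ} (hr : 0 < r) (hx : closedBall x r ⊆ diamond lam m n) :
    r ≤ 2 * lam ∧ ball (zorich h lam nu x)
      (nu * lam * Real.exp (-(2 * lam)) / (1 + 5 * (L * lam) ^ 2) * Real.exp (x 2) * r) ⊆
      zorich h lam nu '' ball x r := by
  have hr2 : r ≤ 2 * lam := by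
    have h1 := hx (mem_closedBall_self hr.le)
    have h2 : x + EuclideanSpace.single 0 r ∈ closedBall x r := by
      rw [mem_closedBall, dist_eq_norm, add_sub_cancel_left]
      simp [abs_of_pos hr]
    have h3 := (hx h2).1.2
    have h4 := h1.1.1
    simp at h3
    linarith
  -- With `C` the closed ball itself, both conditions concern the same sphere. Its points lie at
  -- height at least `x 2 - 2λ`, whence the factor `exp (-(2λ))`.
  refine ⟨hr2, ball_subset_image (continuous_zorich hh hlam) (isOpenMap_zorich hh hlam hnu)
    (C := closedBall x r) isClosed_closedBall ?_ hr (fun z hz hzr => ?_) (fun z hz hzr => ?_)⟩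
  · rw [interior_closedBall _ hr.ne']; exact mem_ball_self hr
  all_goals
    have hz' : dist z x = r := by
      first
      | exact hzr
      | rw [frontier_closedBall _ hr.ne'] at hz; exact hz
    have hzm : z ∈ closedBall x r := hz'.le
    have h1 := dist_dir_of_mem_diamond hh hlam (hx hzm) (hx (mem_closedBall_self hr.le))
    have h3 := abs_coord_le_norm (z - x) 2
    rw [← dist_eq_norm, hz', PiLp.sub_apply, abs_le] at h3
    have h2 := le_dist_zorich hh hlam hnu (C := 1 + 5 * (L * lam) ^ 2) (s := x 2 - 2 * lam)
      (by nlinarith [sq_nonneg (L * lam)]) (by linarith) (by linarith)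
      (h1.trans (by gcongr; nlinarith [sq_nonneg (L * lam)]))
    rw [hz', sub_eq_neg_add, Real.exp_add] at h2
    have h4 : nu * lam * Real.exp (-(2 * lam)) / (1 + 5 * (L * lam) ^ 2) * Real.exp (x 2) * r ≤
      dist (zorich h lam nu z) (zorich h lam nu x) := by
      refine le_trans (le_of_eq ?_) h2
      ring
    first
    | exact h4
    | exact fun h5 => absurd (mem_ball.1 h5) (not_lt.2 h4)

/-- Growth of balls centred at a point whose image lies in the upper half-space. -/
lemma ball_subset_image_beam (hh : IsSymmetricGenerator L h) (hlam : 1 ≤ lam) (hnu : 0 < nu)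
    {x} {r : ℝ} (hr : 0 < r) (hr1 : r ≤ 1) (hx : 0 < zorich h lam nu x 2) :
    ball (zorich h lam nu x) (min (zorich h lam nu x 2)
      (nu * Real.exp (-1) / L * Real.exp (x 2) * r)) ⊆ zorich h lam nu '' ball x r := by
  have hL := hh.one_le
  have hlam0 : 0 < lam := by linarith
  have hm := mem_beam_cell hlam0 x
  set k := cell lam (x 0)
  set l := cell lam (x 1)
  -- The walls are mapped into the plane of height zero, which a ball around `zorich h lam nu x` of
  -- radius at most the height of that point does not meet.
  have bdry : ∀ z ∈ beam lam k l, z ∉ interior (beam lam k l) → zorich h lam nu z 2 = 0 := by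
    intro z hz hzi
    have hb : |cellPoint lam k l z 0| = 1 ∨ |cellPoint lam k l z 1| = 1 := by
      by_contra hcon
      push Not at hcon
      have hmem := cellPoint_mem hlam0 hz
      have c0 := lt_of_le_of_ne hmem.1 hcon.1
      have c1 := lt_of_le_of_ne hmem.2 hcon.2
      rw [abs_cellPoint_zero hlam0, inv_mul_lt_iff₀ hlam0, mul_one] at c0
      rw [abs_cellPoint_one hlam0, inv_mul_lt_iff₀ hlam0, mul_one] at c1
      apply hzi
      rw [mem_interior]
      refine ⟨{y | |y 0 - 2 * lam * k| < lam} ∩ {y | |y 1 - 2 * lam * l| < lam},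
        fun y hy => ⟨le_of_lt hy.1, le_of_lt hy.2⟩, ?_, c0, c1⟩
      exact (isOpen_lt (f := fun y : EuclideanSpace ℝ (Fin 3) => |y 0 - 2 * lam * k|) (by fun_prop)
        continuous_const).inter (isOpen_lt
        (f := fun y : EuclideanSpace ℝ (Fin 3) => |y 1 - 2 * lam * l|) (by fun_prop)
        continuous_const)
    rw [zorich_eq_smul, dir_eq hh hlam0 hz]
    simp [hh.eq_zero_of_boundary (cellPoint_mem hlam0 hz) hb]
  refine ball_subset_image (continuous_zorich hh hlam0) (isOpenMap_zorich hh hlam0 hnu)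
    (C := beam lam k l) (isClosed_beam k l) ?_ hr (fun z hz hzr => ?_) (fun z hz hzr h5 => ?_)
  · by_contra hcon
    exact hx.ne' (bdry x hm hcon)
  · have h1 := dist_dir_of_mem_beam hh hlam0 hz hm
    have h3 := abs_coord_le_norm (z - x) 2
    rw [← dist_eq_norm, hzr, PiLp.sub_apply, abs_le] at h3
    have h2 := le_dist_zorich hh hlam0 hnu (C := L * lam) (s := x 2 - 1)
      (by nlinarith) (by linarith) (by linarith) h1
    rw [hzr, sub_eq_neg_add, Real.exp_add] at h2
    refine (min_le_right _ _).trans (le_trans (le_of_eq ?_) h2)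
    field_simp
  · have hzC : z ∈ beam lam k l := (isClosed_beam k l).frontier_subset hz
    have h0 := bdry z hzC hz.2
    have h3 := abs_coord_le_norm (zorich h lam nu z - zorich h lam nu x) 2
    rw [PiLp.sub_apply, h0, zero_sub, abs_neg, abs_of_pos hx, ← dist_eq_norm] at h3
    exact absurd (mem_ball.1 h5) (not_lt.2 ((min_le_left _ _).trans h3))

/-! ### An obstruction for orbits -/

/-- Iterated exponentials, started at `0`. -/
noncomputable def tower (κ : ℝ) : ℕ → ℝ
  | 0 => 0
  | n + 1 => κ * Real.exp (tower κ n)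

lemma tower_nonneg {κ : ℝ} (hκ : 1 / 2 ≤ κ) (n : ℕ) : 0 ≤ tower κ n := by
  cases n with
  | zero => exact le_rfl
  | succ n => rw [tower]; positivity

/-- Half of `1 + x + x²/2` equals the left-hand side. With factor at least `1/2` the exponential
thus has no fixed point on the half-line, and the gap grows quadratically. -/
lemma add_le_mul_exp {κ : ℝ} (hκ : 1 / 2 ≤ κ) {x : ℝ} (hx : 0 ≤ x) :
    x + ((x - 1) ^ 2 / 4 + 1 / 4) ≤ κ * Real.exp x := by
  have := Real.quadratic_le_exp_of_nonneg hx
  nlinarith [Real.exp_pos x]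

lemma tower_lower {κ : ℝ} (hκ : 1 / 2 ≤ κ) (n : ℕ) : (n : ℝ) / 4 ≤ tower κ n := by
  induction n with
  | zero => simp [tower]
  | succ n ih =>
    have := add_le_mul_exp hκ (tower_nonneg hκ n)
    rw [tower]; push_cast
    nlinarith [sq_nonneg (tower κ n - 1)]

lemma doubling_unbounded {s : ℕ → ℝ} (h0 : 0 < s 0) (h : ∀ k, 2 * s k ≤ s (k + 1)) (R : ℝ) :
    ∃ K, ∀ k ≥ K, R < s k := by
  have h1 : ∀ k, (k + 1) * s 0 ≤ s k := by
    intro k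
    induction k with
    | zero => simp
    | succ k ih => push_cast; nlinarith [h k, (Nat.cast_nonneg k : (0 : ℝ) ≤ k)]
  obtain ⟨K, hK⟩ := exists_nat_gt (R / s 0)
  refine ⟨K, fun k hk => lt_of_lt_of_le ?_ (h1 k)⟩
  rw [div_lt_iff₀ h0] at hK
  have : (K : ℝ) ≤ k := by exact_mod_cast hk
  nlinarith

/-- Once the gap between consecutive tower values exceeds `log (2 / q)`, the product `q ^ n * exp
(tower κ n)` at least doubles at each step. -/
lemma tower_beats_geometric {κ q : ℝ} (hκ : 1 / 2 ≤ κ) (hq : 0 < q) (C : ℝ) :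
    ∃ N : ℕ, ∀ n ≥ N, C ≤ q ^ n * Real.exp (tower κ n) := by
  obtain ⟨N, hN⟩ := exists_nat_gt (4 * (1 + 4 * |Real.log (2 / q)|))
  have step : ∀ n ≥ N, 2 * (q ^ n * Real.exp (tower κ n)) ≤
      q ^ (n + 1) * Real.exp (tower κ (n + 1)) := by
    intro n hn
    have h1 := tower_lower hκ n
    have h2 : (N : ℝ) ≤ n := by exact_mod_cast hn
    have h3 := add_le_mul_exp hκ (tower_nonneg hκ n)
    have h4 : tower κ n + Real.log (2 / q) ≤ tower κ (n + 1) := by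
      rw [tower]
      have := le_abs_self (Real.log (2 / q))
      have h5 : 4 * |Real.log (2 / q)| ≤ tower κ n - 1 := by linarith
      have h6 := abs_nonneg (Real.log (2 / q))
      rcases le_total (|Real.log (2 / q)|) (1 / 4) with h | h
      · nlinarith [sq_nonneg (tower κ n - 1)]
      · nlinarith
    have h5 := Real.exp_le_exp.2 h4
    rw [Real.exp_add, Real.exp_log (by positivity)] at h5
    calc 2 * (q ^ n * Real.exp (tower κ n)) = q ^ (n + 1) * (Real.exp (tower κ n) * (2 / q)) := by
          field_simp
          rw [pow_succ]
      _ ≤ _ := by gcongr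
  obtain ⟨K, hK⟩ := doubling_unbounded (s := fun k => q ^ (N + k) * Real.exp (tower κ (N + k)))
    (by positivity) (fun k => step (N + k) (by omega)) C
  refine ⟨N + K, fun n hn => ?_⟩
  obtain ⟨k, rfl⟩ := Nat.exists_eq_add_of_le (show N ≤ n by omega)
  exact (hK k (by omega)).le

/-- There is no orbit with heights `τ`, distances `p` from the axis, and norms `N`, that eventually
leaves every bounded set away from the axis and carries balls of bounded radii `r`. -/
lemma orbit_obstruction {r p τ N : ℕ → ℝ} {c C κ κ' ε₀ R₀ : ℝ} (hc : 0 < c) (hC : 0 < C)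
    (hκ : 0 < κ) (hκ' : 1 / 2 ≤ κ') (hε₀ : 0 < ε₀) (r_pos : ∀ n, 0 < r n) (r_le : ∀ n, r n ≤ R₀)
    (r_succ : ∀ n, r (n + 1) = c * Real.exp (τ n) * r n)
    (N_succ : ∀ n, N (n + 1) = κ * Real.exp (τ n)) (hτ : ∀ n, |τ n| ≤ N n)
    (hp : ∀ n, p n ≤ N n) (p_succ : ∀ n, p (n + 1) ≤ C * Real.exp (τ n) * p n)
    (near : ∀ n, p n ≤ ε₀ → κ' * Real.exp (τ n) ≤ τ (n + 1))
    (esc : ∀ ε > 0, ∀ R, ∃ n₀, ∀ n ≥ n₀, N n ≤ R → p n < ε) : False := by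
  -- A bounded orbit point sufficiently close to the axis stays within `ε₀` of it for any prescribed
  -- number of steps.
  have follow : ∀ J : ℕ, ∀ B : ℝ, ∃ ε > 0, ∀ n, p n < ε → N n ≤ B → ∀ j ≤ J, p (n + j) ≤ ε₀ := by
    intro J
    induction J with
    | zero =>
      refine fun B => ⟨ε₀, hε₀, fun n hn _ j hj => ?_⟩
      obtain rfl : j = 0 := by omega
      exact hn.le
    | succ J ih =>
      intro B
      obtain ⟨ε, hε, H⟩ := ih (κ * Real.exp B)
      refine ⟨min ε₀ (ε / (C * Real.exp B)), by positivity, fun n hn hB j hj => ?_⟩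
      cases j with
      | zero => exact (hn.trans_le (min_le_left _ _)).le
      | succ j =>
        have hτB : Real.exp (τ n) ≤ Real.exp B :=
          Real.exp_le_exp.2 ((le_abs_self _).trans ((hτ n).trans hB))
        rw [show n + (j + 1) = n + 1 + j by ring]
        refine H (n + 1) ?_ ?_ j (by omega)
        · have h1 := hn.trans_le (min_le_right _ _)
          rw [lt_div_iff₀ (by positivity)] at h1
          have h2 := p_succ n
          rcases le_or_gt (p n) 0 with h | h
          · have : 0 ≤ C * Real.exp (τ n) := by positivity
            nlinarith
          · calc _ ≤ C * Real.exp (τ n) * p n := h2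
              _ ≤ C * Real.exp B * p n := by gcongr
              _ < ε := by linarith
        · rw [N_succ]; gcongr
  -- Radii double whenever the height is at least `M`. As the radii are bounded, heights below `M`
  -- must recur.
  set M := Real.log (2 / c)
  have grow : ∀ n, M ≤ τ n → 2 * r n ≤ r (n + 1) := by
    intro n hn
    have h1 := Real.exp_le_exp.2 hn
    rw [Real.exp_log (by positivity), div_le_iff₀ hc] at h1
    rw [r_succ]
    exact mul_le_mul_of_nonneg_right (by linarith) (r_pos n).le
  have low : ∀ n, ∃ m ≥ n, τ m < M := by
    intro n
    by_contra! hcon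
    obtain ⟨K, hK⟩ := doubling_unbounded (s := fun k => r (n + k)) (r_pos _)
      (fun k => grow (n + k) (hcon _ (by omega))) R₀
    exact absurd (r_le (n + K)) (not_le.2 (hK K le_rfl))
  -- Both `r` and `p` pick up the same factor `e^τ`, so up to a geometric loss the radius grows at
  -- least as fast as the distance from the axis.
  have lower : ∀ n j, (c / C) ^ j * (c / κ) * p (n + 1 + j) * r n ≤ r (n + 1 + j) := by
    intro n j
    induction j with
    | zero =>
      have h1 := hp (n + 1)
      rw [N_succ] at h1
      rw [pow_zero, one_mul, add_zero, r_succ]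
      refine mul_le_mul_of_nonneg_right ?_ (r_pos n).le
      rw [div_mul_eq_mul_div, div_le_iff₀ hκ]
      nlinarith
    | succ j ih =>
      rw [show n + 1 + (j + 1) = n + 1 + j + 1 by ring, r_succ]
      have h1 := p_succ (n + 1 + j)
      have h2 := r_pos n
      calc (c / C) ^ (j + 1) * (c / κ) * p (n + 1 + j + 1) * r n
          ≤ (c / C) ^ (j + 1) * (c / κ) * (C * Real.exp (τ (n + 1 + j)) * p (n + 1 + j)) * r n := by
            gcongr
        _ = c * Real.exp (τ (n + 1 + j)) * ((c / C) ^ j * (c / κ) * p (n + 1 + j) * r n) := by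
            rw [pow_succ]; field_simp
        _ ≤ _ := by gcongr
  -- After `J` steps of tower growth the last factor `e^τ` outweighs the geometric loss in `lower`
  -- and still leaves a factor `2`.
  obtain ⟨J, hJ⟩ := tower_beats_geometric hκ' (div_pos hc hC)
    (2 / (c * (c / C) * (c / κ) * ε₀))
  obtain ⟨ε, hε, hfollow⟩ := follow (J + 1) (κ * Real.exp M)
  obtain ⟨n₀, hn₀⟩ := esc ε hε (κ * Real.exp M)
  -- One cycle: a low height makes the next point bounded, hence very close to the axis. The heights
  -- then climb until the first departure from the `ε₀`-neighbourhood, which exists because low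
  -- heights recur and which comes late enough for the radius to have doubled. The radius does not
  -- decrease again before the next low height.
  have next : ∀ n ≥ n₀, τ n < M → ∃ m ≥ n₀, τ m < M ∧ 2 * r n ≤ r m := by
    intro n hn hnM
    have hB : N (n + 1) ≤ κ * Real.exp M := by rw [N_succ]; gcongr
    have hsmall := hfollow (n + 1) (hn₀ (n + 1) (by omega) hB) hB
    have climb : ∀ i : ℕ, (∀ j ≤ i, p (n + 1 + j) ≤ ε₀) → tower κ' i ≤ τ (n + 2 + i) := by
      intro i
      induction i with
      | zero =>
        intro hi
        have := near _ (hi 0 le_rfl)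
        exact le_trans (by rw [tower]; positivity) this
      | succ i ih =>
        intro hi
        have h1 := near _ (hi (i + 1) le_rfl)
        have h2 := ih fun j hj => hi j (by omega)
        rw [tower]
        rw [show n + 1 + (i + 1) + 1 = n + 2 + (i + 1) by ring,
          show n + 1 + (i + 1) = n + 2 + i by ring] at h1
        refine le_trans ?_ h1
        gcongr
    have hex : ∃ j, ε₀ < p (n + 1 + j) := by
      by_contra! hcon
      obtain ⟨K, hK⟩ := exists_nat_gt (4 * M)
      obtain ⟨m, hm, hmM⟩ := low (n + 2 + K)
      obtain ⟨i, rfl⟩ := Nat.exists_eq_add_of_le (show n + 2 ≤ m by omega)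
      have h1 := climb i fun j _ => hcon j
      have h2 := tower_lower hκ' i
      have h3 : (K : ℝ) ≤ i := by exact_mod_cast (show K ≤ i by omega)
      linarith
    classical
    obtain ⟨j, hj, hmin⟩ : ∃ j, ε₀ < p (n + 1 + j) ∧ ∀ i < j, p (n + 1 + i) ≤ ε₀ :=
      ⟨Nat.find hex, Nat.find_spec hex, fun i hi => not_lt.1 (Nat.find_min hex hi)⟩
    have hjJ : J + 1 < j := by
      by_contra hcon
      exact absurd (hsmall j (by omega)) (not_le.2 hj)
    obtain ⟨i, rfl⟩ : ∃ i, j = i + 1 := ⟨j - 1, by omega⟩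
    have h1 := climb i fun k hk => hmin k (by omega)
    have h2 := lower n (i + 1)
    have h3 := hJ i (by omega)
    have hr := r_pos n
    rw [div_le_iff₀ (by positivity)] at h3
    have big : 2 * r n ≤ r (n + 2 + i + 1) := by
      rw [r_succ]
      rw [show n + 1 + (i + 1) = n + 2 + i by ring] at h2 hj
      calc 2 * r n ≤ ((c / C) ^ i * Real.exp (tower κ' i) * (c * (c / C) * (c / κ) * ε₀)) * r n := by
            gcongr
        _ = c * Real.exp (tower κ' i) * ((c / C) ^ (i + 1) * (c / κ) * ε₀ * r n) := by
            rw [pow_succ]; ring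
        _ ≤ c * Real.exp (τ (n + 2 + i)) * ((c / C) ^ (i + 1) * (c / κ) * p (n + 2 + i) * r n) := by
            gcongr
        _ ≤ _ := by gcongr
    have hex2 : ∃ k, τ (n + 2 + i + 1 + k) < M := by
      obtain ⟨m, hm, hmM⟩ := low (n + 2 + i + 1)
      obtain ⟨k, rfl⟩ := Nat.exists_eq_add_of_le hm
      exact ⟨k, hmM⟩
    obtain ⟨k, hk, hkmin⟩ : ∃ k, τ (n + 2 + i + 1 + k) < M ∧
        ∀ i' < k, M ≤ τ (n + 2 + i + 1 + i') :=
      ⟨Nat.find hex2, Nat.find_spec hex2, fun i hi => not_lt.1 (Nat.find_min hex2 hi)⟩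
    have mono : ∀ k' ≤ k, r (n + 2 + i + 1) ≤ r (n + 2 + i + 1 + k') := by
      intro k'
      induction k' with
      | zero => exact fun _ => le_rfl
      | succ k' ih =>
        intro hk'
        have h4 := grow _ (hkmin k' (by omega))
        have h5 := ih (by omega)
        have h6 := r_pos (n + 2 + i + 1 + k')
        rw [← add_assoc]
        linarith
    exact ⟨_, by omega, hk, big.trans (mono k le_rfl)⟩
  obtain ⟨n₁, hn₁, hM₁⟩ := low n₀
  have iter : ∀ k : ℕ, ∃ m ≥ n₀, τ m < M ∧ (k + 1) * r n₁ ≤ r m := by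
    intro k
    induction k with
    | zero => exact ⟨n₁, hn₁, hM₁, by simp⟩
    | succ k ih =>
      obtain ⟨m, hm, hmM, hmr⟩ := ih
      obtain ⟨m', hm', hmM', hmr'⟩ := next m hm hmM
      refine ⟨m', hm', hmM', ?_⟩
      push_cast
      nlinarith [r_pos n₁, (Nat.cast_nonneg k : (0 : ℝ) ≤ k)]
  obtain ⟨K, hK⟩ := exists_nat_gt (R₀ / r n₁)
  obtain ⟨m, -, -, hm⟩ := iter K
  rw [div_lt_iff₀ (r_pos n₁)] at hK
  linarith [r_le m, r_pos n₁]

/-! ### Expansion of volume -/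

/-- A map that is expanding with respect to the distance `dist (T a) (T b)`, where `T` is linear,
increases volume at least by the factor `c ^ d * |det T|`. -/
lemma volume_image_ge {d : ℕ} {f : EuclideanSpace ℝ (Fin d) → EuclideanSpace ℝ (Fin d)}
    (T : EuclideanSpace ℝ (Fin d) →ₗ[ℝ] EuclideanSpace ℝ (Fin d))
    {A : Set (EuclideanSpace ℝ (Fin d))} {c : ℝ} (hc : 0 < c)
    (hf : ∀ x ∈ A, ∀ y ∈ A, c * dist (T x) (T y) ≤ dist (f x) (f y)) :
    ENNReal.ofReal (c ^ d * |LinearMap.det T|) * volume A ≤ volume (f '' A) := by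
  have hrank : Module.finrank ℝ (EuclideanSpace ℝ (Fin d)) = d := by simp
  have hH : (μH[(d : ℝ)] : Measure (EuclideanSpace ℝ (Fin d))).IsAddHaarMeasure := by
    have := MeasureTheory.isAddHaarMeasure_hausdorffMeasure (E := EuclideanSpace ℝ (Fin d))
    rwa [hrank] at this
  -- The map `f x ↦ T x` is Lipschitz with constant `c⁻¹` on `f '' A`, so Hausdorff measure of
  -- dimension `d` gives the bound; being a Haar measure, it is proportional to volume.
  have key : ENNReal.ofReal (c ^ d) * μH[(d : ℝ)] (T '' A) ≤ μH[(d : ℝ)] (f '' A) := by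
    have hch : ∀ y ∈ f '' A, ∃ x ∈ A, f x = y := fun y hy => hy
    choose! g hgA hg using hch
    have hlip : LipschitzOnWith (Real.toNNReal c⁻¹) (fun y => T (g y)) (f '' A) := by
      refine LipschitzOnWith.of_dist_le_mul fun y hy z hz => ?_
      rw [Real.coe_toNNReal _ (inv_nonneg.2 hc.le)]
      have := hf _ (hgA y hy) _ (hgA z hz)
      rw [hg y hy, hg z hz] at this
      rwa [inv_mul_eq_div, le_div_iff₀' hc]
    have himg : T '' A ⊆ (fun y => T (g y)) '' (f '' A) := by
      rintro _ ⟨x, hx, rfl⟩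
      refine ⟨f x, mem_image_of_mem f hx, ?_⟩
      have := hf _ (hgA (f x) (mem_image_of_mem f hx)) _ hx
      rw [hg _ (mem_image_of_mem f hx), dist_self] at this
      exact dist_le_zero.1 (not_lt.1 fun h => absurd this (not_le.2 (mul_pos hc h)))
    have h1 := hlip.hausdorffMeasure_image_le (d := (d : ℝ)) (by positivity)
    have h2 := (measure_mono himg).trans h1
    calc ENNReal.ofReal (c ^ d) * μH[(d : ℝ)] (T '' A)
        ≤ ENNReal.ofReal (c ^ d) * ((Real.toNNReal c⁻¹ : ℝ≥0∞) ^ (d : ℝ) * μH[(d : ℝ)] (f '' A)) := by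
          gcongr
      _ = (ENNReal.ofReal c * ENNReal.ofReal c⁻¹) ^ d * μH[(d : ℝ)] (f '' A) := by
          rw [ENNReal.rpow_natCast, mul_pow, ENNReal.ofReal_pow hc.le, mul_assoc]; rfl
      _ = μH[(d : ℝ)] (f '' A) := by
          rw [← ENNReal.ofReal_mul hc.le, mul_inv_cancel₀ hc.ne', ENNReal.ofReal_one, one_pow,
            one_mul]
  have hv := Measure.isAddLeftInvariant_eq_smul (volume : Measure (EuclideanSpace ℝ (Fin d)))
    (μH[(d : ℝ)] : Measure (EuclideanSpace ℝ (Fin d)))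
  rw [hv, Measure.smul_apply, Measure.smul_apply, ENNReal.ofReal_mul (by positivity), mul_assoc]
  rw [Measure.addHaar_image_linearMap] at key
  rw [ENNReal.smul_def, ENNReal.smul_def, smul_eq_mul, smul_eq_mul]
  refine le_trans (le_of_eq ?_) (mul_le_mul_right key _)
  ring

/-- Expansion of a measure under an injective map can be verified on the pieces of a countable
partition. -/
lemma measure_image_ge_of_pieces {E ι : Type*} [TopologicalSpace E] [PolishSpace E]
    [MeasurableSpace E] [BorelSpace E] [Countable ι] {μ : Measure E} {f : E → E}
    (hf : Continuous f) {A : Set E} (hA : MeasurableSet A) (hinj : InjOn f A) (φ : E → ι)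
    (hφ : ∀ i, MeasurableSet (φ ⁻¹' {i})) {q : ℝ≥0∞}
    (h : ∀ i, q * μ (A ∩ φ ⁻¹' {i}) ≤ μ (f '' (A ∩ φ ⁻¹' {i}))) : q * μ A ≤ μ (f '' A) := by
  have hAe : A = ⋃ i, A ∩ φ ⁻¹' {i} := by
    ext x; simp
  have hm : ∀ i, MeasurableSet (A ∩ φ ⁻¹' {i}) := fun i => hA.inter (hφ i)
  have hd : Pairwise (Function.onFun Disjoint fun i => A ∩ φ ⁻¹' {i}) := by
    intro i j hij
    rw [Function.onFun, Set.disjoint_left]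
    rintro x ⟨-, h1⟩ ⟨-, h2⟩
    exact hij (h1.symm.trans h2)
  have hd' : Pairwise (Function.onFun Disjoint fun i => f '' (A ∩ φ ⁻¹' {i})) := by
    intro i j hij
    rw [Function.onFun, Set.disjoint_left]
    rintro _ ⟨x, ⟨hx, h1⟩, rfl⟩ ⟨y, ⟨hy, h2⟩, hxy⟩
    rw [hinj hy hx hxy] at h2
    exact hij (h1.symm.trans h2)
  calc q * μ A = q * ∑' i, μ (A ∩ φ ⁻¹' {i}) := by
        rw [← measure_iUnion hd hm, ← hAe]
    _ = ∑' i, q * μ (A ∩ φ ⁻¹' {i}) := ENNReal.tsum_mul_left.symm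
    _ ≤ ∑' i, μ (f '' (A ∩ φ ⁻¹' {i})) := ENNReal.tsum_le_tsum h
    _ = μ (⋃ i, f '' (A ∩ φ ⁻¹' {i})) := by
        rw [measure_iUnion hd' fun i => (hm i).image_of_continuousOn_injOn hf.continuousOn
          (hinj.mono inter_subset_left)]
    _ = μ (f '' A) := by rw [← image_iUnion, ← hAe]

/-! ### Orbits of open sets meet the invariant planes -/

/-- The distance from the vertical axis. -/
noncomputable def axisDist (x : EuclideanSpace ℝ (Fin 3)) : ℝ := √(x 0 ^ 2 + x 1 ^ 2)

lemma axisDist_nonneg (x) : 0 ≤ axisDist x := Real.sqrt_nonneg _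

lemma axisDist_sq (x) : axisDist x ^ 2 = x 0 ^ 2 + x 1 ^ 2 := Real.sq_sqrt (by positivity)

lemma continuous_axisDist : Continuous axisDist := by unfold axisDist; fun_prop

lemma axisDist_le_norm (x) : axisDist x ≤ ‖x‖ := by
  refine abs_le_of_sq_le_sq' ?_ (norm_nonneg x) |>.2
  rw [axisDist_sq, norm_sq_three]
  nlinarith [sq_nonneg (x 2)]

lemma norm_cellPoint_sq (hlam : 0 < lam) (k l : ℤ) (x) :
    lam ^ 2 * ‖cellPoint lam k l x‖ ^ 2 = (x 0 - 2 * lam * k) ^ 2 + (x 1 - 2 * lam * l) ^ 2 := by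
  have h0 := abs_cellPoint_zero hlam k l x
  have h1 := abs_cellPoint_one hlam k l x
  rw [norm_sq_two, ← sq_abs (cellPoint lam k l x 0), ← sq_abs (cellPoint lam k l x 1), h0, h1,
    mul_pow, mul_pow, sq_abs, sq_abs]
  field_simp

lemma norm_cellPoint_cell_le (hlam : 0 < lam) (x) :
    lam * ‖cellPoint lam (cell lam (x 0)) (cell lam (x 1)) x‖ ≤ axisDist x := by
  refine abs_le_of_sq_le_sq' ?_ (axisDist_nonneg x) |>.2
  rw [mul_pow, norm_cellPoint_sq hlam, axisDist_sq, ← sq_abs (x 0 - _), ← sq_abs (x 1 - _),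
    ← sq_abs (x 0), ← sq_abs (x 1), ← abs_fold, ← abs_fold]
  have := abs_fold_le_abs hlam (x 0)
  have := abs_fold_le_abs hlam (x 1)
  gcongr

lemma dist_pole_le (hh : IsSymmetricGenerator L h) {w} (hw : w ∈ square) :
    h w 0 ^ 2 + h w 1 ^ 2 + (1 - h w 2) ^ 2 ≤ (L * ‖w‖) ^ 2 := by
  have h1 := hh.dist_le w hw 0 (by simp [square])
  rw [dist_zero_right] at h1
  have h2 := dist_sq_three (h w) (h 0)
  rw [hh.map_zero] at h1 h2
  have h3 := pow_le_pow_left₀ dist_nonneg h1 2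
  rw [h2] at h3
  simp only [Matrix.cons_val_zero, Matrix.cons_val_one, Matrix.cons_val, sub_zero] at h3
  nlinarith

/-- The axis passes through beam centres mapped to the pole, so the generator's Lipschitz bound
controls the horizontal part of the image. Folding does not increase the distance from the axis, and
the factor `λ` cancels. -/
lemma axisDist_zorich_le (hh : IsSymmetricGenerator L h) (hlam : 0 < lam) (hnu : 0 < nu) (x) :
    axisDist (zorich h lam nu x) ≤ L * nu * Real.exp (x 2) * axisDist x := by
  have hL := hh.one_le
  set w := cellPoint lam (cell lam (x 0)) (cell lam (x 1)) x
  have h1 := dist_pole_le hh (cellPoint_mem hlam (mem_beam_cell hlam x))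
  have h2 := norm_cellPoint_cell_le hlam x
  have h3 : axisDist (zorich h lam nu x) ≤ nu * lam * Real.exp (x 2) * (L * ‖w‖) := by
    refine abs_le_of_sq_le_sq' ?_ (by positivity) |>.2
    rw [axisDist_sq, zorich_eq_smul, dir]
    simp only [PiLp.smul_apply, flip_zero, flip_one, smul_eq_mul]
    have : 0 ≤ (1 - h w 2) ^ 2 := sq_nonneg _
    calc _ = (nu * lam * Real.exp (x 2)) ^ 2 * (h w 0 ^ 2 + h w 1 ^ 2) := by ring
      _ ≤ (nu * lam * Real.exp (x 2)) ^ 2 * (L * ‖w‖) ^ 2 := by gcongr; linarith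
      _ = _ := by ring
  calc _ ≤ _ := h3
    _ = L * nu * Real.exp (x 2) * (lam * ‖w‖) := by ring
    _ ≤ _ := by gcongr

/-- At this distance the direction lies within `1/2` of the pole, so at least half of the norm of
the image is height. -/
lemma zorich_two_near_axis (hh : IsSymmetricGenerator L h) (hlam : 0 < lam) (hnu : 0 < nu) {x}
    (hx : axisDist x ≤ lam / (2 * L)) :
    nu * lam / 2 * Real.exp (x 2) ≤ zorich h lam nu x 2 := by
  have hL := hh.one_le
  have hx' : axisDist x ≤ lam := hx.trans (div_le_self hlam.le (by linarith))
  have ha := axisDist_sq x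
  have m : x ∈ beam lam 0 0 := by
    constructor
    · rw [show x 0 - 2 * lam * ((0 : ℤ) : ℝ) = x 0 by simp]
      exact abs_le_of_sq_le_sq (by nlinarith [sq_nonneg (x 1), axisDist_nonneg x]) hlam.le
    · rw [show x 1 - 2 * lam * ((0 : ℤ) : ℝ) = x 1 by simp]
      exact abs_le_of_sq_le_sq (by nlinarith [sq_nonneg (x 0), axisDist_nonneg x]) hlam.le
  have h1 := dist_pole_le hh (cellPoint_mem hlam m)
  have h2 := norm_cellPoint_sq hlam 0 0 x
  simp only [Int.cast_zero, mul_zero, sub_zero] at h2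
  rw [← ha, ← mul_pow] at h2
  have h3 : lam * ‖cellPoint lam 0 0 x‖ = axisDist x :=
    (pow_left_inj₀ (by positivity) (axisDist_nonneg x) two_ne_zero).1 h2
  have h4 : L * ‖cellPoint lam 0 0 x‖ ≤ 1 / 2 := by
    rw [← h3, le_div_iff₀ (by positivity)] at hx
    nlinarith
  have h5 : 1 / 2 ≤ h (cellPoint lam 0 0 x) 2 := by
    have : (L * ‖cellPoint lam 0 0 x‖) ^ 2 ≤ (1 / 2) ^ 2 := by gcongr
    nlinarith [sq_nonneg (h (cellPoint lam 0 0 x) 0), sq_nonneg (h (cellPoint lam 0 0 x) 1)]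
  rw [zorich_eq_smul, dir_eq hh hlam m]
  simp only [PiLp.smul_apply, flip_two, smul_eq_mul, add_zero, zpow_zero, one_mul]
  have : 0 < nu * lam * Real.exp (x 2) := by positivity
  nlinarith

/-- The axis lies in the planes that bound the diamonds. -/
lemma axisDist_pos_of_mem_diamond (hlam : 0 < lam) {m n : ℤ} {x} (hx : x ∈ diamond lam m n) :
    0 < axisDist x := by
  refine (axisDist_nonneg x).lt_of_ne fun h0 => ?_
  have h1 := axisDist_sq x
  rw [← h0] at h1
  have e0 : x 0 = 0 := by nlinarith [sq_nonneg (x 0), sq_nonneg (x 1)]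
  have e1 : x 1 = 0 := by nlinarith [sq_nonneg (x 0), sq_nonneg (x 1)]
  obtain ⟨h2, h3⟩ := hx.1
  rw [e0, e1] at h2 h3
  have h4 : (m : ℝ) < 0 := by nlinarith
  have h5 : (-1 : ℝ) < m := by nlinarith
  have h4' : m < 0 := by exact_mod_cast h4
  have h5' : -1 < m := by exact_mod_cast h5
  omega

/-- The measure with density `axisDist ^ (-3)`. -/
noncomputable def axisMeasure : Measure (EuclideanSpace ℝ (Fin 3)) :=
  volume.withDensity fun x => (ENNReal.ofReal (axisDist x))⁻¹ ^ 3

lemma measurable_axisDensity : Measurable fun x : EuclideanSpace ℝ (Fin 3) =>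
    (ENNReal.ofReal (axisDist x))⁻¹ ^ 3 :=
  (continuous_axisDist.measurable.ennreal_ofReal.inv).pow_const 3

lemma axisMeasure_le {A : Set (EuclideanSpace ℝ (Fin 3))} {a : ℝ}
    (hA : ∀ x ∈ A, a ≤ axisDist x) : axisMeasure A ≤ (ENNReal.ofReal a)⁻¹ ^ 3 * volume A := by
  rw [axisMeasure, withDensity_apply' _ A, ← setLIntegral_const]
  refine setLIntegral_mono measurable_const fun x hx => ?_
  gcongr
  exact hA x hx

lemma le_axisMeasure {A : Set (EuclideanSpace ℝ (Fin 3))} {a : ℝ}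
    (hA : ∀ x ∈ A, axisDist x ≤ a) : (ENNReal.ofReal a)⁻¹ ^ 3 * volume A ≤ axisMeasure A := by
  rw [axisMeasure, withDensity_apply' _ A, ← setLIntegral_const]
  refine setLIntegral_mono measurable_axisDensity fun x hx => ?_
  gcongr
  exact hA x hx

/-- Multiplication of the last coordinate by `a`. -/
noncomputable def stretch (d : ℕ) (a : ℝ) :
    EuclideanSpace ℝ (Fin (d + 1)) →ₗ[ℝ] EuclideanSpace ℝ (Fin (d + 1)) :=
  Matrix.toEuclideanLin (Matrix.diagonal fun i => if i = Fin.last d then a else 1)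

lemma stretch_apply (d : ℕ) (a : ℝ) (x : EuclideanSpace ℝ (Fin (d + 1))) (i) :
    stretch d a x i = (if i = Fin.last d then a else 1) * x i := by
  simp [stretch, Matrix.toLpLin_apply, Matrix.mulVec_diagonal]

lemma det_stretch (d : ℕ) (a : ℝ) : LinearMap.det (stretch d a) = a := by
  rw [stretch, LinearMap.det_toLpLin, Matrix.det_diagonal,
    Fin.prod_univ_castSucc]
  simp [Fin.castSucc_ne_last]

/-- Horizontally the lower constant is `ν e^s / L`, vertically it is `ν λ e^s`. Keeping the two
apart by a stretch of factor `L λ` preserves the factor `λ` in the volume bound, on which the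
condition `λ > L⁵` rests. -/
lemma dist_stretch_le (hh : IsSymmetricGenerator L h) (hlam : 0 < lam) (hnu : 0 < nu) {k l : ℤ}
    {x z} (hx : x ∈ beam lam k l) (hz : z ∈ beam lam k l) {s : ℝ} (hxs : s ≤ x 2) (hzs : s ≤ z 2) :
    (nu * Real.exp s / L) ^ 2 *
      ((x 0 - z 0) ^ 2 + (x 1 - z 1) ^ 2 + (L * lam) ^ 2 * (x 2 - z 2) ^ 2) ≤
      dist (zorich h lam nu x) (zorich h lam nu z) ^ 2 := by
  have hL := hh.one_le
  refine le_trans ?_ (le_dist_zorich_sq hh hlam hnu hxs hzs)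
  have h1 := dist_dir_of_mem_beam hh hlam hx hz
  calc _ ≤ (nu * Real.exp s / L) ^ 2 * ((L * lam) ^ 2 * dist (dir h lam x) (dir h lam z) ^ 2 +
          (L * lam) ^ 2 * (x 2 - z 2) ^ 2) := by gcongr
    _ = _ := by field_simp; ring

lemma volume_image_beam (hh : IsSymmetricGenerator L h) (hlam : 0 < lam) (hnu : 0 < nu) {k l : ℤ}
    {A : Set (EuclideanSpace ℝ (Fin 3))} {s : ℝ} (hA : A ⊆ beam lam k l) (hs : ∀ x ∈ A, s ≤ x 2) :
    ENNReal.ofReal ((nu * Real.exp s / L) ^ 3 * (L * lam)) * volume A ≤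
      volume (zorich h lam nu '' A) := by
  have hL := hh.one_le
  have := volume_image_ge (f := zorich h lam nu) (A := A) (stretch 2 (L * lam))
    (c := nu * Real.exp s / L) (by positivity) fun x hx z hz => ?_
  · rwa [det_stretch, abs_of_pos (by positivity)] at this
  · refine abs_le_of_sq_le_sq' ?_ dist_nonneg |>.2
    refine le_trans (le_of_eq ?_) (dist_stretch_le hh hlam hnu (hA hx) (hA hz) (hs x hx) (hs z hz))
    rw [mul_pow, dist_sq_three]
    simp only [stretch_apply]
    simp [Fin.last, Fin.ext_iff]
    left; ring

/-- Expansion of `axisMeasure` on diamond-shaped beams. -/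
lemma exists_axisMeasure_expansion (hh : IsSymmetricGenerator L h) (hlam : L ^ 5 < lam)
    (hnu : 0 < nu) : ∃ q : ℝ, 1 < q ∧ ∀ (m n : ℤ) (A : Set (EuclideanSpace ℝ (Fin 3))),
      MeasurableSet A → A ⊆ diamond lam m n →
      ENNReal.ofReal q * axisMeasure A ≤ axisMeasure (zorich h lam nu '' A) := by
  have hL := hh.one_le
  have hL5 : 1 ≤ L ^ 5 := one_le_pow₀ hL
  have hlam0 : 0 < lam := by linarith
  have hq0 : 1 < lam / L ^ 5 := (one_lt_div (by positivity)).2 hlam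
  -- The pieces have size `δ` in height and in the logarithm of the distance from the axis. Each
  -- rounding costs `e^{3δ}`, because of the cube, so half of the available factor `e^{12δ} = λ /
  -- L⁵` survives.
  set δ := Real.log (lam / L ^ 5) / 12
  have hδ : 0 < δ := div_pos (Real.log_pos hq0) (by norm_num)
  have hexp : Real.exp (12 * δ) = lam / L ^ 5 := by
    rw [mul_div_cancel₀ _ (by norm_num), Real.exp_log (by linarith)]
  refine ⟨Real.exp (6 * δ), Real.one_lt_exp_iff.2 (by positivity), fun m n A hA hAd => ?_⟩
  have hround : Measurable (round : ℝ → ℤ) := by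
    have : (round : ℝ → ℤ) = fun x => ⌊x + 1 / 2⌋ := funext round_eq
    rw [this]; fun_prop
  let φ : EuclideanSpace ℝ (Fin 3) → ℤ × ℤ × ℤ × ℤ := fun x =>
    (cell lam (x 0), cell lam (x 1), ⌊x 2 / δ⌋, ⌊Real.log (axisDist x) / δ⌋)
  have hφ : Measurable φ := by
    have h1 := continuous_axisDist.measurable
    refine Measurable.prodMk ?_ (Measurable.prodMk ?_ (Measurable.prodMk ?_ ?_))
    · exact hround.comp (by fun_prop)
    · exact hround.comp (by fun_prop)
    · fun_prop
    · fun_prop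
  refine measure_image_ge_of_pieces (continuous_zorich hh hlam0) hA
    ((zorich_injOn_diamond hh hlam0 hnu m n).mono hAd) φ
    (fun i => hφ (measurableSet_singleton i)) fun i => ?_
  obtain ⟨k, l, s, j⟩ := i
  set P := A ∩ φ ⁻¹' {(k, l, s, j)}
  have hP : ∀ x ∈ P, x ∈ beam lam k l ∧ (s * δ ≤ x 2 ∧ x 2 ≤ (s + 1) * δ) ∧
      (Real.exp (j * δ) ≤ axisDist x ∧ axisDist x ≤ Real.exp ((j + 1) * δ)) := by
    rintro x ⟨hxA, hx⟩
    have hx' : (cell lam (x 0), cell lam (x 1), ⌊x 2 / δ⌋, ⌊Real.log (axisDist x) / δ⌋) =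
      (k, l, s, j) := hx
    simp only [Prod.mk.injEq] at hx'
    obtain ⟨h1, h2, h3, h4⟩ := hx'
    have hp := axisDist_pos_of_mem_diamond hlam0 (hAd hxA)
    rw [Int.floor_eq_iff, le_div_iff₀ hδ, div_lt_iff₀ hδ] at h3 h4
    refine ⟨h1 ▸ h2 ▸ mem_beam_cell hlam0 x, ⟨h3.1, h3.2.le⟩, ?_, ?_⟩
    · rw [← Real.le_log_iff_exp_le hp]; exact h4.1
    · rw [← Real.log_le_iff_le_exp hp]; exact h4.2.le
  have h1 := axisMeasure_le (A := P) (a := Real.exp (j * δ)) fun x hx => (hP x hx).2.2.1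
  have h2 := le_axisMeasure (A := zorich h lam nu '' P)
    (a := L * nu * Real.exp ((s + 1) * δ) * Real.exp ((j + 1) * δ)) (by
      rintro _ ⟨x, hx, rfl⟩
      obtain ⟨-, ⟨-, hx2⟩, -, hx3⟩ := hP x hx
      refine (axisDist_zorich_le hh hlam0 hnu x).trans ?_
      have := axisDist_nonneg x
      gcongr)
  have h3 := volume_image_beam hh hlam0 hnu (A := P) (s := s * δ) (fun x hx => (hP x hx).1)
    fun x hx => (hP x hx).2.1.1
  refine le_trans ?_ h2
  refine le_trans (mul_le_mul_right h1 _) ?_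
  refine le_trans ?_ (mul_le_mul_right h3 _)
  rw [← mul_assoc, ← mul_assoc]
  refine mul_le_mul_left ?_ _
  rw [← ENNReal.ofReal_inv_of_pos (by positivity), ← ENNReal.ofReal_inv_of_pos (by positivity),
    ← ENNReal.ofReal_pow (by positivity), ← ENNReal.ofReal_pow (by positivity),
    ← ENNReal.ofReal_mul (by positivity), ← ENNReal.ofReal_mul (by positivity)]
  refine ENNReal.ofReal_le_ofReal (le_of_eq ?_)
  have e1 : Real.exp ((s + 1) * δ) = Real.exp (s * δ) * Real.exp δ := by
    rw [← Real.exp_add]; ring_nf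
  have e2 : Real.exp ((j + 1) * δ) = Real.exp (j * δ) * Real.exp δ := by
    rw [← Real.exp_add]; ring_nf
  have e3 : Real.exp (6 * δ) = Real.exp δ ^ 6 := by
    rw [← Real.exp_nat_mul]; norm_num
  have e4 : lam = L ^ 5 * Real.exp δ ^ 12 := by
    rw [← Real.exp_nat_mul, show ((12 : ℕ) : ℝ) * δ = 12 * δ by norm_num, hexp]
    field_simp
  rw [e1, e2, e3, e4]
  field_simp

lemma preconnected_subset_Ioo {E : Type*} [TopologicalSpace E] {S : Set E} (hS : IsPreconnected S)
    {f : E → ℝ} (hf : Continuous f) {a : ℝ} (ha : 0 < a) (hne : ∀ x ∈ S, ∀ m : ℤ, f x ≠ a * m) :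
    ∃ m : ℤ, ∀ x ∈ S, f x ∈ Ioo (a * m) (a * (m + 1)) := by
  rcases S.eq_empty_or_nonempty with rfl | ⟨x₀, hx₀⟩
  · exact ⟨0, fun x hx => hx.elim⟩
  have hI := (hS.image f hf.continuousOn).ordConnected
  refine ⟨⌊f x₀ / a⌋, fun x hx => ?_⟩
  have h1 := Int.floor_le (f x₀ / a)
  have h2 := Int.lt_floor_add_one (f x₀ / a)
  rw [le_div_iff₀' ha] at h1
  rw [div_lt_iff₀' ha] at h2
  have avoid : ∀ m : ℤ, a * m ∉ f '' S := by
    rintro m ⟨y, hy, h⟩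
    exact hne y hy m h
  constructor
  · by_contra! hcon
    exact avoid _ (hI.out (mem_image_of_mem f hx) (mem_image_of_mem f hx₀) ⟨hcon, h1⟩)
  · by_contra! hcon
    refine avoid (⌊f x₀ / a⌋ + 1) (hI.out (mem_image_of_mem f hx₀) (mem_image_of_mem f hx) ⟨?_, ?_⟩)
    · push_cast; exact h2.le
    · push_cast; exact hcon

lemma iterate_succ_image {E : Type*} (f : E → E) (n : ℕ) (S : Set E) :
    f^[n + 1] '' S = f '' (f^[n] '' S) := by
  rw [Function.iterate_succ', image_comp]

/-- The bound on `ν` gives `(ν λ)² > 2 L λ > 1`. -/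
lemma one_le_nu_mul_lam (hL : 1 ≤ L) (hlam : L ^ 5 < lam) (hnu : √(2 * L / lam) < nu) :
    0 < nu ∧ 1 ≤ nu * lam ∧ 2 * L < nu ^ 2 * lam := by
  have hL5 : 1 ≤ L ^ 5 := one_le_pow₀ hL
  have hlam0 : 0 < lam := by linarith
  have h0 : 0 < nu := (Real.sqrt_nonneg _).trans_lt hnu
  have h1 : 2 * L / lam < nu ^ 2 := (Real.sqrt_lt' h0).1 hnu
  rw [div_lt_iff₀ hlam0] at h1
  refine ⟨h0, ?_, h1⟩
  by_contra! hcon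
  have : (nu * lam) ^ 2 < 1 := by
    have : 0 < nu * lam := by positivity
    nlinarith
  nlinarith

/-- Almost every point of an open set, whose images are all contained in diamond-shaped beams,
eventually leaves every bounded set that has a positive distance from the axis. -/
lemma exists_escaping_point (hh : IsSymmetricGenerator L h) (hlam : L ^ 5 < lam)
    (hnu : 0 < nu) {V : Set (EuclideanSpace ℝ (Fin 3))} (hV : IsOpen V) (hVne : V.Nonempty)
    (hd : ∀ n, ∃ m k : ℤ, (zorich h lam nu)^[n] '' V ⊆ diamond lam m k) :
    ∃ x ∈ V, ∀ ε > 0, ∀ R : ℝ, ∃ n₀, ∀ n ≥ n₀, ‖(zorich h lam nu)^[n] x‖ ≤ R →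
      axisDist ((zorich h lam nu)^[n] x) < ε := by
  have hlam0 : 0 < lam := lt_trans (pow_pos (by linarith [hh.one_le]) 5) hlam
  obtain ⟨q, hq, hexp⟩ := exists_axisMeasure_expansion hh hlam hnu
  set Z := zorich h lam nu
  have hZ : Continuous Z := continuous_zorich hh hlam0
  have hinj : ∀ n, InjOn Z^[n] V := by
    intro n
    induction n with
    | zero => exact injOn_id V
    | succ n ih =>
      rw [Function.iterate_succ']
      obtain ⟨m, k, hmk⟩ := hd n
      exact (zorich_injOn_diamond hh hlam0 hnu m k).comp ih fun x hx => hmk (mem_image_of_mem _ hx)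
  have hgrow : ∀ n, ∀ A ⊆ V, MeasurableSet A →
      ENNReal.ofReal q ^ n * axisMeasure A ≤ axisMeasure (Z^[n] '' A) := by
    intro n A hAV hA
    induction n with
    | zero => simp
    | succ n ih =>
      obtain ⟨m, k, hmk⟩ := hd n
      have hm : MeasurableSet (Z^[n] '' A) :=
        hA.image_of_continuousOn_injOn (hZ.iterate n).continuousOn ((hinj n).mono hAV)
      rw [iterate_succ_image, pow_succ', mul_assoc]
      exact (mul_le_mul_right ih _).trans (hexp m k _ hm ((image_mono hAV).trans hmk))
  let K : ℕ → Set (EuclideanSpace ℝ (Fin 3)) := fun j =>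
    {x | 1 / ((j : ℝ) + 1) ≤ axisDist x} ∩ closedBall 0 j
  have hKm : ∀ j, MeasurableSet (K j) := fun j =>
    (isClosed_le continuous_const continuous_axisDist).measurableSet.inter
      isClosed_closedBall.measurableSet
  have hKfin : ∀ j, axisMeasure (K j) ≠ ⊤ := by
    intro j
    have h1 := axisMeasure_le (A := K j) (a := 1 / ((j : ℝ) + 1)) fun x hx => hx.1
    refine ne_top_of_le_ne_top (ENNReal.mul_ne_top (ENNReal.pow_ne_top ?_) ?_) h1
    · exact ENNReal.inv_ne_top.2 (ENNReal.ofReal_pos.2 (by positivity)).ne'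
    · exact ne_top_of_le_ne_top measure_closedBall_lt_top.ne (measure_mono inter_subset_right)
  -- Borel-Cantelli: the points of `V` that are in `K j` at time `n` have measure at most
  -- `axisMeasure (K j) / q ^ n`, which is summable.
  have hae : ∀ j, ∀ᵐ x ∂axisMeasure, ∀ᶠ n in atTop, x ∉ V ∩ Z^[n] ⁻¹' (K j) := by
    intro j
    refine ae_eventually_notMem ?_
    have hle : ∀ n, axisMeasure (V ∩ Z^[n] ⁻¹' (K j)) ≤
        axisMeasure (K j) * (ENNReal.ofReal q)⁻¹ ^ n := by
      intro n
      have h1 := hgrow n (V ∩ Z^[n] ⁻¹' (K j)) inter_subset_left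
        (hV.measurableSet.inter ((hZ.iterate n).measurable (hKm j)))
      have h2 : axisMeasure (Z^[n] '' (V ∩ Z^[n] ⁻¹' (K j))) ≤ axisMeasure (K j) :=
        measure_mono (image_subset_iff.2 inter_subset_right)
      have hqpos : ENNReal.ofReal q ^ n ≠ 0 :=
        pow_ne_zero _ (ENNReal.ofReal_pos.2 (by linarith)).ne'
      rw [← ENNReal.inv_pow, ← div_eq_mul_inv, ENNReal.le_div_iff_mul_le (Or.inl hqpos)
        (Or.inl (ENNReal.pow_ne_top ENNReal.ofReal_ne_top)), mul_comm]
      exact h1.trans h2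
    refine ne_top_of_le_ne_top ?_ (ENNReal.tsum_le_tsum hle)
    rw [ENNReal.tsum_mul_left, ENNReal.tsum_geometric]
    refine ENNReal.mul_ne_top (hKfin j) (ENNReal.inv_ne_top.2 (tsub_pos_of_lt ?_).ne')
    exact ENNReal.inv_lt_one.2 (by rw [← ENNReal.ofReal_one]; exact ENNReal.ofReal_lt_ofReal_iff_of_nonneg zero_le_one |>.2 hq)
  have hVpos : axisMeasure V ≠ 0 := by
    obtain ⟨v, hv⟩ := hVne
    have hO : IsOpen (V ∩ ball 0 (‖v‖ + 1)) := hV.inter isOpen_ball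
    have h1 := le_axisMeasure (A := V ∩ ball 0 (‖v‖ + 1)) (a := ‖v‖ + 1) fun x hx =>
      (axisDist_le_norm x).trans (mem_ball_zero_iff.1 hx.2).le
    have h2 := hO.measure_pos volume ⟨v, hv, by simp⟩
    have h3 : 0 < axisMeasure (V ∩ ball 0 (‖v‖ + 1)) := by
      refine lt_of_lt_of_le (ENNReal.mul_pos (pow_ne_zero _ ?_) h2.ne') h1
      exact ENNReal.inv_ne_zero.2 ENNReal.ofReal_ne_top
    exact (h3.trans_le (measure_mono inter_subset_left)).ne'
  have hall := ae_all_iff.2 hae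
  obtain ⟨x, hxV, hx⟩ : ∃ x ∈ V, ∀ j, ∀ᶠ n in atTop, x ∉ V ∩ Z^[n] ⁻¹' (K j) := by
    by_contra! hcon
    refine hVpos (measure_mono_null (fun x hx => ?_) hall)
    obtain ⟨j, hj⟩ := hcon x hx
    intro hx'
    exact hj (hx' j)
  refine ⟨x, hxV, fun ε hε R => ?_⟩
  obtain ⟨j₁, hj₁⟩ := exists_nat_one_div_lt hε
  obtain ⟨j₂, hj₂⟩ := exists_nat_ge R
  obtain ⟨n₀, hn₀⟩ := eventually_atTop.1 (hx (max j₁ j₂))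
  refine ⟨n₀, fun n hn hR => ?_⟩
  by_contra! hcon
  refine hn₀ n hn ⟨hxV, ?_, ?_⟩
  · refine le_trans (le_trans ?_ hj₁.le) hcon
    have : (j₁ : ℝ) ≤ (max j₁ j₂ : ℕ) := by exact_mod_cast le_max_left _ _
    gcongr
  · rw [mem_closedBall_zero_iff]
    have : (j₂ : ℝ) ≤ (max j₁ j₂ : ℕ) := by exact_mod_cast le_max_right _ _
    linarith

/-- The forward orbit of every open set meets the preimages of the planes `y₁ = ± y₀`. -/
lemma exists_iterate_mem_plane (hh : IsSymmetricGenerator L h) (hlam : L ^ 5 < lam)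
    (hnu : √(2 * L / lam) < nu) {V : Set (EuclideanSpace ℝ (Fin 3))} (hV : IsOpen V)
    (hVne : V.Nonempty) : ∃ x ∈ V, ∃ n : ℕ, ∃ m : ℤ,
      (zorich h lam nu)^[n] x 0 + (zorich h lam nu)^[n] x 1 = 2 * lam * m ∨
      (zorich h lam nu)^[n] x 0 - (zorich h lam nu)^[n] x 1 = 2 * lam * m := by
  have hL := hh.one_le
  have hlam0 : 0 < lam := lt_trans (pow_pos (by linarith) 5) hlam
  obtain ⟨hnu0, hκ, -⟩ := one_le_nu_mul_lam hL hlam hnu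
  by_contra! hcon
  obtain ⟨v, hv⟩ := hVne
  obtain ⟨ρ, hρ, hball⟩ := Metric.isOpen_iff.1 hV v hv
  set Z := zorich h lam nu
  have hZ : Continuous Z := continuous_zorich hh hlam0
  have hd : ∀ n, ∃ m k : ℤ, Z^[n] '' ball v ρ ⊆ diamond lam m k := by
    intro n
    have hc : IsPreconnected (Z^[n] '' ball v ρ) :=
      (convex_ball v ρ).isPreconnected.image _ (hZ.iterate n).continuousOn
    obtain ⟨m, hm⟩ := preconnected_subset_Ioo hc
      (f := fun x : EuclideanSpace ℝ (Fin 3) => x 0 + x 1) (by fun_prop) (a := 2 * lam)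
      (by positivity) (by
        rintro _ ⟨x, hx, rfl⟩ m
        exact (hcon x (hball hx) n m).1)
    obtain ⟨k, hk⟩ := preconnected_subset_Ioo hc
      (f := fun x : EuclideanSpace ℝ (Fin 3) => x 0 - x 1) (by fun_prop) (a := 2 * lam)
      (by positivity) (by
        rintro _ ⟨x, hx, rfl⟩ m
        exact (hcon x (hball hx) n m).2)
    exact ⟨m, k, fun x hx => ⟨hm x hx, hk x hx⟩⟩
  obtain ⟨x, hxV, hesc⟩ := exists_escaping_point hh hlam hnu0 isOpen_ball
    (nonempty_ball.2 hρ) hd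
  obtain ⟨r₀, hr₀, hr₀V⟩ : ∃ r > 0, closedBall x r ⊆ ball v ρ :=
    nhds_basis_closedBall.mem_iff.1 (isOpen_ball.mem_nhds hxV)
  -- The final division by `2` turns the open balls of `ball_subset_image_diamond` into closed ones,
  -- so that the inclusion can be iterated.
  set c := nu * lam * Real.exp (-(2 * lam)) / (1 + 5 * (L * lam) ^ 2) / 2 with hcdef
  have hc0 : 0 < c := by positivity
  let r : ℕ → ℝ := fun n => Nat.rec r₀ (fun n s => c * Real.exp (Z^[n] x 2) * s) n
  have r_succ : ∀ n, r (n + 1) = c * Real.exp (Z^[n] x 2) * r n := fun n => rfl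
  have r_pos : ∀ n, 0 < r n := by
    intro n
    induction n with
    | zero => exact hr₀
    | succ n ih => rw [r_succ]; positivity
  have hr : ∀ n, closedBall (Z^[n] x) (r n) ⊆ Z^[n] '' ball v ρ := by
    intro n
    induction n with
    | zero => rw [Function.iterate_zero, image_id]; exact hr₀V
    | succ n ih =>
      obtain ⟨m, k, hmk⟩ := hd n
      have h1 := (ball_subset_image_diamond hh hlam0 hnu0 (r_pos n) (ih.trans hmk)).2
      rw [iterate_succ_image, Function.iterate_succ_apply']
      refine Subset.trans ?_ (h1.trans (image_mono (ball_subset_closedBall.trans ih)))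
      refine closedBall_subset_ball ?_
      rw [r_succ, hcdef]
      have := r_pos n
      have : 0 < nu * lam * Real.exp (-(2 * lam)) / (1 + 5 * (L * lam) ^ 2) *
        Real.exp (Z^[n] x 2) * r n := by positivity
      linarith
  refine orbit_obstruction (r := r) (p := fun n => axisDist (Z^[n] x)) (τ := fun n => Z^[n] x 2)
    (N := fun n => ‖Z^[n] x‖) (c := c) (C := L * nu) (κ := nu * lam) (κ' := nu * lam / 2)
    (ε₀ := lam / (2 * L)) (R₀ := 2 * lam) hc0 (by positivity) (by positivity) (by linarith)
    (by positivity) r_pos (fun n => ?_) r_succ (fun n => ?_) (fun n => abs_coord_le_norm _ 2)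
    (fun n => axisDist_le_norm _) (fun n => ?_) (fun n hn => ?_) hesc
  · obtain ⟨m, k, hmk⟩ := hd n
    exact (ball_subset_image_diamond hh hlam0 hnu0 (r_pos n) ((hr n).trans hmk)).1
  · simp only [Function.iterate_succ_apply']
    exact norm_zorich hh hlam0 hnu0 _
  · simp only [Function.iterate_succ_apply']
    exact axisDist_zorich_le hh hlam0 hnu0 _
  · simp only [Function.iterate_succ_apply']
    exact zorich_two_near_axis hh hlam0 hnu0 hn

/-! ### The planes `y₁ = ± y₀` -/

/-- Folding sends the plane to a diagonal of the square, which the symmetric generator maps into `y₁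
= ± y₀`. -/
lemma zorich_mem_plane (hh : IsSymmetricGenerator L h) (hlam : 0 < lam) {σ : ℝ}
    (hσ : σ = 1 ∨ σ = -1) {k l : ℤ} {x : EuclideanSpace ℝ (Fin 3)} (hx : |x 0 - 2 * lam * k| ≤ lam)
    (hx' : x 1 - 2 * lam * l = σ * (x 0 - 2 * lam * k)) :
    zorich h lam nu x 1 = (-1) ^ (k + l) * σ * zorich h lam nu x 0 := by
  have hm : x ∈ beam lam k l := by
    refine ⟨hx, ?_⟩
    rw [hx', abs_mul, show |σ| = 1 by rcases hσ with rfl | rfl <;> norm_num, one_mul]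
    exact hx
  set t := lam⁻¹ * ((-1) ^ k * (x 0 - 2 * lam * k)) with ht
  have ht1 : |t| ≤ 1 := by
    rw [ht, abs_mul, abs_mul, abs_neg_one_zpow, one_mul, abs_of_pos (by positivity),
      inv_mul_le_iff₀ hlam, mul_one]
    exact hx
  set e := (-1 : ℝ) ^ (k + l) * σ with he
  have hk := neg_one_zpow_sq k
  have hw : cellPoint lam k l x = !₂[t, e * t] := by
    refine ext_two ?_ ?_
    · simp [cellPoint, ht]
    · simp only [cellPoint, hx', he, ht, zpow_add₀ (show (-1 : ℝ) ≠ 0 by norm_num),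
        PiLp.smul_apply, smul_eq_mul, Matrix.cons_val_zero, Matrix.cons_val_one]
      linear_combination (-(lam⁻¹ * (-1) ^ l * σ * (x 0 - 2 * lam * k))) * hk
  have hd : dir h lam x 1 = e * dir h lam x 0 := by
    rw [dir_eq hh hlam hm, flip_one, flip_zero, hw]
    have he1 : e = 1 ∨ e = -1 := by
      rcases neg_one_zpow_eq (k + l) with h1 | h1 <;> rcases hσ with h2 | h2 <;>
        rw [he, h1, h2] <;> norm_num
    rcases he1 with h1 | h1
    · rw [h1, one_mul, one_mul, ← hh.diagonal t ht1]
    · rw [h1, neg_one_mul, neg_one_mul, hh.antidiagonal t ht1, neg_neg]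
  rw [zorich_eq_smul, PiLp.smul_apply, PiLp.smul_apply, hd, smul_eq_mul, smul_eq_mul]
  ring

lemma exists_zorich_mem_plane (hh : IsSymmetricGenerator L h) (hlam : 0 < lam) {m : ℤ}
    {x : EuclideanSpace ℝ (Fin 3)} (hx : x 0 + x 1 = 2 * lam * m ∨ x 0 - x 1 = 2 * lam * m) :
    ∃ σ : ℝ, (σ = 1 ∨ σ = -1) ∧ zorich h lam nu x 1 = σ * zorich h lam nu x 0 := by
  have hc := abs_sub_cell_le hlam (x 0)
  have sign : ∀ (j : ℤ) (σ : ℝ), (σ = 1 ∨ σ = -1) →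
      ((-1 : ℝ) ^ j * σ = 1 ∨ (-1 : ℝ) ^ j * σ = -1) := by
    intro j σ hσ
    rcases neg_one_zpow_eq j with h1 | h1 <;> rcases hσ with h2 | h2 <;> rw [h1, h2] <;> norm_num
  rcases hx with hx | hx
  · refine ⟨_, sign _ (-1) (Or.inr rfl), zorich_mem_plane hh hlam (Or.inr rfl)
      (l := m - cell lam (x 0)) hc ?_⟩
    push_cast; linarith
  · refine ⟨_, sign _ 1 (Or.inl rfl), zorich_mem_plane hh hlam (Or.inl rfl)
      (l := cell lam (x 0) - m) hc ?_⟩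
    push_cast; linarith

section plane

variable {σ : ℝ}

/-- The beams along the plane `x₁ = σ x₀` have indices `(k, k)` or `(k, -k)`. Their parity is even,
so `Z` maps the whole plane into its own upper half. -/
lemma exists_diagonal_beam (lam : ℝ) (hσ : σ = 1 ∨ σ = -1) (k : ℤ) :
    ∃ l : ℤ, (-1 : ℝ) ^ (k + l) = 1 ∧ ∀ x : EuclideanSpace ℝ (Fin 3), x 1 = σ * x 0 →
      x 1 - 2 * lam * l = σ * (x 0 - 2 * lam * k) ∧
      (|x 0 - 2 * lam * k| ≤ lam → x ∈ beam lam k l) := by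
  rcases hσ with rfl | rfl
  · refine ⟨k, Even.neg_one_zpow ⟨k, rfl⟩, fun x hx => ⟨by rw [hx]; ring, fun h1 => ⟨h1, ?_⟩⟩⟩
    rw [hx, one_mul]; exact h1
  · refine ⟨-k, by simp, fun x hx => ⟨by rw [hx]; push_cast; ring, fun h1 => ⟨h1, ?_⟩⟩⟩
    rw [hx, ← abs_neg]; push_cast
    rw [show -(-1 * x 0 - 2 * lam * -(k : ℝ)) = x 0 - 2 * lam * k by ring]
    exact h1

lemma zorich_plane (hh : IsSymmetricGenerator L h) (hlam : 0 < lam) (hnu : 0 < nu)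
    (hσ : σ = 1 ∨ σ = -1) {x : EuclideanSpace ℝ (Fin 3)} (hx : x 1 = σ * x 0) :
    zorich h lam nu x 1 = σ * zorich h lam nu x 0 ∧ 0 ≤ zorich h lam nu x 2 := by
  obtain ⟨l, hl, h1⟩ := exists_diagonal_beam lam hσ (cell lam (x 0))
  obtain ⟨h2, h3⟩ := h1 x hx
  have h4 := zorich_mem_plane (nu := nu) hh hlam hσ (abs_sub_cell_le hlam (x 0)) h2
  have h5 := zorich_two_sign hh hlam hnu (h3 (abs_sub_cell_le hlam (x 0)))
  rw [hl, one_mul] at h4 h5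
  exact ⟨h4, h5⟩

lemma zorich_center (hh : IsSymmetricGenerator L h) (hlam : 0 < lam)
    {k l : ℤ} (hkl : (-1 : ℝ) ^ (k + l) = 1) {x : EuclideanSpace ℝ (Fin 3)}
    (h0 : x 0 = 2 * lam * k) (h1 : x 1 = 2 * lam * l) :
    zorich h lam nu x = !₂[0, 0, nu * lam * Real.exp (x 2)] := by
  have hm : x ∈ beam lam k l := by
    constructor
    · rw [h0, sub_self, abs_zero]; exact hlam.le
    · rw [h1, sub_self, abs_zero]; exact hlam.le
  have hc : cellPoint lam k l x = 0 := ext_two (by simp [cellPoint, h0]) (by simp [cellPoint, h1])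
  rw [zorich_eq_smul, dir_eq hh hlam hm, hc, hh.map_zero, hkl]
  refine ext_three ?_ ?_ ?_ <;> simp

/-- The centre line of an even beam goes to the positive axis, where the height follows `t ↦ ν λ e^t
≥ t + 1`. -/
lemma tendsto_height_of_center (hh : IsSymmetricGenerator L h) (hlam : 0 < lam)
    (hκ : 1 ≤ nu * lam) {k l : ℤ} (hkl : (-1 : ℝ) ^ (k + l) = 1) {x : EuclideanSpace ℝ (Fin 3)}
    {N : ℕ} (h0 : (zorich h lam nu)^[N] x 0 = 2 * lam * k)
    (h1 : (zorich h lam nu)^[N] x 1 = 2 * lam * l) :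
    Tendsto (fun n => (zorich h lam nu)^[n] x 2) atTop atTop := by
  set Z := zorich h lam nu
  have key : ∀ j : ℕ, Z^[j + (N + 1)] x 0 = 0 ∧ Z^[j + (N + 1)] x 1 = 0 ∧
      (j : ℝ) ≤ Z^[j + (N + 1)] x 2 := by
    intro j
    induction j with
    | zero =>
      rw [zero_add, Function.iterate_succ_apply', show Z (Z^[N] x) = _ from zorich_center hh hlam hkl h0 h1]
      have := Real.exp_pos (Z^[N] x 2)
      exact ⟨by simp, by simp, by simp; positivity⟩
    | succ j ih =>
      obtain ⟨h2, h3, h4⟩ := ih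
      have h5 := zorich_center (nu := nu) hh hlam (k := 0) (l := 0) (by simp)
        (x := Z^[j + (N + 1)] x) (by simpa using h2) (by simpa using h3)
      rw [add_right_comm, Function.iterate_succ_apply', show Z _ = _ from h5]
      refine ⟨by simp, by simp, ?_⟩
      have := Real.add_one_le_exp (Z^[j + (N + 1)] x 2)
      have h6 : Real.exp (Z^[j + (N + 1)] x 2) ≤ nu * lam * Real.exp (Z^[j + (N + 1)] x 2) :=
        le_mul_of_one_le_left (Real.exp_pos _).le hκ
      simp only [Matrix.cons_val]
      push_cast
      linarith
  rw [← tendsto_add_atTop_iff_nat (N + 1)]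
  exact tendsto_atTop_mono (fun j => (key j).2.2) tendsto_natCast_atTop_atTop

/-- Isometric parametrization of the plane `x₁ = σ x₀`. -/
noncomputable def planeMap (σ : ℝ) (p : EuclideanSpace ℝ (Fin 2)) : EuclideanSpace ℝ (Fin 3) :=
  !₂[p 0 / √2, σ * (p 0 / √2), p 1]

/-- The coordinates of a point in the plane `x₁ = σ x₀`. -/
noncomputable def planeCoord (x : EuclideanSpace ℝ (Fin 3)) : EuclideanSpace ℝ (Fin 2) :=
  !₂[√2 * x 0, x 2]

@[simp] lemma planeMap_zero (p) : planeMap σ p 0 = p 0 / √2 := rfl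
@[simp] lemma planeMap_one (p) : planeMap σ p 1 = σ * (p 0 / √2) := rfl
@[simp] lemma planeMap_two (p) : planeMap σ p 2 = p 1 := rfl

lemma continuous_planeMap : Continuous (planeMap σ) :=
  continuous_mk_three (by fun_prop) (by fun_prop) (by fun_prop)

lemma continuous_planeCoord : Continuous planeCoord :=
  continuous_mk_two (by fun_prop) (by fun_prop)

lemma planeMap_planeCoord {x : EuclideanSpace ℝ (Fin 3)} (hx : x 1 = σ * x 0) :
    planeMap σ (planeCoord x) = x :=
  ext_three (by simp [planeCoord]) (by simp [planeCoord, hx]) (by simp [planeCoord])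

lemma dist_planeMap (hσ : σ = 1 ∨ σ = -1) (p q) : dist (planeMap σ p) (planeMap σ q) = dist p q := by
  refine (pow_left_inj₀ dist_nonneg dist_nonneg two_ne_zero).1 ?_
  rw [dist_sq_three, dist_sq_two]
  simp only [planeMap_zero, planeMap_one, planeMap_two]
  have h2 : (√2 : ℝ) ^ 2 = 2 := Real.sq_sqrt (by norm_num)
  have hs : σ ^ 2 = 1 := by rcases hσ with rfl | rfl <;> norm_num
  rw [← mul_sub, mul_pow, hs, ← sub_div, div_pow, h2]
  ring

/-- The restriction of the Zorich map to the plane `x₁ = σ x₀`. -/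
noncomputable def planeZorich (h : EuclideanSpace ℝ (Fin 2) → EuclideanSpace ℝ (Fin 3))
    (lam nu σ : ℝ) (p : EuclideanSpace ℝ (Fin 2)) : EuclideanSpace ℝ (Fin 2) :=
  planeCoord (zorich h lam nu (planeMap σ p))

lemma planeMap_planeZorich (hh : IsSymmetricGenerator L h) (hlam : 0 < lam) (hnu : 0 < nu)
    (hσ : σ = 1 ∨ σ = -1) (p) :
    planeMap σ (planeZorich h lam nu σ p) = zorich h lam nu (planeMap σ p) :=
  planeMap_planeCoord (zorich_plane hh hlam hnu hσ rfl).1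

lemma planeMap_iterate (hh : IsSymmetricGenerator L h) (hlam : 0 < lam) (hnu : 0 < nu)
    (hσ : σ = 1 ∨ σ = -1) (n : ℕ) (p) :
    planeMap σ ((planeZorich h lam nu σ)^[n] p) = (zorich h lam nu)^[n] (planeMap σ p) := by
  induction n with
  | zero => rfl
  | succ n ih =>
    rw [Function.iterate_succ_apply', Function.iterate_succ_apply',
      planeMap_planeZorich hh hlam hnu hσ, ih]

lemma norm_planeMap (hσ : σ = 1 ∨ σ = -1) (p) : ‖planeMap σ p‖ = ‖p‖ := by
  have h1 := dist_planeMap hσ p 0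
  rwa [show planeMap σ 0 = 0 from ext_three (by simp) (by simp) (by simp), dist_zero_right,
    dist_zero_right] at h1

lemma continuous_planeZorich (hh : IsSymmetricGenerator L h) (hlam : 0 < lam) :
    Continuous (planeZorich h lam nu σ) :=
  continuous_planeCoord.comp ((continuous_zorich hh hlam).comp continuous_planeMap)

lemma volume_image_planeZorich_beam (hh : IsSymmetricGenerator L h) (hlam : 0 < lam) (hnu : 0 < nu)
    (hσ : σ = 1 ∨ σ = -1) {A : Set (EuclideanSpace ℝ (Fin 2))} {s : ℝ} {k : ℤ}
    (hA : ∀ p ∈ A, |p 0 / √2 - 2 * lam * k| ≤ lam) (hs : ∀ p ∈ A, s ≤ p 1) :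
    ENNReal.ofReal ((nu * Real.exp s / L) ^ 2 * (L * lam)) * volume A ≤
      volume (planeZorich h lam nu σ '' A) := by
  have hL := hh.one_le
  obtain ⟨l, -, hl⟩ := exists_diagonal_beam lam hσ k
  have := volume_image_ge (f := planeZorich h lam nu σ) (A := A) (stretch 1 (L * lam))
    (c := nu * Real.exp s / L) (by positivity) fun p hp q hq => ?_
  · rwa [det_stretch, abs_of_pos (by positivity)] at this
  · refine abs_le_of_sq_le_sq' ?_ dist_nonneg |>.2
    rw [← dist_planeMap hσ (planeZorich h lam nu σ p), planeMap_planeZorich hh hlam hnu hσ,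
      planeMap_planeZorich hh hlam hnu hσ]
    refine le_trans (le_of_eq ?_) (dist_stretch_le hh hlam hnu ((hl _ rfl).2 (hA p hp))
      ((hl _ rfl).2 (hA q hq)) (hs p hp) (hs q hq))
    have h2 : (√2 : ℝ) ^ 2 = 2 := Real.sq_sqrt (by norm_num)
    have h3 : σ ^ 2 = 1 := by rcases hσ with rfl | rfl <;> norm_num
    rw [mul_pow (nu * _ / L), dist_sq_two]
    simp only [stretch_apply, planeMap_zero, planeMap_one, planeMap_two]
    rw [← mul_sub σ, mul_pow σ, h3, ← sub_div, div_pow (p 0 - q 0), h2]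
    simp [Fin.last]
    left; ring

/-- A strip between consecutive centre lines consists of two halves in adjacent beams. The images of
the halves may overlap, so adding the two estimates loses a factor `2`; this is the `2` in the bound
on `ν`. -/
lemma volume_image_planeZorich_strip (hh : IsSymmetricGenerator L h) (hlam : 0 < lam) (hnu : 0 < nu)
    (hσ : σ = 1 ∨ σ = -1) {A : Set (EuclideanSpace ℝ (Fin 2))} {s : ℝ} {k : ℤ}
    (hA : ∀ p ∈ A, p 0 / √2 ∈ Ioo (2 * lam * k) (2 * lam * (k + 1))) (hs : ∀ p ∈ A, s ≤ p 1) :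
    ENNReal.ofReal (nu ^ 2 * lam / (2 * L) * Real.exp s ^ 2) * volume A ≤
      volume (planeZorich h lam nu σ '' A) := by
  have hL := hh.one_le
  have h1 := volume_image_planeZorich_beam hh hlam hnu hσ (A := {p ∈ A | p 0 / √2 ≤ 2 * lam * k + lam})
    (k := k) (s := s) (fun p hp => by
      have := (hA p hp.1).1
      have := hp.2
      rw [abs_le]; constructor <;> linarith) fun p hp => hs p hp.1
  have h2 := volume_image_planeZorich_beam hh hlam hnu hσ (A := {p ∈ A | 2 * lam * k + lam ≤ p 0 / √2})
    (k := k + 1) (s := s) (fun p hp => by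
      have := (hA p hp.1).2
      have := hp.2
      push_cast
      rw [abs_le]; constructor <;> linarith) fun p hp => hs p hp.1
  have h3 : volume A ≤ volume {p ∈ A | p 0 / √2 ≤ 2 * lam * k + lam} +
      volume {p ∈ A | 2 * lam * k + lam ≤ p 0 / √2} := by
    refine (measure_mono fun p hp => ?_).trans (measure_union_le _ _)
    rcases le_total (p 0 / √2) (2 * lam * k + lam) with h4 | h4
    · exact Or.inl ⟨hp, h4⟩
    · exact Or.inr ⟨hp, h4⟩
  have h4 : ENNReal.ofReal ((nu * Real.exp s / L) ^ 2 * (L * lam)) * volume A ≤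
      2 * volume (planeZorich h lam nu σ '' A) := by
    calc _ ≤ ENNReal.ofReal ((nu * Real.exp s / L) ^ 2 * (L * lam)) * _ := mul_le_mul_right h3 _
      _ ≤ _ := by
        rw [mul_add, two_mul (volume _)]
        exact add_le_add (h1.trans (measure_mono (image_mono (sep_subset _ _))))
          (h2.trans (measure_mono (image_mono (sep_subset _ _))))
  have h5 : (nu * Real.exp s / L) ^ 2 * (L * lam) =
      2 * (nu ^ 2 * lam / (2 * L) * Real.exp s ^ 2) := by field_simp
  rw [h5, ENNReal.ofReal_mul (by norm_num), mul_assoc, show ENNReal.ofReal 2 = 2 by simp] at h4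
  exact (ENNReal.mul_le_mul_iff_right (by norm_num) (by norm_num)).1 h4

/-- Every open set that meets the plane `x₁ = σ x₀` contains points in this plane whose orbit
escapes upwards. -/
lemma exists_tendsto_height (hh : IsSymmetricGenerator L h) (hlam : L ^ 5 < lam)
    (hnu : √(2 * L / lam) < nu) (hσ : σ = 1 ∨ σ = -1) {V : Set (EuclideanSpace ℝ (Fin 3))}
    (hV : IsOpen V) {v : EuclideanSpace ℝ (Fin 3)} (hv : v ∈ V) (hvσ : v 1 = σ * v 0) :
    ∃ x ∈ V, Tendsto (fun n => (zorich h lam nu)^[n] x 2) atTop atTop := by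
  have hL := hh.one_le
  have hlam0 : 0 < lam := lt_trans (pow_pos (by linarith) 5) hlam
  obtain ⟨hnu0, hκ, hq⟩ := one_le_nu_mul_lam hL hlam hnu
  -- If no orbit in the plane part of `V` hits a centre line, the iterates of a disc stay in strips
  -- and area expansion applies at every step.
  by_cases hcenter : ∃ x ∈ V, x 1 = σ * x 0 ∧ ∃ (n : ℕ) (k : ℤ),
      (zorich h lam nu)^[n] x 0 = 2 * lam * k
  · obtain ⟨x, hx, hxσ, n, k, hk⟩ := hcenter
    refine ⟨x, hx, ?_⟩
    obtain ⟨l, hl, hl'⟩ := exists_diagonal_beam lam hσ k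
    have h1 : (zorich h lam nu)^[n] x 1 = σ * (zorich h lam nu)^[n] x 0 := by
      have := planeMap_iterate hh hlam0 hnu0 hσ n (planeCoord x)
      rw [planeMap_planeCoord hxσ] at this
      rw [← this]; rfl
    refine tendsto_height_of_center hh hlam0 hκ hl hk ?_
    have := (hl' _ h1).1
    rw [hk, sub_self, mul_zero, sub_eq_zero] at this
    exact this
  push Not at hcenter
  set Z := zorich h lam nu
  set F := planeZorich h lam nu σ
  have hF : Continuous F := continuous_planeZorich hh hlam0
  have hiter := planeMap_iterate hh hlam0 hnu0 hσ
  obtain ⟨ρ, hρ, hball⟩ := Metric.isOpen_iff.1 (hV.preimage (continuous_planeMap (σ := σ)))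
    (planeCoord v) (by rw [mem_preimage, planeMap_planeCoord hvσ]; exact hv)
  set O := ball (planeCoord v) ρ
  set s₀ := planeCoord v 1 - ρ
  set q := nu ^ 2 * lam / (2 * L)
  have hq1 : 1 < q := by rw [lt_div_iff₀ (by positivity)]; linarith
  have hs₀ : ∀ p ∈ O, s₀ ≤ p 1 := fun p hp => by
    have h1 := abs_coord_le_norm (p - planeCoord v) 1
    rw [← dist_eq_norm] at h1
    have h2 := (abs_le.1 (h1.trans (mem_ball.1 hp).le)).1
    simp only [PiLp.sub_apply] at h2
    linarith
  have hstrip : ∀ n, ∃ k : ℤ, ∀ p ∈ F^[n] '' O, p 0 / √2 ∈ Ioo (2 * lam * k) (2 * lam * (k + 1)) := by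
    intro n
    refine preconnected_subset_Ioo ((convex_ball _ _).isPreconnected.image _
      (hF.iterate n).continuousOn) (f := fun p : EuclideanSpace ℝ (Fin 2) => p 0 / √2) (by fun_prop)
      (by positivity) ?_
    rintro _ ⟨p, hp, rfl⟩ k hk
    refine hcenter _ (hball hp) rfl n k ?_
    rw [← hk, ← hiter]; rfl
  -- Only the first step can start at negative height, which accounts for the factor `exp s₀ ^ 2`;
  -- afterwards the images lie in the upper half-plane.
  have hgrow : ∀ n, ∀ A ⊆ O, ENNReal.ofReal (q * Real.exp s₀ ^ 2) * ENNReal.ofReal q ^ n * volume A ≤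
      volume (F^[n + 1] '' A) := by
    intro n A hAO
    induction n with
    | zero =>
      obtain ⟨k, hk⟩ := hstrip 0
      rw [pow_zero, mul_one]
      exact volume_image_planeZorich_strip hh hlam0 hnu0 hσ
        (fun p hp => hk p (by simpa using hAO hp)) fun p hp => hs₀ p (hAO hp)
    | succ n ih =>
      obtain ⟨k, hk⟩ := hstrip (n + 1)
      have h1 := volume_image_planeZorich_strip hh hlam0 hnu0 hσ (A := F^[n + 1] '' A) (s := 0)
        (fun p hp => hk p (image_mono hAO hp)) (by
          rintro _ ⟨p, hp, rfl⟩
          rw [Function.iterate_succ_apply']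
          exact (zorich_plane hh hlam0 hnu0 hσ rfl).2)
      rw [Real.exp_zero, one_pow, mul_one] at h1
      rw [iterate_succ_image F (n + 1)]
      refine le_trans (le_of_eq ?_) ((mul_le_mul_right ih _).trans h1)
      rw [pow_succ]; ring
  have hae : ∀ j : ℕ, ∀ᵐ p, ∀ᶠ n in atTop, p ∉ O ∩ F^[n + 1] ⁻¹' closedBall 0 j := by
    intro j
    refine ae_eventually_notMem ?_
    set a := ENNReal.ofReal (q * Real.exp s₀ ^ 2)
    have ha0 : a ≠ 0 := (ENNReal.ofReal_pos.2 (by positivity)).ne'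
    have hle : ∀ n, volume (O ∩ F^[n + 1] ⁻¹' closedBall 0 j) ≤
        volume (closedBall (0 : EuclideanSpace ℝ (Fin 2)) j) * a⁻¹ * (ENNReal.ofReal q)⁻¹ ^ n := by
      intro n
      have h1 := hgrow n (O ∩ F^[n + 1] ⁻¹' closedBall 0 j) inter_subset_left
      have h2 : volume (F^[n + 1] '' (O ∩ F^[n + 1] ⁻¹' closedBall 0 j)) ≤
          volume (closedBall (0 : EuclideanSpace ℝ (Fin 2)) j) :=
        measure_mono (image_subset_iff.2 inter_subset_right)
      have hqpos : ENNReal.ofReal q ^ n ≠ 0 :=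
        pow_ne_zero _ (ENNReal.ofReal_pos.2 (by linarith)).ne'
      have hqtop : ENNReal.ofReal q ^ n ≠ ⊤ := ENNReal.pow_ne_top ENNReal.ofReal_ne_top
      rw [← ENNReal.inv_pow, mul_assoc, ← ENNReal.mul_inv (Or.inl ha0) (Or.inr hqpos),
        ← div_eq_mul_inv, ENNReal.le_div_iff_mul_le (Or.inl (mul_ne_zero ha0 hqpos))
        (Or.inl (ENNReal.mul_ne_top ENNReal.ofReal_ne_top hqtop)), mul_comm]
      exact h1.trans h2
    refine ne_top_of_le_ne_top ?_ (ENNReal.tsum_le_tsum hle)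
    rw [ENNReal.tsum_mul_left, ENNReal.tsum_geometric]
    refine ENNReal.mul_ne_top (ENNReal.mul_ne_top measure_closedBall_lt_top.ne
      (ENNReal.inv_ne_top.2 ha0)) (ENNReal.inv_ne_top.2 (tsub_pos_of_lt ?_).ne')
    exact ENNReal.inv_lt_one.2 (ENNReal.one_lt_ofReal.2 hq1)
  obtain ⟨p, hpO, hp⟩ : ∃ p ∈ O, ∀ j : ℕ, ∀ᶠ n in atTop, p ∉ O ∩ F^[n + 1] ⁻¹' closedBall 0 j := by
    by_contra! hcon
    refine (isOpen_ball.measure_pos volume (nonempty_ball.2 hρ)).ne'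
      (measure_mono_null (fun p hp => ?_) (ae_all_iff.2 hae) : volume O = 0)
    obtain ⟨j, hj⟩ := hcon p hp
    intro hp'
    exact hj (hp' j)
  -- The norm of an image point is `ν λ e^t` for the height `t` one step earlier, so leaving every
  -- ball means that the heights tend to infinity.
  refine ⟨planeMap σ p, hball hpO, tendsto_atTop.2 fun R => ?_⟩
  obtain ⟨j, hj⟩ := exists_nat_ge (nu * lam * Real.exp R)
  filter_upwards [hp j] with n hn
  by_contra! hcon
  refine hn ⟨hpO, ?_⟩
  rw [mem_preimage, mem_closedBall_zero_iff, ← norm_planeMap hσ, hiter, Function.iterate_succ_apply',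
    norm_zorich hh hlam0 hnu0]
  refine le_trans ?_ hj
  have := Real.exp_le_exp.2 hcon.le
  gcongr

end plane

/-! ### Blowing up along upward escaping orbits -/

lemma isOpenMap_iterate {E : Type*} [TopologicalSpace E] {f : E → E} (hf : IsOpenMap f) (n : ℕ) :
    IsOpenMap f^[n] := by
  induction n with
  | zero => exact IsOpenMap.id
  | succ n ih => exact ih.comp hf

/-- High up, balls of radius at most `1` grow by a factor at least `2` until they reach radius `1`.
One further step produces a radius that tends to infinity with the height. -/
lemma eventually_ball_subset (hh : IsSymmetricGenerator L h) (hlam : 1 ≤ lam) (hnu : 0 < nu)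
    {V : Set (EuclideanSpace ℝ (Fin 3))} (hV : IsOpen V) {x : EuclideanSpace ℝ (Fin 3)} (hx : x ∈ V)
    (ht : Tendsto (fun n => (zorich h lam nu)^[n] x 2) atTop atTop) (R : ℝ) :
    ∀ᶠ n in atTop, ball ((zorich h lam nu)^[n] x) R ⊆ (zorich h lam nu)^[n] '' V := by
  have hL := hh.one_le
  have hlam0 : 0 < lam := by linarith
  set Z := zorich h lam nu
  set c := nu * Real.exp (-1) / L
  have hc : 0 < c := by positivity
  have hexp : Tendsto (fun n => c * Real.exp (Z^[n] x 2)) atTop atTop :=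
    (Real.tendsto_exp_atTop.comp ht).const_mul_atTop hc
  have step : ∀ n r, 0 < r → r ≤ 1 → 0 < Z^[n + 1] x 2 → ball (Z^[n] x) r ⊆ Z^[n] '' V →
      ball (Z^[n + 1] x) (min (Z^[n + 1] x 2) (c * Real.exp (Z^[n] x 2) * r)) ⊆ Z^[n + 1] '' V := by
    intro n r hr hr1 hpos hsub
    rw [Function.iterate_succ_apply'] at hpos ⊢
    rw [iterate_succ_image]
    exact (ball_subset_image_beam hh hlam hnu hr hr1 hpos).trans (image_mono hsub)
  obtain ⟨N, hN⟩ := eventually_atTop.1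
    ((ht.eventually_ge_atTop 1).and (hexp.eventually_ge_atTop 2))
  have hone : ∃ M ≥ N, ball (Z^[M] x) 1 ⊆ Z^[M] '' V := by
    have hopen : IsOpen (Z^[N] '' V) := isOpenMap_iterate (isOpenMap_zorich hh hlam0 hnu) N V hV
    obtain ⟨r, hr, hrV⟩ := Metric.isOpen_iff.1 hopen _ (mem_image_of_mem _ hx)
    have key : ∀ j : ℕ, ball (Z^[N + j] x) (min 1 (2 ^ j * r)) ⊆ Z^[N + j] '' V := by
      intro j
      induction j with
      | zero => exact (ball_subset_ball (by simp)).trans hrV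
      | succ j ih =>
        have h1 := (hN (N + j + 1) (by omega)).1
        have h2 := (hN (N + j) (by omega)).2
        have hm : 0 < min 1 (2 ^ j * r) := by positivity
        refine (ball_subset_ball ?_).trans
          (step (N + j) _ hm (min_le_left _ _) (by linarith) ih)
        refine le_min ((min_le_left _ _).trans h1) (le_trans ?_ (mul_le_mul_of_nonneg_right h2 hm.le))
        rw [mul_min_of_nonneg _ _ zero_le_two, pow_succ']
        exact min_le_min (by norm_num) (by rw [mul_assoc])
    obtain ⟨j, hj⟩ := pow_unbounded_of_one_lt r⁻¹ (one_lt_two)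
    refine ⟨N + j, by omega, (ball_subset_ball (le_min le_rfl ?_)).trans (key j)⟩
    rw [inv_lt_iff_one_lt_mul₀ hr] at hj
    linarith
  obtain ⟨M, hM, hMV⟩ := hone
  have hall : ∀ n ≥ M, ball (Z^[n] x) 1 ⊆ Z^[n] '' V := by
    intro n hn
    induction n, hn using Nat.le_induction with
    | base => exact hMV
    | succ n hn ih =>
      have h1 := (hN (n + 1) (by omega)).1
      have h2 := (hN n (by omega)).2
      refine (ball_subset_ball (le_min h1 ?_)).trans (step n 1 one_pos le_rfl (by linarith) ih)
      linarith
  rw [← map_add_atTop_eq_nat 1, eventually_map]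
  filter_upwards [eventually_ge_atTop M, hexp.eventually_ge_atTop R,
    (tendsto_add_atTop_iff_nat 1).2 ht |>.eventually_ge_atTop (max 1 R)] with n h1 h2 h3
  refine (ball_subset_ball (le_min ((le_max_right _ _).trans h3) ?_)).trans
    (step n 1 one_pos le_rfl (by linarith [le_max_left 1 R]) (hall n h1))
  rwa [mul_one]

/-- Every point of the shell has a preimage within `4λ` of `x` in each horizontal coordinate and
within `R / 2` in height. -/
lemma shell_subset_image (hh : IsSymmetricGenerator L h) (hlam : 0 < lam) (hnu : 0 < nu)
    {x z : EuclideanSpace ℝ (Fin 3)} {R : ℝ} (hR : 8 * lam ≤ R)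
    (h1 : nu * lam * Real.exp (x 2 - R / 2) ≤ ‖z‖) (h2 : ‖z‖ ≤ nu * lam * Real.exp (x 2 + R / 2)) :
    z ∈ zorich h lam nu '' ball x R := by
  have hz : z ≠ 0 := by
    rintro rfl
    rw [norm_zero] at h1
    exact absurd h1 (not_le.2 (by positivity))
  obtain ⟨w, rfl, hw0, hw1, hw2⟩ := exists_preimage_near hh hlam hnu hz (x 0) (x 1)
  refine ⟨w, ?_, rfl⟩
  rw [← hw2] at h1 h2
  have h3 := Real.exp_le_exp.1 (le_of_mul_le_mul_left h1 (by positivity))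
  have h4 := Real.exp_le_exp.1 (le_of_mul_le_mul_left h2 (by positivity))
  rw [mem_ball]
  refine abs_lt_of_sq_lt_sq' ?_ (by linarith) |>.2
  rw [dist_sq_three]
  have h5 : (w 0 - x 0) ^ 2 ≤ (4 * lam) ^ 2 := sq_le_sq' (abs_le.1 hw0).1 (abs_le.1 hw0).2
  have h6 : (w 1 - x 1) ^ 2 ≤ (4 * lam) ^ 2 := sq_le_sq' (abs_le.1 hw1).1 (abs_le.1 hw1).2
  have h7 : (w 2 - x 2) ^ 2 ≤ (R / 2) ^ 2 := sq_le_sq' (by linarith) (by linarith)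
  have h8 : (8 * lam) ^ 2 ≤ R ^ 2 := pow_le_pow_left₀ (by positivity) hR 2
  have : 0 < lam ^ 2 := by positivity
  nlinarith

/-- The image of an open set that contains an upward escaping point covers everything but `0`. -/
lemma exists_mem_image_of_tendsto (hh : IsSymmetricGenerator L h) (hlam : 1 ≤ lam) (hnu : 0 < nu)
    (hκ : 1 ≤ nu * lam) {V : Set (EuclideanSpace ℝ (Fin 3))} (hV : IsOpen V)
    {x : EuclideanSpace ℝ (Fin 3)} (hx : x ∈ V)
    (ht : Tendsto (fun n => (zorich h lam nu)^[n] x 2) atTop atTop) {y} (hy : y ≠ 0) :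
    ∃ n, y ∈ (zorich h lam nu)^[n] '' V := by
  have hlam0 : 0 < lam := by linarith
  set Z := zorich h lam nu
  set η := Real.log (‖y‖ / (nu * lam))
  set R := 12 * lam + |η| with hRdef
  have hη := abs_nonneg η
  obtain ⟨n, hball, hs⟩ := ((eventually_ball_subset hh hlam hnu hV hx ht R).and
    (ht.eventually_ge_atTop R)).exists
  set u := nu * lam * Real.exp (Z^[n] x 2 - R / 2) with hu
  have hu0 : 0 < u := by positivity
  -- The shell has radii `u` and `u e^R`. A preimage of `y` near the line over `(u + 4λ, 0)` has
  -- first coordinate at least `u` and norm at most `u + 12λ + |η| = u + R ≤ u (1 + R)`, so it lies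
  -- in the shell.
  obtain ⟨w, hwy, hw0, hw1, hw2⟩ := exists_preimage_near hh hlam0 hnu hy (u + 4 * lam) 0
  have hw2' : w 2 = η := by
    rw [← Real.exp_eq_exp, Real.exp_log (div_pos (norm_pos_iff.2 hy) (by positivity)),
      eq_div_iff (by positivity), mul_comm]
    exact hw2
  refine ⟨n + 2, ?_⟩
  rw [iterate_succ_image, iterate_succ_image]
  refine ⟨w, image_mono hball (shell_subset_image hh hlam0 hnu (by linarith) ?_ ?_), hwy⟩
  · refine le_trans ?_ (abs_coord_le_norm w 0)
    refine le_trans ?_ (le_abs_self _)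
    linarith [(abs_le.1 hw0).1]
  · have h1 : ‖w‖ ≤ |w 0| + |w 1| + |w 2| := by
      refine abs_le_of_sq_le_sq' ?_ (by positivity) |>.2
      rw [norm_sq_three, ← sq_abs (w 0), ← sq_abs (w 1), ← sq_abs (w 2)]
      have := abs_nonneg (w 0)
      have := abs_nonneg (w 1)
      have := abs_nonneg (w 2)
      nlinarith [mul_nonneg (abs_nonneg (w 0)) (abs_nonneg (w 1)),
        mul_nonneg (abs_nonneg (w 0)) (abs_nonneg (w 2)),
        mul_nonneg (abs_nonneg (w 1)) (abs_nonneg (w 2))]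
    have h2 : |w 0| ≤ u + 8 * lam := by
      rw [abs_le] at hw0 ⊢
      constructor <;> linarith [hw0.1, hw0.2]
    rw [sub_zero] at hw1
    rw [hw2'] at h1
    have h3 : nu * lam * Real.exp (Z^[n] x 2 + R / 2) = u * Real.exp R := by
      rw [hu, mul_assoc (nu * lam), ← Real.exp_add]; ring_nf
    have h4 : 1 ≤ u := by
      have : 1 ≤ Real.exp (Z^[n] x 2 - R / 2) := Real.one_le_exp (by linarith)
      exact one_le_mul_of_one_le_of_one_le hκ this
    rw [h3]
    have h5 := Real.add_one_le_exp R
    have h6 : u * (R + 1) ≤ u * Real.exp R := mul_le_mul_of_nonneg_left h5 hu0.le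
    nlinarith

/-- The forward orbit of every non-empty open set covers everything but `0`. -/
lemma exists_mem_iterate_image (hh : IsSymmetricGenerator L h) (hlam : L ^ 5 < lam)
    (hnu : √(2 * L / lam) < nu) {V : Set (EuclideanSpace ℝ (Fin 3))} (hV : IsOpen V)
    (hVne : V.Nonempty) {y} (hy : y ≠ 0) : ∃ n, y ∈ (zorich h lam nu)^[n] '' V := by
  have hL := hh.one_le
  have hL5 : 1 ≤ L ^ 5 := one_le_pow₀ hL
  have hlam0 : 0 < lam := by linarith
  obtain ⟨hnu0, hκ, -⟩ := one_le_nu_mul_lam hL hlam hnu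
  obtain ⟨v, hv, n, m, hvm⟩ := exists_iterate_mem_plane hh hlam hnu hV hVne
  obtain ⟨σ, hσ, hvσ⟩ := exists_zorich_mem_plane (nu := nu) hh hlam0 hvm
  have hW : IsOpen ((zorich h lam nu)^[n + 1] '' V) :=
    isOpenMap_iterate (isOpenMap_zorich hh hlam0 hnu0) (n + 1) V hV
  rw [← Function.iterate_succ_apply' (zorich h lam nu)] at hvσ
  obtain ⟨x, hxW, hx⟩ := exists_tendsto_height hh hlam hnu hσ hW (mem_image_of_mem _ hv) hvσ
  obtain ⟨k, hk⟩ := exists_mem_image_of_tendsto hh (by linarith) hnu0 hκ hW hxW hx hy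
  refine ⟨k + (n + 1), ?_⟩
  rwa [Function.iterate_add, image_comp]

/-! ### Points have capacity zero -/

section capacity

variable {d : ℕ}

/-- A smooth bump function at the origin. -/
noncomputable def originBump (d : ℕ) : ContDiffBump (0 : EuclideanSpace ℝ (Fin d)) :=
  ⟨1, 2, one_pos, one_lt_two⟩

lemma enorm_zero_functional : ‖(0 : EuclideanSpace ℝ (Fin d) →L[ℝ] ℝ)‖ₑ = 0 := by
  rw [← ofReal_norm, norm_zero, ENNReal.ofReal_zero]

lemma norm_mem_of_fderiv_ne_zero {y : EuclideanSpace ℝ (Fin d)}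
    (hy : fderiv ℝ (originBump d) y ≠ 0) : 1 ≤ ‖y‖ ∧ ‖y‖ ≤ 2 := by
  constructor
  · by_contra! hlt
    refine hy ?_
    have h1 := (originBump d).eventuallyEq_one_of_mem_ball
      (show y ∈ ball 0 (1 : ℝ) from mem_ball_zero_iff.2 hlt)
    rw [h1.fderiv_eq]
    exact fderiv_const_apply 1
  · have h1 := support_fderiv_subset ℝ (f := originBump d) (Function.mem_support.2 hy)
    rw [(originBump d).tsupport_eq] at h1
    exact mem_closedBall_zero_iff.1 h1

/-- Test functions for the capacity of the origin. -/
noncomputable def bumpAverage (d N : ℕ) (x : EuclideanSpace ℝ (Fin d)) : ℝ :=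
  (N : ℝ)⁻¹ * ∑ j ∈ Finset.range N, originBump d ((4 : ℝ) ^ j • x)

lemma contDiff_bumpAverage (N : ℕ) : ContDiff ℝ ∞ (bumpAverage d N) :=
  contDiff_const.mul (ContDiff.sum fun j _ =>
    (originBump d).contDiff.comp (contDiff_const_smul ((4 : ℝ) ^ j)))

lemma support_bumpAverage_subset (N : ℕ) :
    Function.support (bumpAverage d N) ⊆ closedBall 0 2 := by
  intro x hx
  by_contra hlt
  rw [mem_closedBall_zero_iff, not_le] at hlt
  refine hx ?_
  rw [bumpAverage, Finset.sum_eq_zero, mul_zero]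
  intro j _
  refine (originBump d).zero_of_le_dist ?_
  rw [dist_zero_right, norm_smul, norm_pow, Real.norm_ofNat]
  have : (1 : ℝ) ≤ 4 ^ j := one_le_pow₀ (by norm_num)
  change (2 : ℝ) ≤ _
  nlinarith

lemma bumpAverage_zero {N : ℕ} (hN : N ≠ 0) : bumpAverage d N 0 = 1 := by
  have : originBump d 0 = 1 := (originBump d).one_of_mem_closedBall (by simp [originBump])
  simp [bumpAverage, this, hN]

lemma bumpAverage_nonneg (N : ℕ) (x) : 0 ≤ bumpAverage d N x :=
  mul_nonneg (by positivity) (Finset.sum_nonneg fun _ _ => (originBump d).nonneg)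

lemma fderiv_bumpAverage (N : ℕ) (x) : fderiv ℝ (bumpAverage d N) x =
    (N : ℝ)⁻¹ • ∑ j ∈ Finset.range N, (4 : ℝ) ^ j • fderiv ℝ (originBump d) ((4 : ℝ) ^ j • x) := by
  have hd : ∀ j ∈ Finset.range N, DifferentiableAt ℝ (fun x => originBump d ((4 : ℝ) ^ j • x)) x :=
    fun j _ => (((originBump d).contDiff (n := 1)).differentiable one_ne_zero).comp
      (differentiable_id.const_smul ((4 : ℝ) ^ j)) x
  unfold bumpAverage
  rw [fderiv_const_mul (DifferentiableAt.fun_sum hd), fderiv_fun_sum hd]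
  congr 1
  exact Finset.sum_congr rfl fun j _ => fderiv_comp_smul _

/-- The gradients of the summands live on the annuli `1 ≤ 4 ^ j ‖x‖ ≤ 2`, which are disjoint since
`4 > 2`. At each point at most one term survives, so the power of the sum is the sum of the powers.
-/
lemma enorm_fderiv_bumpAverage_pow (hd : d ≠ 0) (N : ℕ) (x) :
    ‖fderiv ℝ (bumpAverage d N) x‖ₑ ^ d = (N : ℝ≥0∞)⁻¹ ^ d *
      ∑ j ∈ Finset.range N, (4 ^ j * ‖fderiv ℝ (originBump d) ((4 : ℝ) ^ j • x)‖ₑ) ^ d := by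
  have h4 : ∀ j : ℕ, ‖(4 : ℝ) ^ j‖ₑ = 4 ^ j := by
    intro j
    rw [enorm_pow, Real.enorm_eq_ofReal (by norm_num)]; simp
  rw [fderiv_bumpAverage]
  rcases Nat.eq_zero_or_pos N with rfl | hN
  · simp [hd, enorm_zero_functional]
  rw [enorm_smul, mul_pow, enorm_inv (by positivity), Real.enorm_natCast]
  congr 1
  by_cases hex : ∃ j ∈ Finset.range N, fderiv ℝ (originBump d) ((4 : ℝ) ^ j • x) ≠ 0
  · obtain ⟨j, hj, hne⟩ := hex
    have huniq : ∀ i ∈ Finset.range N, i ≠ j → fderiv ℝ (originBump d) ((4 : ℝ) ^ i • x) = 0 := by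
      intro i _ hij
      by_contra hne'
      have h1 := norm_mem_of_fderiv_ne_zero hne
      have h2 := norm_mem_of_fderiv_ne_zero hne'
      rw [norm_smul, norm_pow, Real.norm_ofNat] at h1 h2
      have key : ∀ {a b : ℕ}, a < b → 1 ≤ 4 ^ a * ‖x‖ → 4 ^ b * ‖x‖ ≤ 2 → False := by
        intro a b hab ha hb
        have : (4 : ℝ) ^ (a + 1) ≤ 4 ^ b := pow_le_pow_right₀ (by norm_num) hab
        have := mul_le_mul_of_nonneg_right this (norm_nonneg x)
        rw [pow_succ] at this
        linarith
      rcases lt_or_gt_of_ne hij with h | h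
      · exact key h h2.1 h1.2
      · exact key h h1.1 h2.2
    rw [Finset.sum_eq_single_of_mem j hj fun i hi hij => by rw [huniq i hi hij, smul_zero],
      Finset.sum_eq_single_of_mem j hj fun i hi hij => by simp [huniq i hi hij, hd, enorm_zero_functional],
      enorm_smul, h4]
  · push Not at hex
    rw [Finset.sum_eq_zero fun i hi => by rw [hex i hi, smul_zero],
      Finset.sum_eq_zero fun i hi => by simp [hex i hi, hd, enorm_zero_functional]]
    simp [hd, enorm_zero_functional]

/-- The energy with exponent equal to the dimension is invariant under scaling, so one bound serves
for all `j`. -/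
lemma exists_lintegral_bump_le (hd : d ≠ 0) : ∃ B : ℝ≥0∞, B ≠ ⊤ ∧ ∀ j : ℕ,
    ∫⁻ x, (4 ^ j * ‖fderiv ℝ (originBump d) ((4 : ℝ) ^ j • x)‖ₑ) ^ d ≤ B := by
  have hc : Continuous (fderiv ℝ (originBump d)) :=
    ((originBump d).contDiff (n := 1)).continuous_fderiv one_ne_zero
  obtain ⟨M, hM⟩ := hc.bounded_above_of_compact_support
    ((originBump d).hasCompactSupport.fderiv (𝕜 := ℝ))
  refine ⟨ENNReal.ofReal (2 * M) ^ d * volume (ball (0 : EuclideanSpace ℝ (Fin d)) 1),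
    ENNReal.mul_ne_top (ENNReal.pow_ne_top ENNReal.ofReal_ne_top) measure_ball_lt_top.ne,
    fun j => ?_⟩
  have hle : ∀ x, (4 ^ j * ‖fderiv ℝ (originBump d) ((4 : ℝ) ^ j • x)‖ₑ) ^ d ≤
      (closedBall (0 : EuclideanSpace ℝ (Fin d)) (2 / 4 ^ j)).indicator
        (fun _ => (4 ^ j * ENNReal.ofReal M) ^ d) x := by
    intro x
    by_cases h0 : fderiv ℝ (originBump d) ((4 : ℝ) ^ j • x) = 0
    · simp [h0, hd, enorm_zero_functional]
    · have h1 := (norm_mem_of_fderiv_ne_zero h0).2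
      rw [norm_smul, norm_pow, Real.norm_ofNat] at h1
      rw [indicator_of_mem (mem_closedBall_zero_iff.2 ((le_div_iff₀' (by positivity)).2 h1))]
      gcongr
      rw [← ofReal_norm]
      exact ENNReal.ofReal_le_ofReal (hM _)
  refine (lintegral_mono hle).trans (le_of_eq ?_)
  rw [lintegral_indicator_const isClosed_closedBall.measurableSet,
    Measure.addHaar_closedBall _ _ (by positivity), ← mul_assoc]
  congr 1
  have h4 : (4 : ℝ≥0∞) ^ j = ENNReal.ofReal (4 ^ j) := by
    rw [ENNReal.ofReal_pow (by norm_num)]; simp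
  have hM0 : 0 ≤ M := (norm_nonneg _).trans (hM 0)
  rw [h4, ← ENNReal.ofReal_mul (by positivity), ← ENNReal.ofReal_pow (by positivity),
    ← ENNReal.ofReal_mul (by positivity), ← ENNReal.ofReal_pow (by positivity)]
  congr 1
  rw [finrank_euclideanSpace_fin, ← mul_pow]
  field_simp

/-- Averaging `N` bumps of disjoint gradient supports gives energy at most `N ^ (1 - d) * B`, which
tends to `0` because `d ≥ 2`. -/
lemma capZero_of_subset_singleton (hd : 2 ≤ d) {S : Set (EuclideanSpace ℝ (Fin d))}
    (hS : S ⊆ {0}) : CapZero S := by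
  intro F hF _
  have hF0 : F ⊆ {0} := hF.trans hS
  refine ⟨ball 0 3, isOpen_ball, isBounded_ball, hF0.trans (by simp), ?_⟩
  obtain ⟨B, hB, hBj⟩ := exists_lintegral_bump_le (d := d) (by omega)
  have hle : ∀ᶠ N : ℕ in atTop, condenserCap (ball 0 3) F ≤ B * (N : ℝ≥0∞)⁻¹ := by
    filter_upwards [eventually_ne_atTop 0] with N hN
    have hts : tsupport (bumpAverage d N) ⊆ closedBall 0 2 :=
      closure_minimal (support_bumpAverage_subset N) isClosed_closedBall
    have hone : ∀ x ∈ F, 1 ≤ bumpAverage d N x := fun x hx => by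
      rw [show x = 0 from hF0 hx, bumpAverage_zero hN]
    refine (iInf₂_le (bumpAverage d N) ⟨contDiff_bumpAverage N,
      HasCompactSupport.of_support_subset_isCompact (isCompact_closedBall 0 2)
        (support_bumpAverage_subset N),
      hts.trans (closedBall_subset_ball (by norm_num)), bumpAverage_nonneg N, hone⟩).trans ?_
    refine (setLIntegral_le_lintegral _ _).trans ?_
    have hc : Continuous (fderiv ℝ (originBump d)) :=
      ((originBump d).contDiff (n := 1)).continuous_fderiv one_ne_zero
    have hm : ∀ j : ℕ, Measurable fun x =>
        (4 ^ j * ‖fderiv ℝ (originBump d) ((4 : ℝ) ^ j • x)‖ₑ) ^ d := fun j =>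
      (((hc.comp (continuous_const_smul ((4 : ℝ) ^ j))).enorm.measurable).const_mul _).pow_const _
    simp_rw [enorm_fderiv_bumpAverage_pow (d := d) (by omega) N]
    rw [lintegral_const_mul _ (Finset.measurable_sum _ fun j _ => hm j),
      lintegral_finsetSum _ fun j _ => hm j]
    have hN0 : (N : ℝ≥0∞) ≠ 0 := by exact_mod_cast hN
    calc (N : ℝ≥0∞)⁻¹ ^ d * _ ≤ (N : ℝ≥0∞)⁻¹ ^ d * ∑ _j ∈ Finset.range N, B :=
          mul_le_mul_right (Finset.sum_le_sum fun j _ => hBj j) _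
      _ ≤ (N : ℝ≥0∞)⁻¹ ^ 2 * (N * B) := by
          rw [Finset.sum_const, Finset.card_range, nsmul_eq_mul]
          refine mul_le_mul_left (pow_le_pow_right_of_le_one' ?_ hd) _
          rw [ENNReal.inv_le_one]
          exact_mod_cast Nat.one_le_iff_ne_zero.2 hN
      _ = (N : ℝ≥0∞)⁻¹ * N * (B * (N : ℝ≥0∞)⁻¹) := by ring
      _ = _ := by rw [ENNReal.inv_mul_cancel hN0 (ENNReal.natCast_ne_top N), one_mul]
  have hlim : Tendsto (fun N : ℕ => B * (N : ℝ≥0∞)⁻¹) atTop (𝓝 0) := by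
    have := ENNReal.Tendsto.const_mul ENNReal.tendsto_inv_nat_nhds_zero (Or.inr hB)
    rwa [mul_zero] at this
  exact le_antisymm (ge_of_tendsto hlim hle) zero_le

end capacity

end Zorich

theorem theorem1p1 (L lam nu : ℝ)
    (h : EuclideanSpace ℝ (Fin 2) → EuclideanSpace ℝ (Fin 3))
    (hh : Zorich.IsSymmetricGenerator L h)
    (hlam : L ^ 5 < lam) (hnu : Real.sqrt (2 * L / lam) < nu) :
    Zorich.juliaSet (Zorich.zorich h lam nu) = Set.univ ∧
      ∀ V : Set (EuclideanSpace ℝ (Fin 3)), IsOpen V → V.Nonempty →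
        {0}ᶜ ⊆ ⋃ n : ℕ, (Zorich.zorich h lam nu)^[n] '' V := by
  refine ⟨Set.eq_univ_of_forall fun x U hU => ?_, fun V hV hVne y hy => ?_⟩
  · refine Zorich.capZero_of_subset_singleton (by norm_num) fun y hy => ?_
    by_contra hy0
    obtain ⟨V, hVU, hV, hxV⟩ := mem_nhds_iff.1 hU
    -- The Julia set counts only iterates with `k ≥ 1`. Removing `y` from `V` excludes `n = 0`.
    have hVy : (V \ {y}).Nonempty := by
      obtain ⟨z, hz, hzy⟩ := (infinite_of_mem_nhds x (hV.mem_nhds hxV)).exists_notMem_finset {y}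
      exact ⟨z, hz, by simpa using hzy⟩
    obtain ⟨n, hn⟩ := Zorich.exists_mem_iterate_image hh hlam hnu (hV.sdiff isClosed_singleton) hVy hy0
    have hn0 : n ≠ 0 := by
      rintro rfl
      rw [Function.iterate_zero, Set.image_id] at hn
      exact hn.2 rfl
    refine hy (Set.mem_iUnion₂.2 ⟨n, Nat.one_le_iff_ne_zero.2 hn0, ?_⟩)
    exact Set.image_mono (Set.sdiff_subset.trans hVU) hn
  · exact Set.mem_iUnion.2 (Zorich.exists_mem_iterate_image hh hlam hnu hV hVne hy)
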